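/- **Conventions.** Let $k$ be a field of characteristic zero and $R=k[[\hbar]]$. All complexes are cohomologically $\mathbb{Z}$-graded over $R$, and algebras are associative but not necessarily unital unless stated. Put $w(n)=1$ for $n\ge 2$ and $w(n)=0$ for $n\le 1$. A *$\mathbb{BD}_2$-algebra* is a dga $A$ over $R$ with a dg Lie bracket $\{,\}$ of degree $-1$ (so $\{x,y\}=(-1)^{|x||y|}\{y,x\}$, $\mathrm{d}\{x,y\}=-\{\mathrm{d}x,y\}-(-1)^{|x|}\{x,\mathrm{d}y\}$ and $\{\{x,y\},z\}+(-1)^{|y||z|}\{\{x,z\},y\}+(-1)^{|x|(|y|+|z|)}\{\{y,z\},x\}=0$), and with braces $x\{y_1,\dots,y_n\}$ of degree $-n$ ($n>0$; $x\{\}=x$) such that: * (Associativity) $\hbar^{w(n)w(m)}\,x\{y_1,\dots,y_n\}\{z_1,\dots,z_m\}=\sum(-1)^{\epsilon}\hbar^{q}\,x\{z_1,\dots,z_{i_1},y_1\{z_{i_1+1},\dots,z_{i_1+l_1}\},\dots,y_n\{z_{i_n+1},\dots,z_{i_n+l_n}\},\dots,z_m\}$, where the sum is over all locations $i_p$ and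 lengths $l_p\ge 0$, $\epsilon=\sum_p(|y_p|+1)\sum_{r\le i_p}(|z_r|+1)$, and $q$ makes the relation homogeneous when $\hbar$ has weight $-1$ and an $n$-fold brace has weight $w(n)$; * (Higher homotopies) for $n\geq 1$, $$\hbar^{\delta_{n,2}}\Big(\mathrm{d}(x\{y_1,\dots,y_n\})-(\mathrm{d}x)\{y_1,\dots,y_n\}-\sum_i(-1)^{|x|+\sum_{q<i}|y_q|+i}x\{y_1,\dots,\mathrm{d}y_i,\dots,y_n\}\Big)$$ $$=\sum_{i<n}(-1)^{|x|+\sum_{q\le i}|y_q|+i+1}x\{\dots,y_iy_{i+1},\dots\}-(-1)^{(|y_1|+1)|x|}y_1\cdot x\{y_2,\dots,y_n\}-(-1)^{|x|+\sum_{q<n}|y_q|+n}x\{y_1,\dots,y_{n-1}\}\cdot y_n;$$ * (Distributivity) $\hbar^{\delta_{n,2}}(x_1x_2)\{y_1,\dots,y_n\}=\sum_{j=0}^n(-1)^{|x_2|(\sum_{q\le j}|y_q|+j)}\hbar^{q}\,x_1\{y_1,\dots,y_j\}\,x_2\{y_{j+1},\dots,y_n\}$, with $q$ again determined by the weights; *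 $\hbar\{x,y\}=(-1)^{|x|}x\{y\}+(-1)^{|y|(|x|+1)}y\{x\}$; * (Homotopy Leibniz rule) $\mathrm{d}(x\{y_1,y_2\})-(\mathrm{d}x)\{y_1,y_2\}-(-1)^{|x|+1}x\{\mathrm{d}y_1,y_2\}-(-1)^{|x|+|y_1|}x\{y_1,\mathrm{d}y_2\}=(-1)^{|y_1|}\{x,y_1y_2\}-(-1)^{|y_1|}\{x,y_1\}y_2-(-1)^{|x||y_1|}y_1\{x,y_2\}$. The same structure without bracket (and so without the last two relations), over a commutative ring and with $\hbar$ replaced by $1$, is a *brace algebra*. A *$\mathbb{BD}_1$-algebra* is a dga over $R$ with a dg Lie bracket of degree $0$ satisfying $\hbar\{x,y\}=xy-(-1)^{|x||y|}yx$ and $\{x,yz\}=\{x,y\}z+(-1)^{|x||y|}y\{x,z\}$. For a dga $A$ let $\mathrm{T}_\bullet(A[1])=\bigoplus_n A^{\otimes n}[n]$ be the bar complex, with $[a_1|\dots|a_n]$ in degree $\sum(|a_i|-1)$, the deconcatenation coproduct $\Delta$, the counit projecting to $n=0$, and $$\mathrm{d}[a_1|\dots|a_n]=\sum_i(-1)^{\sum_{q<i}|a_q|+i-1}[\dots|\mathrm{d}a_i|\dots]+\sum_{i<n}(-1)^{\sum_{q\le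 i}|a_q|+i}[\dots|a_ia_{i+1}|\dots].$$ If $A$ is a $\mathbb{BD}_2$-algebra, define a product on it by $$[x_1|\dots|x_n]\cdot[y_1|\dots|y_m]=\sum_{\{i_p,l_p\}}(-1)^{\epsilon}\hbar^{q}[y_1|\dots|y_{i_1}|x_1\{y_{i_1+1},\dots,y_{i_1+l_1}\}|\dots|x_n\{y_{i_n+1},\dots,y_{i_n+l_n}\}|\dots|y_m],$$ where $\epsilon=\sum_p(|x_p|+1)\sum_{r\le i_p}(|y_r|+1)$ and $q=\#\{p: l_p>1\}$. For a brace algebra the same formula is used with $\hbar$ replaced by $1$. **Proposition.** Let $A$ be a $\mathbb{BD}_2$-algebra. 1. There is exactly one dg bialgebra (unital and counital) on $\mathrm{T}_\bullet(A[1])$ with this grading, differential, product, coproduct, counit and with unit $[]$. 2. For all homogeneous $a,b\in\mathrm{T}_\bullet(A[1])$ the commutator $ab-(-1)^{|a||b|}ba$ lies in $\hbar\,\mathrm{T}_\bullet(A[1])$. 3. Suppose that $A$ has no $\hbar$-torsion. Then $\{a,b\}=\big(ab-(-1)^{|a||b|}ba\big)/\hbar$ is a well-defined bilinear bracket, which makes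 $\mathrm{T}_\bullet(A[1])$ a $\mathbb{BD}_1$-algebra, compatibly with the coalgebra structure: $\Delta$ is a morphism of $\mathbb{BD}_1$-algebras, where the tensor square has the bracket $\{a\otimes a',b\otimes b'\}=(-1)^{|a'||b|}\big(\{a,b\}\otimes(-1)^{|a'||b'|}b'a'+ab\otimes\{a',b'\}\big)$. 4. (Limit $\hbar=0$.) If, in the situation of 3, all braces $x\{y_1,\dots,y_n\}$, $n\ge1$, lie in $\hbar A$, then modulo $\hbar\,\mathrm{T}_\bullet(A[1])$ the product is the shuffle product and the bracket is the one of the $\mathbb{P}_1$-bialgebra attached to a $\mathbb{P}_2$-algebra, $$\{[x_1|\dots|x_n],[y_1|\dots|y_m]\}\equiv\sum_{i,j}(-1)^{\epsilon_{ij}+|x_i|}\big([x_1|\dots|x_{i-1}]\cdot[y_1|\dots|y_{j-1}]\big)\wedge[\{x_i,y_j\}]\wedge\big([x_{i+1}|\dots|x_n]\cdot[y_{j+1}|\dots|y_m]\big),$$ where on the right $\cdot$ is the shuffle product, $\wedge$ is concatenation, and $(-1)^{\epsilon_{ij}}$ is the Koszul sign, for letters $x$ of degree $|x|-1$, of moving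 $y_1,\dots,y_{j-1}$ past $x_i,\dots,x_n$ and $y_j$ past $x_{i+1},\dots,x_n$. 5. (Brace algebras.) The dga $A$ with the rescaled braces $\hbar^{w(n)}x\{y_1,\dots,y_n\}$ is a brace algebra over $R$, and the dg bialgebra of 1 is the one built from this brace algebra. -/

import Mathlib

open scoped TensorProduct DirectSum PowerSeries

noncomputable section

namespace BDBar

/-! ### Words in the tensor module

For an `R`-module `A` the module `TensorAlgebra R A` is `⨁ n, A^{⊗ n}`; the word `[y₁|...|yₙ]` is
the pure tensor `y₁ ⊗ ... ⊗ yₙ`, and `*` in `TensorAlgebra R A` is the concatenation of words. -/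

section Words

/-- The word `[y₁|...|yₙ]`. -/
def word (R : Type*) [CommRing R] {A : Type*} [AddCommGroup A] [Module R A] {n : ℕ}
    (y : Fin n → A) : TensorAlgebra R A :=
  TensorAlgebra.tprod R A n y

/-- The subword `[y_s|...|y_{s+l-1}]` of length `l` of `[y_0|...|y_{m-1}]`, counting from `0`. -/
def seg (R : Type*) [CommRing R] {A : Type*} [AddCommGroup A] [Module R A] {m : ℕ}
    (y : Fin m → A) (s l : ℕ) : TensorAlgebra R A :=
  (((List.ofFn fun i => TensorAlgebra.ι R (y i)).drop s).take l).prod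

/-- The weight of a brace `x{y₁,...,yₙ}`: it is `1` if `n ≥ 2` and `0` otherwise. -/
def wt (n : ℕ) : ℕ := if 2 ≤ n then 1 else 0

/-- The families `{i_p, l_p}` of locations `i_p` and lengths `l_p` (`p = 1,...,n`) of the braces in
`[y₁|...|y_{i_1}|x₁{y_{i_1+1},...,y_{i_1+l_1}}|...|xₙ{y_{i_n+1},...,y_{i_n+l_n}}|...|y_m]`. -/
def insertions (n m : ℕ) : Finset ((Fin n → Fin (m + 1)) × (Fin n → Fin (m + 1))) :=
  Finset.univ.filter fun c =>
    (∀ p, (c.1 p : ℕ) + c.2 p ≤ m) ∧ ∀ p p', p < p' → (c.1 p : ℕ) + c.2 p ≤ c.1 p'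

/-- The exponent `∑_p (|x_p| + 1) ∑_{q ≤ i_p} (|y_q| + 1)` of the sign of an insertion,
for `|x_p| = a p` and `|y_q| = b q`. -/
def insertionExp {n m : ℕ} (a : Fin n → ℤ) (b : Fin m → ℤ)
    (c : (Fin n → Fin (m + 1)) × (Fin n → Fin (m + 1))) : ℤ :=
  ∑ p, (a p + 1) * ∑ q ∈ Finset.univ.filter (fun q : Fin m => (q : ℕ) < c.1 p), (b q + 1)

/-- The number of letters `y_q` used up by the first `p` braces and the gaps before them; as the
braces are ordered, this is `i_p + l_p` (and `0` for `p = 0`). -/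
def insertionEnd {n m : ℕ} (c : (Fin n → Fin (m + 1)) × (Fin n → Fin (m + 1))) (p : ℕ) : ℕ :=
  (Finset.univ.filter fun p' : Fin n => (p' : ℕ) < p).sup fun p' => (c.1 p' : ℕ) + c.2 p'

/-- The word
`[y₁|...|y_{i_1}|x₁{y_{i_1+1},...,y_{i_1+l_1}}|...|xₙ{y_{i_n+1},...,y_{i_n+l_n}}|...|y_m]`. -/
def insertionWord {R : Type*} [CommRing R] {A : Type*} [AddCommGroup A] [Module R A]
    (brace : A →ₗ[R] TensorAlgebra R A →ₗ[R] A) {n m : ℕ} (x : Fin n → A) (y : Fin m → A)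
    (c : (Fin n → Fin (m + 1)) × (Fin n → Fin (m + 1))) : TensorAlgebra R A :=
  (List.ofFn fun p : Fin n =>
      seg R y (insertionEnd c p) ((c.1 p : ℕ) - insertionEnd c p) *
        TensorAlgebra.ι R (brace (x p) (seg R y (c.1 p) (c.2 p)))).prod *
    seg R y (insertionEnd c n) (m - insertionEnd c n)

end Words

/-! ### Differential graded algebras, brace algebras and `𝔹𝔻₂`-algebras -/

/-- The structure of a (not necessarily unital) differential `ℤ`-graded associative algebra over
`R` on the module `A`, with differential of degree `1`. -/
structure DGA (R : Type*) [CommRing R] (A : Type*) [AddCommGroup A] [Module R A] where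
  gr : ℤ → Submodule R A
  internal : DirectSum.IsInternal gr
  d : A →ₗ[R] A
  d_mem : ∀ i x, x ∈ gr i → d x ∈ gr (i + 1)
  d_d : ∀ x, d (d x) = 0
  mul : A →ₗ[R] A →ₗ[R] A
  mul_mem : ∀ i j x y, x ∈ gr i → y ∈ gr j → mul x y ∈ gr (i + j)
  mul_assoc : ∀ x y z, mul (mul x y) z = mul x (mul y z)
  d_mul : ∀ i x y, x ∈ gr i → d (mul x y) = mul (d x) y + i.negOnePow • mul x (d y)

/-- A dga with brace operations `x{y₁,...,yₙ}` of degree `-n`, satisfying the associativity, higher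
homotopy and distributivity relations, made homogeneous by powers of an element `t` of `R`: `t` has
weight `-1` and `x{y₁,...,yₙ}` has weight `wt n`. In each relation the power of `t` in front of a
term of weight `w` is `t ^ (w - w₀)`, where `w₀` is the least weight that occurs in the relation.
For `t = 1` these are the brace algebras, for `t = ħ` these are the relations of a `𝔹𝔻₂`-algebra
which involve braces only.

The braces are collected in one map `A ⊗ (⨁ n, A^{⊗ n}) → A`, with `x{} = x` for `n = 0`. -/
structure WeightedBraceAlgebra (R : Type*) [CommRing R] (t : R)
    (A : Type*) [AddCommGroup A] [Module R A] extends DGA R A where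
  brace : A →ₗ[R] TensorAlgebra R A →ₗ[R] A
  brace_one : ∀ x, brace x 1 = x
  brace_mem : ∀ (n : ℕ) (a : ℤ) (b : Fin n → ℤ) (x : A) (y : Fin n → A),
    x ∈ gr a → (∀ i, y i ∈ gr (b i)) → brace x (word R y) ∈ gr (a + ∑ i, b i - (n : ℤ))
  /-- Associativity. The weights are `wt n + wt m` on the left and `wt (n + m - ∑ l_p) + ∑ wt l_p`
  on the right; the least weight in the relation is `wt n + wt m - wt n * wt m`. -/
  brace_brace : ∀ (n m : ℕ) (b : Fin n → ℤ) (c : Fin m → ℤ)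
    (x : A) (y : Fin n → A) (z : Fin m → A),
    (∀ i, y i ∈ gr (b i)) → (∀ i, z i ∈ gr (c i)) →
    t ^ (wt n * wt m) • brace (brace x (word R y)) (word R z) =
      ∑ e ∈ insertions n m, (insertionExp b c e).negOnePow •
        t ^ (wt (n + m - ∑ p, (e.2 p : ℕ)) + ∑ p, wt (e.2 p) + wt n * wt m - (wt n + wt m)) •
          brace x (insertionWord brace y z e)
  /-- Higher homotopies, for the `n + 1` arguments `y₁, ..., y_{n+1}`. -/
  d_brace : ∀ (n : ℕ) (a : ℤ) (b : Fin (n + 1) → ℤ) (x : A) (y : Fin (n + 1) → A),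
    x ∈ gr a → (∀ i, y i ∈ gr (b i)) →
    t ^ (if n + 1 = 2 then 1 else 0) • d (brace x (word R y)) =
      t ^ (if n + 1 = 2 then 1 else 0) • brace (d x) (word R y)
      + t ^ (if n + 1 = 2 then 1 else 0) • (∑ i : Fin (n + 1),
          (a + ∑ q ∈ Finset.univ.filter (· < i), b q + ((i : ℕ) + 1 : ℤ)).negOnePow •
            brace x (word R (Function.update y i (d (y i)))))
      + ∑ i : Fin n,
          (a + ∑ q ∈ Finset.univ.filter (· ≤ i.castSucc), b q + ((i : ℕ) + 1 : ℤ) + 1).negOnePow •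
            brace x (seg R y 0 (i : ℕ) * TensorAlgebra.ι R (mul (y i.castSucc) (y i.succ)) *
              seg R y ((i : ℕ) + 2) (n - 1 - (i : ℕ)))
      - ((b 0 + 1) * a).negOnePow • mul (y 0) (brace x (seg R y 1 n))
      - (a + ∑ q : Fin n, b q.castSucc + (n + 1 : ℤ)).negOnePow •
          mul (brace x (seg R y 0 n)) (y (Fin.last n))
  /-- Distributivity. Only for `n = 2` is `wt n` not the least weight in the relation. -/
  mul_brace : ∀ (n : ℕ) (a₁ a₂ : ℤ) (b : Fin n → ℤ) (x₁ x₂ : A) (y : Fin n → A),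
    x₁ ∈ gr a₁ → x₂ ∈ gr a₂ → (∀ i, y i ∈ gr (b i)) →
    ∑ j ∈ Finset.range (n + 1),
      (a₂ * (∑ q ∈ Finset.univ.filter (fun q : Fin n => (q : ℕ) < j), b q + (j : ℤ))).negOnePow •
        t ^ (wt j + wt (n - j) + (if n = 2 then 1 else 0) - wt n) •
          mul (brace x₁ (seg R y 0 j)) (brace x₂ (seg R y j (n - j))) =
      t ^ (if n = 2 then 1 else 0) • brace (mul x₁ x₂) (word R y)

/-- Brace algebras over `R`. -/
abbrev BraceAlgebra (R : Type*) [CommRing R] (A : Type*) [AddCommGroup A] [Module R A] :=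
  WeightedBraceAlgebra R 1 A

/-- `𝔹𝔻₂`-algebras over `k⟦ħ⟧`, where `ħ = PowerSeries.X`. -/
structure BD2Algebra (k : Type*) [Field k] (A : Type*) [AddCommGroup A] [Module k⟦X⟧ A]
    extends WeightedBraceAlgebra k⟦X⟧ PowerSeries.X A where
  /-- The Lie bracket of degree `-1`. -/
  bracket : A →ₗ[k⟦X⟧] A →ₗ[k⟦X⟧] A
  bracket_mem : ∀ i j x y, x ∈ gr i → y ∈ gr j → bracket x y ∈ gr (i + j - 1)
  bracket_symm : ∀ i j x y, x ∈ gr i → y ∈ gr j →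
    bracket x y = (i * j).negOnePow • bracket y x
  jacobi : ∀ i j l x y z, x ∈ gr i → y ∈ gr j → z ∈ gr l →
    bracket (bracket x y) z + (j * l).negOnePow • bracket (bracket x z) y
      + (i * (j + l)).negOnePow • bracket (bracket y z) x = 0
  d_bracket : ∀ i x y, x ∈ gr i →
    d (bracket x y) = -bracket (d x) y - i.negOnePow • bracket x (d y)
  hbar_bracket : ∀ i j x y, x ∈ gr i → y ∈ gr j →
    (PowerSeries.X : k⟦X⟧) • bracket x y =
      i.negOnePow • brace x (word k⟦X⟧ ![y]) + (j * (i + 1)).negOnePow • brace y (word k⟦X⟧ ![x])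
  homotopy_leibniz : ∀ i j x y₁ y₂, x ∈ gr i → y₁ ∈ gr j →
    d (brace x (word k⟦X⟧ ![y₁, y₂])) - brace (d x) (word k⟦X⟧ ![y₁, y₂])
        - (i + 1).negOnePow • brace x (word k⟦X⟧ ![d y₁, y₂])
        - (i + j).negOnePow • brace x (word k⟦X⟧ ![y₁, d y₂]) =
      j.negOnePow • bracket x (mul y₁ y₂) - j.negOnePow • mul (bracket x y₁) y₂
        - (i * j).negOnePow • mul y₁ (bracket x y₂)

/-- `𝔹𝔻₁`-algebras over `k⟦ħ⟧`, where `ħ = PowerSeries.X`. -/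
structure BD1Algebra (k : Type*) [Field k] (B : Type*) [AddCommGroup B] [Module k⟦X⟧ B]
    extends DGA k⟦X⟧ B where
  /-- The Lie bracket of degree `0`. -/
  bracket : B →ₗ[k⟦X⟧] B →ₗ[k⟦X⟧] B
  bracket_mem : ∀ i j x y, x ∈ gr i → y ∈ gr j → bracket x y ∈ gr (i + j)
  bracket_symm : ∀ i j x y, x ∈ gr i → y ∈ gr j →
    bracket x y = -((i * j).negOnePow • bracket y x)
  jacobi : ∀ i j x y z, x ∈ gr i → y ∈ gr j →
    bracket x (bracket y z) =
      bracket (bracket x y) z + (i * j).negOnePow • bracket y (bracket x z)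
  d_bracket : ∀ i x y, x ∈ gr i →
    d (bracket x y) = bracket (d x) y + i.negOnePow • bracket x (d y)
  hbar_bracket : ∀ i j x y, x ∈ gr i → y ∈ gr j →
    (PowerSeries.X : k⟦X⟧) • bracket x y = mul x y - (i * j).negOnePow • mul y x
  leibniz : ∀ i j x y z, x ∈ gr i → y ∈ gr j →
    bracket x (mul y z) = mul (bracket x y) z + (i * j).negOnePow • mul y (bracket x z)

/-! ### Tensor squares of graded modules -/

section Tensor

variable {R : Type*} [CommRing R] {B : Type*} [AddCommGroup B] [Module R B]

/-- A module with an internal grading as a direct sum. -/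
def grEquiv (gr : ℤ → Submodule R B) (h : DirectSum.IsInternal gr) : (⨁ i, gr i) ≃ₗ[R] B :=
  LinearEquiv.ofBijective (DirectSum.coeLinearMap gr) h

/-- The map `x ↦ (-1)^{|x|} x`. -/
def parity (gr : ℤ → Submodule R B) (h : DirectSum.IsInternal gr) : B →ₗ[R] B :=
  DirectSum.toModule R ℤ B (fun i => i.negOnePow • (gr i).subtype) ∘ₗ (grEquiv gr h).symm

/-- The Koszul swap `x ⊗ y ↦ (-1)^{|x||y|} y ⊗ x`. -/
def koszulSwap (gr : ℤ → Submodule R B) (h : DirectSum.IsInternal gr) : B ⊗[R] B →ₗ[R] B ⊗[R] B :=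
  (TensorProduct.congr (grEquiv gr h) (grEquiv gr h)).toLinearMap ∘ₗ
    (TensorProduct.gradedComm R (fun i => gr i) (fun i => gr i)).toLinearMap ∘ₗ
      (TensorProduct.congr (grEquiv gr h).symm (grEquiv gr h).symm).toLinearMap

/-- The degree `i` part of `B ⊗ B`. -/
def tensorGr (gr : ℤ → Submodule R B) (i : ℤ) : Submodule R (B ⊗[R] B) :=
  ⨆ j : ℤ, Submodule.map₂ (TensorProduct.mk R B B) (gr j) (gr (i - j))

/-- The bilinear operation `(x ⊗ x', y ⊗ y') ↦ (-1)^{|x'||y|} f(x, y) ⊗ g(x', y')` on `B ⊗ B`. -/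
def tensorOp (gr : ℤ → Submodule R B) (h : DirectSum.IsInternal gr) (f g : B →ₗ[R] B →ₗ[R] B) :
    B ⊗[R] B →ₗ[R] B ⊗[R] B →ₗ[R] B ⊗[R] B :=
  TensorProduct.curry <|
    TensorProduct.map (TensorProduct.lift f) (TensorProduct.lift g) ∘ₗ
      (TensorProduct.assoc R B B (B ⊗[R] B)).symm.toLinearMap ∘ₗ
        ((TensorProduct.assoc R B B B).toLinearMap ∘ₗ (koszulSwap gr h).rTensor B ∘ₗ
            (TensorProduct.assoc R B B B).symm.toLinearMap).lTensor B ∘ₗ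
          (TensorProduct.assoc R B B (B ⊗[R] B)).toLinearMap

/-- The opposite operation `(x, y) ↦ (-1)^{|x||y|} f(y, x)`. -/
def koszulOp (gr : ℤ → Submodule R B) (h : DirectSum.IsInternal gr) (f : B →ₗ[R] B →ₗ[R] B) :
    B →ₗ[R] B →ₗ[R] B :=
  TensorProduct.curry (TensorProduct.lift f ∘ₗ koszulSwap gr h)

end Tensor

/-! ### Bialgebras -/

/-- Differential graded bialgebras over `R`: unital and counital dg algebras and dg coalgebras
whose comultiplication and counit are morphisms of dg algebras. -/
structure DGBialgebra (R : Type*) [CommRing R] (B : Type*) [AddCommGroup B] [Module R B]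
    extends DGA R B where
  one : B
  one_mem : one ∈ gr 0
  one_mul : ∀ x, mul one x = x
  mul_one : ∀ x, mul x one = x
  coalg : Coalgebra R B
  comul_mem : ∀ i x, x ∈ gr i → coalg.comul x ∈ tensorGr gr i
  counit_mem : ∀ i x, x ∈ gr i → i ≠ 0 → coalg.counit x = 0
  comul_d : ∀ x, coalg.comul (d x) =
    (d.rTensor B + TensorProduct.map (parity gr internal) d) (coalg.comul x)
  counit_d : ∀ x, coalg.counit (d x) = 0
  comul_mul : ∀ x y, coalg.comul (mul x y) =
    tensorOp gr internal mul mul (coalg.comul x) (coalg.comul y)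
  comul_one : coalg.comul one = one ⊗ₜ one
  counit_mul : ∀ x y, coalg.counit (mul x y) = coalg.counit x * coalg.counit y
  counit_one : coalg.counit one = 1

/-- `𝔹𝔻₁`-algebras with a compatible coalgebra structure: dg bialgebras which are
`𝔹𝔻₁`-algebras, such that the comultiplication also preserves the brackets, where the bracket on
`B ⊗ B` is
`{x ⊗ x', y ⊗ y'} = (-1)^{|x'||y|} ({x, y} ⊗ (-1)^{|x'||y'|} y'x' + xy ⊗ {x', y'})`. -/
structure BD1Bialgebra (k : Type*) [Field k] (B : Type*) [AddCommGroup B] [Module k⟦X⟧ B]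
    extends DGBialgebra k⟦X⟧ B, BD1Algebra k B where
  comul_bracket : ∀ x y, coalg.comul (bracket x y) =
    (tensorOp gr internal bracket (koszulOp gr internal mul) + tensorOp gr internal mul bracket)
      (coalg.comul x) (coalg.comul y)

/-! ### The bar complex -/

section BarComplex

variable {R : Type*} [CommRing R] {A : Type*} [AddCommGroup A] [Module R A]

/-- The grading of `T(A[1])`: the word `[y₁|...|yₙ]` has degree `∑ (|y_q| - 1)`. -/
def barGr (gr : ℤ → Submodule R A) (i : ℤ) : Submodule R (TensorAlgebra R A) :=
  Submodule.span R {w | ∃ (n : ℕ) (b : Fin n → ℤ) (y : Fin n → A),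
    (∀ q, y q ∈ gr (b q)) ∧ ∑ q, (b q - 1) = i ∧ w = word R y}

/-- The dg bialgebra `D` on `T(A[1])` is the bar complex of the dga `S`, with the deconcatenation
coproduct, and with the product built from the braces of `S`, in which each brace with at least two
arguments comes with a factor `t`. Since words of homogeneous elements span `T(A[1])`, these
formulas determine all operations of `D`. -/
structure IsBarBialgebra {t : R} (S : WeightedBraceAlgebra R t A)
    (D : DGBialgebra R (TensorAlgebra R A)) : Prop where
  gr_eq : D.gr = barGr S.gr
  one_eq : D.one = 1
  comul_word : ∀ (n : ℕ) (y : Fin n → A),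
    D.coalg.comul (word R y) = ∑ i ∈ Finset.range (n + 1), seg R y 0 i ⊗ₜ seg R y i (n - i)
  counit_word : ∀ (n : ℕ) (y : Fin n → A), D.coalg.counit (word R y) = if n = 0 then 1 else 0
  d_word : ∀ (n : ℕ) (b : Fin n → ℤ) (y : Fin n → A), (∀ q, y q ∈ S.gr (b q)) →
    D.d (word R y) =
      ∑ i : Fin n, (∑ q ∈ Finset.univ.filter (· < i), b q + ((i : ℕ) : ℤ)).negOnePow •
          word R (Function.update y i (S.d (y i)))
      + ∑ i : Fin n, if h : (i : ℕ) + 1 < n then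
          (∑ q ∈ Finset.univ.filter (· ≤ i), b q + ((i : ℕ) + 1 : ℤ)).negOnePow •
            (seg R y 0 (i : ℕ) * TensorAlgebra.ι R (S.mul (y i) (y ⟨(i : ℕ) + 1, h⟩)) *
              seg R y ((i : ℕ) + 2) (n - 2 - (i : ℕ)))
        else 0
  mul_word : ∀ (n m : ℕ) (a : Fin n → ℤ) (b : Fin m → ℤ) (x : Fin n → A) (y : Fin m → A),
    (∀ p, x p ∈ S.gr (a p)) → (∀ q, y q ∈ S.gr (b q)) →
    D.mul (word R x) (word R y) =
      ∑ e ∈ insertions n m, (insertionExp a b e).negOnePow •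
        t ^ (∑ p, wt (e.2 p)) • insertionWord S.brace x y e

/-- The part of a family before the index `i`. -/
def before {X : Type*} {n : ℕ} (x : Fin n → X) (i : Fin n) : Fin i → X :=
  fun q => x ⟨q, q.isLt.trans i.isLt⟩

/-- The part of a family after the index `i`. -/
def after {X : Type*} {n : ℕ} (x : Fin n → X) (i : Fin n) : Fin (n - ((i : ℕ) + 1)) → X :=
  fun q => x ⟨(i : ℕ) + 1 + (q : ℕ), by have := q.isLt; omega⟩

/-- The shuffle product of the words `[x₁|...|xₙ]` and `[y₁|...|y_m]`, for `|x_p| = a p` and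
`|y_q| = b q`: the sum of all words in the letters `x_p` and `y_q` which keep the order of the
`x_p` and of the `y_q`, with the Koszul sign for the degrees `|x_p| - 1` and `|y_q| - 1`. -/
def shuffleProd (R : Type*) [CommRing R] {A : Type*} [AddCommGroup A] [Module R A] {n m : ℕ}
    (a : Fin n → ℤ) (b : Fin m → ℤ) (x : Fin n → A) (y : Fin m → A) : TensorAlgebra R A :=
  ∑ σ ∈ Finset.univ.filter (fun σ : Equiv.Perm (Fin (n + m)) =>
      (∀ p p' : Fin n, p < p' → σ.symm (Fin.castAdd m p) < σ.symm (Fin.castAdd m p')) ∧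
        ∀ q q' : Fin m, q < q' → σ.symm (Fin.natAdd n q) < σ.symm (Fin.natAdd n q')),
    (∑ u : Fin (n + m), ∑ v ∈ Finset.univ.filter (fun v => u < v ∧ σ v < σ u),
        (Fin.append a b (σ u) - 1) * (Fin.append a b (σ v) - 1)).negOnePow •
      word R (Fin.append x y ∘ σ)

/-- The bracket of words on the bar complex of a `ℙ₂`-algebra with bracket `br`, that is, the sum
over `i`, `j` of
`± ([x₁|...|x_{i-1}] · [y₁|...|y_{j-1}]) ∧ [{x_i, y_j}] ∧ ([x_{i+1}|...|xₙ] · [y_{j+1}|...|y_m])`,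
where `·` is the shuffle product, and the sign is `(-1)^{|x_i|}` times the Koszul sign (for the
degrees `|x_p| - 1` and `|y_q| - 1`) of moving `y₁, ..., y_{j-1}` past `x_i, ..., xₙ` and `y_j`
past `x_{i+1}, ..., xₙ`. -/
def poissonBracket (br : A →ₗ[R] A →ₗ[R] A) {n m : ℕ}
    (a : Fin n → ℤ) (b : Fin m → ℤ) (x : Fin n → A) (y : Fin m → A) : TensorAlgebra R A :=
  ∑ i : Fin n, ∑ j : Fin m,
    (a i + (∑ q, (before b j q - 1)) * (a i - 1 + ∑ p, (after a i p - 1))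
        + (b j - 1) * ∑ p, (after a i p - 1)).negOnePow •
      (shuffleProd R (before a i) (before b j) (before x i) (before y j) *
        TensorAlgebra.ι R (br (x i) (y j)) *
          shuffleProd R (after a i) (after b j) (after x i) (after y j))

end BarComplex

end BDBar

end

open scoped TensorProduct DirectSum PowerSeries

noncomputable section

namespace BDBar

section CofreeCoalgebra

variable {R : Type*} [CommRing R] {A : Type*} [AddCommGroup A] [Module R A]

local notation "𝕋" => TensorAlgebra R A
local notation "ιT" => TensorAlgebra.ι R

/-! ### The deconcatenation coalgebra -/

/-! Multiplying the brace with `n` arguments by `ħ ^ wt n` turns the weighted relations into those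
of a brace algebra, and the powers of `ħ` in the product formula are exactly those absorbed by the
rescaled braces (`WeightedBraceAlgebra.rescale`, `isBarBialgebra_rescale_iff`). So the existence of
the dg bialgebra is a statement about brace algebras; uniqueness holds because homogeneous words
span.

For a brace algebra, the point is that `T(A[1])` with deconcatenation is cogenerated by the
projection `letter` to words of length one: an element vanishes as soon as its counit and `(1 ⊗
letter) Δ` of it vanish (`eq_zero_of_lTensor_letter_decon`). The product `barMul` is defined by
recursion on the last letter of the left factor, `(w|a)·y = ∑ ± (w·y') ∧ [a{y''}] ∧ y'''`, and is a
coalgebra map (`decon_barMul`); the differential `barD` is the coderivation with letter component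
`letterD` (`decon_barD`). By induction on the total length, associativity, the Leibniz rule and `d²
= 0` then need to be checked only after applying `letter` (`IsWordCoalgebra.mul_assoc`,
`IsWordCoalgebra.d_mul`, `IsWordCoalgebra.d_d`). There they become the axioms of `A`: associativity
is `a{v}{w} = a{v·w}`; the Leibniz rule for a left word of one or two letters is the higher homotopy
or the distributivity relation, and for other lengths it is trivial; `d² = 0` collects `d² = 0`, the
Leibniz rule and associativity in `A`.

Modulo `ħ` the rescaled braces with two or more arguments vanish, so the product obeys a
quasi-shuffle recursion: the last letter of `(v|a)·(w|b)` is `b`, `a{b}` or `a`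
(`barMul_mul_ι_mul_ι_modEq`). The relation for `ħ{x,y}` says that `a{b}` is graded symmetric modulo
`ħ`, and induction gives commutativity modulo `ħ`. Over the discrete valuation ring `k⟦ħ⟧` a module
without `ħ`-torsion is flat, hence the tensor algebra and its tensor square have no torsion either;
the commutator can be divided by `ħ`, and the axioms of the bracket follow from identities between
commutators after multiplication by `ħ` or `ħ²` (`DGBialgebra.toBD1Bialgebra`).

If all braces are divisible by `ħ`, the quasi-shuffle recursion even holds modulo `ħ²`. Modulo `ħ`
it is the shuffle recursion, and its antisymmetrization divided by `ħ` is a recursion on last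
letters which the Poisson bracket of words satisfies too (`bracket_mul_ι_mul_ι_modEq`,
`poissonBracket_succ`). -/

theorem tensorAlgebra_induction_right {C : TensorAlgebra R A → Prop} (one : C 1)
    (mul_ι : ∀ w a, C w → C (w * ιT a)) (add : ∀ v w, C v → C w → C (v + w))
    (smul : ∀ (r : R) w, C w → C (r • w)) (w : TensorAlgebra R A) : C w := by
  -- Induction on the right factor `x`, for all `w` at once; the claim is the case `w = 1`.
  have key : ∀ x w : 𝕋, C w → C (w * x) := by
    intro x
    induction x using TensorAlgebra.induction with
    | algebraMap r =>
      intro w hw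
      rw [← Algebra.commutes, ← Algebra.smul_def]
      exact smul r w hw
    | ι a => exact fun w hw => mul_ι w a hw
    | mul x y hx hy =>
      intro w hw
      rw [← mul_assoc]
      exact hy _ (hx _ hw)
    | add x y hx hy =>
      intro w hw
      rw [mul_add]
      exact add _ _ (hx _ hw) (hy _ hw)
  simpa using key w 1 one

theorem linearMap_ext_right {X : Type*} [AddCommGroup X] [Module R X]
    {f g : TensorAlgebra R A →ₗ[R] X} (one : f 1 = g 1)
    (mul_ι : ∀ w a, f w = g w → f (w * ιT a) = g (w * ιT a)) : f = g := by
  ext w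
  refine tensorAlgebra_induction_right (C := fun w => f w = g w) one mul_ι ?_ ?_ w
  · intro v w hv hw
    simp [hv, hw]
  · intro r w hw
    simp [hw]

/-- Recursion on the last letter of a word. -/
def recRight {X : Type*} [AddCommMonoid X] [Module R X] (G : A →ₗ[R] X →ₗ[R] X) :
    TensorAlgebra R A →ₗ[R] X →ₗ[R] X :=
  -- Lifting to the opposite of the endomorphism algebra makes the last letter of a word act
  -- outermost.
  (MulOpposite.opLinearEquiv R).symm.toLinearMap ∘ₗ
    (TensorAlgebra.lift R
      ((MulOpposite.opLinearEquiv R (M := Module.End R X)).toLinearMap ∘ₗ G)).toLinearMap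

section recRight

variable {X : Type*} [AddCommMonoid X] [Module R X] (G : A →ₗ[R] X →ₗ[R] X)

@[simp]
theorem recRight_one (x : X) : recRight G 1 x = x := by
  simp [recRight]

@[simp]
theorem recRight_mul_ι (w : TensorAlgebra R A) (a : A) (x : X) :
    recRight G (w * ιT a) x = G a (recRight G w x) := by
  simp [recRight]

end recRight

/-- One step of the recursion for the deconcatenation coproduct. -/
def comulStep : A →ₗ[R] (TensorAlgebra R A × TensorAlgebra R A ⊗[R] TensorAlgebra R A) →ₗ[R]
    (TensorAlgebra R A × TensorAlgebra R A ⊗[R] TensorAlgebra R A) :=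
  -- The first component carries the word read so far, which the cut after the new letter requires.
  LinearMap.mk₂ R (fun a p => (p.1 * ιT a, p.2 * (1 ⊗ₜ ιT a) + (p.1 * ιT a) ⊗ₜ 1))
    (by intro a b p; simp [mul_add, TensorProduct.tmul_add, TensorProduct.add_tmul]; abel)
    (by intro r a p; simp; rw [TensorProduct.smul_tmul'])
    (by intro a p q; simp [add_mul, TensorProduct.add_tmul]; abel)
    (by intro r a p; simp [TensorProduct.smul_tmul'])

@[simp]
theorem comulStep_apply (a : A) (p : TensorAlgebra R A × TensorAlgebra R A ⊗[R] TensorAlgebra R A) :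
    comulStep a p = (p.1 * ιT a, p.2 * (1 ⊗ₜ ιT a) + (p.1 * ιT a) ⊗ₜ 1) := rfl

/-- The deconcatenation coproduct. -/
def decon : TensorAlgebra R A →ₗ[R] TensorAlgebra R A ⊗[R] TensorAlgebra R A :=
  LinearMap.snd R _ _ ∘ₗ (recRight comulStep).flip (1, 1 ⊗ₜ 1)

@[simp]
theorem decon_one : decon (1 : TensorAlgebra R A) = 1 ⊗ₜ 1 := by
  simp [decon]

theorem decon_mul_ι (w : TensorAlgebra R A) (a : A) :
    decon (w * ιT a) = decon w * (1 ⊗ₜ ιT a) + (w * ιT a) ⊗ₜ 1 := by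
  have h : ∀ w : 𝕋, (recRight comulStep w (1, 1 ⊗ₜ 1)).1 = w := by
    intro w
    have : LinearMap.fst R _ _ ∘ₗ (recRight comulStep).flip (1, 1 ⊗ₜ[R] (1 : 𝕋)) =
        LinearMap.id (R := R) (M := 𝕋) := by
      apply linearMap_ext_right
      · simp
      · intro w a h
        simp only [LinearMap.comp_apply, LinearMap.flip_apply, LinearMap.fst_apply,
          LinearMap.id_apply] at h
        simp [h]
    exact LinearMap.congr_fun this w
  simp [decon, h]

@[simp]
theorem decon_ι (a : A) : decon (ιT a) = ιT a ⊗ₜ[R] (1 : 𝕋) + 1 ⊗ₜ ιT a := by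
  have := decon_mul_ι (1 : 𝕋) a
  rw [one_mul] at this
  rw [this, decon_one]
  simp [add_comm]

/-- A cut of `v * w` lies in `v` or in `w`; the cut between them is counted twice, whence the
subtracted term. -/
theorem decon_mul (v w : TensorAlgebra R A) :
    decon (v * w) = decon v * (1 ⊗ₜ w) + (v ⊗ₜ 1) * decon w - v ⊗ₜ w := by
  have : decon ∘ₗ LinearMap.mulLeft R v =
      LinearMap.mulLeft R (decon v) ∘ₗ TensorProduct.mk R 𝕋 𝕋 1 +
        LinearMap.mulLeft R (v ⊗ₜ 1) ∘ₗ decon - TensorProduct.mk R 𝕋 𝕋 v := by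
    apply linearMap_ext_right
    · simp [← Algebra.TensorProduct.one_def]
    · intro w a h
      simp only [LinearMap.comp_apply, LinearMap.mulLeft_apply, LinearMap.add_apply,
        LinearMap.sub_apply, TensorProduct.mk_apply] at h ⊢
      rw [← mul_assoc, decon_mul_ι, h, decon_mul_ι]
      simp only [add_mul, sub_mul, mul_add, mul_assoc, Algebra.TensorProduct.tmul_mul_tmul,
        mul_one]
      abel
  exact LinearMap.congr_fun this w

/-- The counit of the deconcatenation coalgebra. -/
abbrev decounit : TensorAlgebra R A →ₐ[R] R := TensorAlgebra.algebraMapInv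

@[simp]
theorem decounit_ι (a : A) : decounit (ιT a) = (0 : R) := by
  simp [decounit, TensorAlgebra.algebraMapInv]

theorem rTensor_decounit_decon (w : TensorAlgebra R A) :
    (decounit.toLinearMap.rTensor 𝕋) (decon w) = (1 : R) ⊗ₜ w := by
  have : (decounit.toLinearMap.rTensor 𝕋) ∘ₗ decon = TensorProduct.mk R R 𝕋 1 := by
    apply linearMap_ext_right
    · simp
    · intro w a h
      simp only [LinearMap.comp_apply, TensorProduct.mk_apply] at h ⊢
      have h2 : ∀ ξ : 𝕋 ⊗[R] 𝕋, (decounit.toLinearMap.rTensor 𝕋) (ξ * (1 ⊗ₜ ιT a)) =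
          (decounit.toLinearMap.rTensor 𝕋) ξ * ((1 : R) ⊗ₜ ιT a) := by
        intro ξ
        induction ξ with
        | zero => simp
        | tmul x y => simp
        | add x y hx hy => rw [add_mul, map_add, hx, hy, map_add, add_mul]
      rw [decon_mul_ι, map_add, h2, h]
      simp
  exact LinearMap.congr_fun this w

theorem lTensor_decounit_decon (w : TensorAlgebra R A) :
    (decounit.toLinearMap.lTensor 𝕋) (decon w) = w ⊗ₜ (1 : R) := by
  have : (decounit.toLinearMap.lTensor 𝕋) ∘ₗ decon = (TensorProduct.mk R 𝕋 R).flip 1 := by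
    apply linearMap_ext_right
    · simp
    · intro w a h
      simp only [LinearMap.comp_apply, LinearMap.flip_apply, TensorProduct.mk_apply] at h ⊢
      have h2 : ∀ ξ : 𝕋 ⊗[R] 𝕋, (decounit.toLinearMap.lTensor 𝕋) (ξ * (1 ⊗ₜ ιT a)) = 0 := by
        intro ξ
        induction ξ with
        | zero => simp
        | tmul x y => simp
        | add x y hx hy => rw [add_mul, map_add, hx, hy, add_zero]
      rw [decon_mul_ι, map_add, h2]
      simp
  exact LinearMap.congr_fun this w

theorem decon_coassoc (w : TensorAlgebra R A) :
    TensorProduct.assoc R 𝕋 𝕋 𝕋 (decon.rTensor 𝕋 (decon w)) = decon.lTensor 𝕋 (decon w) := by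
  have : (TensorProduct.assoc R 𝕋 𝕋 𝕋).toLinearMap ∘ₗ decon.rTensor 𝕋 ∘ₗ decon =
      decon.lTensor 𝕋 ∘ₗ decon := by
    apply linearMap_ext_right
    · simp
    · intro w a h
      simp only [LinearMap.comp_apply, LinearEquiv.coe_coe] at h ⊢
      have h1 : ∀ ξ : 𝕋 ⊗[R] 𝕋, TensorProduct.assoc R 𝕋 𝕋 𝕋
          (decon.rTensor 𝕋 (ξ * (1 ⊗ₜ ιT a))) =
          TensorProduct.assoc R 𝕋 𝕋 𝕋 (decon.rTensor 𝕋 ξ) * (1 ⊗ₜ (1 ⊗ₜ ιT a)) := by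
        intro ξ
        induction ξ with
        | zero => simp
        | tmul x y =>
          simp only [Algebra.TensorProduct.tmul_mul_tmul, mul_one, LinearMap.rTensor_tmul]
          generalize decon x = ζ
          induction ζ with
          | zero => simp
          | tmul x' x'' => simp
          | add x y hx hy => simp only [TensorProduct.add_tmul, map_add, add_mul, hx, hy]
        | add x y hx hy => simp only [add_mul, map_add, hx, hy]
      have h2 : ∀ ξ : 𝕋 ⊗[R] 𝕋, decon.lTensor 𝕋 (ξ * (1 ⊗ₜ ιT a)) =
          decon.lTensor 𝕋 ξ * (1 ⊗ₜ (1 ⊗ₜ ιT a)) +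
            TensorProduct.assoc R 𝕋 𝕋 𝕋 ((ξ * (1 ⊗ₜ ιT a)) ⊗ₜ 1) := by
        intro ξ
        induction ξ with
        | zero => simp
        | tmul x y =>
          simp [decon_mul_ι, TensorProduct.tmul_add]
        | add x y hx hy =>
          simp only [add_mul, map_add, TensorProduct.add_tmul, hx, hy]
          abel
      rw [decon_mul_ι, map_add, map_add, h1, h, map_add, h2]
      simp [decon_mul_ι, TensorProduct.add_tmul, add_assoc]
  exact LinearMap.congr_fun this w

/-- The deconcatenation coalgebra. -/
@[reducible]
def deconCoalgebra : Coalgebra R (TensorAlgebra R A) where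
  comul := decon
  counit := decounit.toLinearMap
  coassoc := LinearMap.ext decon_coassoc
  rTensor_counit_comp_comul := LinearMap.ext rTensor_decounit_decon
  lTensor_counit_comp_comul := LinearMap.ext lTensor_decounit_decon

/-! ### Convolution -/

section conv

variable {B : Type*} [Ring B] [Algebra R B]

/-- The convolution product of linear maps from the tensor coalgebra to an algebra. -/
def conv (f g : TensorAlgebra R A →ₗ[R] B) : TensorAlgebra R A →ₗ[R] B :=
  LinearMap.mul' R B ∘ₗ TensorProduct.map f g ∘ₗ decon

theorem conv_apply (f g : TensorAlgebra R A →ₗ[R] B) (w : TensorAlgebra R A) :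
    conv f g w = LinearMap.mul' R B (TensorProduct.map f g (decon w)) := rfl

theorem conv_add_left (f f' g : TensorAlgebra R A →ₗ[R] B) :
    conv (f + f') g = conv f g + conv f' g := by
  ext w; simp [conv_apply, TensorProduct.map_add_left]

theorem conv_add_right (f g g' : TensorAlgebra R A →ₗ[R] B) :
    conv f (g + g') = conv f g + conv f g' := by
  ext w; simp [conv_apply, TensorProduct.map_add_right]

theorem conv_smul_left (r : R) (f g : TensorAlgebra R A →ₗ[R] B) :
    conv (r • f) g = r • conv f g := by
  ext w; simp [conv_apply, TensorProduct.map_smul_left]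

theorem conv_smul_right (r : R) (f g : TensorAlgebra R A →ₗ[R] B) :
    conv f (r • g) = r • conv f g := by
  ext w; simp [conv_apply, TensorProduct.map_smul_right]

/-- Convolution as a bilinear map. -/
def convₗ : (TensorAlgebra R A →ₗ[R] B) →ₗ[R] (TensorAlgebra R A →ₗ[R] B) →ₗ[R]
    TensorAlgebra R A →ₗ[R] B :=
  LinearMap.mk₂ R conv conv_add_left conv_smul_left conv_add_right conv_smul_right

@[simp]
theorem convₗ_apply (f g : TensorAlgebra R A →ₗ[R] B) : convₗ f g = conv f g := rfl

theorem conv_assoc (f g h : TensorAlgebra R A →ₗ[R] B) :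
    conv (conv f g) h = conv f (conv g h) := by
  ext w
  have h1 : ∀ ξ : 𝕋 ⊗[R] 𝕋, LinearMap.mul' R B (TensorProduct.map (conv f g) h ξ) =
      LinearMap.mul' R B ((LinearMap.mul' R B).lTensor B (TensorProduct.map f (TensorProduct.map g h)
        (TensorProduct.assoc R 𝕋 𝕋 𝕋 (decon.rTensor 𝕋 ξ)))) := by
    intro ξ
    induction ξ with
    | zero => simp
    | add x y hx hy => simp only [map_add, hx, hy]
    | tmul x y =>
      simp only [TensorProduct.map_tmul, LinearMap.mul'_apply, conv_apply, LinearMap.rTensor_tmul]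
      generalize decon x = ζ
      induction ζ with
      | zero => simp
      | add x y hx hy => simp only [map_add, TensorProduct.add_tmul, add_mul, hx, hy]
      | tmul x' x'' => simp [mul_assoc]
  have h2 : ∀ ξ : 𝕋 ⊗[R] 𝕋, LinearMap.mul' R B (TensorProduct.map f (conv g h) ξ) =
      LinearMap.mul' R B ((LinearMap.mul' R B).lTensor B (TensorProduct.map f (TensorProduct.map g h)
        (decon.lTensor 𝕋 ξ))) := by
    intro ξ
    induction ξ with
    | zero => simp
    | add x y hx hy => simp only [map_add, hx, hy]
    | tmul x y => simp [conv_apply]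
  rw [conv_apply, h1, decon_coassoc, ← h2, ← conv_apply]

theorem algHom_comp_conv {B' : Type*} [Ring B'] [Algebra R B'] (φ : B →ₐ[R] B')
    (f g : TensorAlgebra R A →ₗ[R] B) :
    φ.toLinearMap ∘ₗ conv f g = conv (φ.toLinearMap ∘ₗ f) (φ.toLinearMap ∘ₗ g) := by
  ext w
  simp only [LinearMap.comp_apply, conv_apply]
  generalize decon w = ζ
  induction ζ with
  | zero => simp
  | add x y hx hy => simp only [map_add, hx, hy]
  | tmul x' x'' => simp

theorem conv_comp (f g : TensorAlgebra R A →ₗ[R] B)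
    (σ : TensorAlgebra R A →ₗ[R] TensorAlgebra R A)
    (hσ : decon ∘ₗ σ = TensorProduct.map σ σ ∘ₗ decon) :
    conv f g ∘ₗ σ = conv (f ∘ₗ σ) (g ∘ₗ σ) := by
  simp only [conv, LinearMap.comp_assoc, hσ, TensorProduct.map_comp]

@[simp]
theorem conv_one (f g : TensorAlgebra R A →ₗ[R] B) : conv f g 1 = f 1 * g 1 := by
  simp [conv_apply]

/-- A cut of `w * ι a` is either before `a`, so that `a` goes to the right part, or at the very end.
-/
theorem conv_mul_ι (f g : TensorAlgebra R A →ₗ[R] B) (w : TensorAlgebra R A) (a : A) :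
    conv f g (w * ιT a) =
      conv f (g ∘ₗ LinearMap.mulRight R (ιT a)) w + f (w * ιT a) * g 1 := by
  rw [conv_apply, decon_mul_ι, map_add, map_add, conv_apply]
  congr 1
  · generalize decon w = ζ
    induction ζ with
    | zero => simp
    | add x y hx hy => simp only [map_add, add_mul, hx, hy]
    | tmul x' x'' => simp

end conv

/-- One step of the recursion for the projection to words of length `1`. -/
def letterStep : A →ₗ[R] (R × A) →ₗ[R] (R × A) :=
  -- The first component is the counit of the word read so far: a letter survives only if nothing
  -- precedes it.
  LinearMap.mk₂ R (fun a p => (0, p.1 • a)) (by simp)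
    (fun r a p => by simp [smul_comm r p.1]) (fun a p q => by simp [add_smul])
    (fun r a p => by simp [mul_smul])

@[simp]
theorem letterStep_apply (a : A) (p : R × A) : letterStep a p = (0, p.1 • a) := rfl

/-- The projection to words of length `1`. -/
def letter : TensorAlgebra R A →ₗ[R] A :=
  LinearMap.snd R R A ∘ₗ (recRight letterStep).flip (1, 0)

@[simp]
theorem letter_one : letter (1 : TensorAlgebra R A) = 0 := by
  simp [letter]

@[simp]
theorem letter_mul_ι (w : TensorAlgebra R A) (a : A) :
    letter (w * ιT a) = decounit w • a := by
  have h : LinearMap.fst R R A ∘ₗ (recRight letterStep).flip (1, 0) = decounit.toLinearMap := by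
    apply linearMap_ext_right
    · simp
    · intro w a h
      simp
  have h' := LinearMap.congr_fun h w
  simp only [LinearMap.comp_apply, LinearMap.flip_apply, LinearMap.fst_apply] at h'
  simp [letter, h']

@[simp]
theorem letter_ι (a : A) : letter (ιT a) = a := by
  simpa using letter_mul_ι (1 : 𝕋) a

/-- A word is determined by its last letter and the rest. -/
theorem eq_decounit_add_conv_letter (w : TensorAlgebra R A) :
    w = algebraMap R _ (decounit w) + conv LinearMap.id (ιT ∘ₗ letter) w := by
  have : LinearMap.id = (Algebra.linearMap R 𝕋) ∘ₗ decounit.toLinearMap +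
      conv LinearMap.id (ιT ∘ₗ letter) := by
    apply linearMap_ext_right
    · simp
    · intro w a h
      have h2 : ∀ ξ : 𝕋 ⊗[R] 𝕋, LinearMap.mul' R 𝕋 (TensorProduct.map LinearMap.id
          ((ιT ∘ₗ letter) ∘ₗ LinearMap.mulRight R (ιT a)) ξ) =
          (TensorProduct.rid R 𝕋 (decounit.toLinearMap.lTensor 𝕋 ξ)) * ιT a := by
        intro ξ
        induction ξ with
        | zero => simp
        | add x y hx hy => simp only [map_add, add_mul, hx, hy]
        | tmul x y => simp
      rw [LinearMap.add_apply, conv_mul_ι, conv_apply, h2, lTensor_decounit_decon]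
      simp
  exact LinearMap.congr_fun this w

/-- Cogeneration by letters: gluing the last letter back onto the rest recovers everything but the
constant term. This reduces identities on the bar complex to identities in `A`. -/
theorem eq_zero_of_lTensor_letter_decon {w : TensorAlgebra R A} (h0 : decounit w = 0)
    (h : letter.lTensor 𝕋 (decon w) = 0) : w = 0 := by
  rw [eq_decounit_add_conv_letter w, h0, conv_apply, ← LinearMap.lTensor, LinearMap.lTensor_comp,
    LinearMap.comp_apply, h]
  simp

/-- `decon` is the convolution of the two inclusions. -/
theorem map_decon_eq_conv {B : Type*} [Ring B] [Algebra R B] {B' : Type*} [Ring B'] [Algebra R B']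
    (f : TensorAlgebra R A →ₗ[R] B) (g : TensorAlgebra R A →ₗ[R] B') :
    TensorProduct.map f g ∘ₗ decon =
      conv (Algebra.TensorProduct.includeLeft.toLinearMap ∘ₗ f : 𝕋 →ₗ[R] B ⊗[R] B')
        ((Algebra.TensorProduct.includeRight : B' →ₐ[R] B ⊗[R] B').toLinearMap ∘ₗ g) := by
  ext w
  simp only [LinearMap.comp_apply, conv_apply]
  generalize decon w = ζ
  induction ζ with
  | zero => simp
  | add x y hx hy => simp only [map_add, hx, hy]
  | tmul x' x'' => simp

end CofreeCoalgebra

/-! ### Koszul signs on internally graded modules -/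

section Koszul

variable {R : Type*} [CommRing R] {B : Type*} [AddCommGroup B] [Module R B]
variable {gr : ℤ → Submodule R B} (h : DirectSum.IsInternal gr)

theorem negOnePow_congr {i j : ℤ} (hij : Even (i - j)) : i.negOnePow = j.negOnePow :=
  (Int.negOnePow_eq_iff i j).mpr hij

theorem grEquiv_lof {i : ℤ} (x : gr i) :
    grEquiv gr h (DirectSum.lof R ℤ (fun i => gr i) i x) = x :=
  DirectSum.coeLinearMap_lof gr i x

theorem grEquiv_symm_apply {i : ℤ} {x : B} (hx : x ∈ gr i) :
    (grEquiv gr h).symm x = DirectSum.lof R ℤ (fun i => gr i) i ⟨x, hx⟩ := by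
  rw [LinearEquiv.symm_apply_eq, grEquiv_lof]

include h in
theorem homogeneous_induction {C : B → Prop} (hom : ∀ i x, x ∈ gr i → C x)
    (add : ∀ x y, C x → C y → C (x + y)) (x : B) : C x := by
  have hx : x ∈ ⨆ i, gr i := by rw [h.submodule_iSup_eq_top]; trivial
  induction hx using Submodule.iSup_induction' with
  | mem i x hx => exact hom i x hx
  | zero => exact hom 0 0 (zero_mem _)
  | add x y _ _ hx hy => exact add x y hx hy

include h in
theorem linearMap_ext_homogeneous {X : Type*} [AddCommGroup X] [Module R X] {f g : B →ₗ[R] X}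
    (hfg : ∀ i x, x ∈ gr i → f x = g x) : f = g := by
  ext x
  refine homogeneous_induction h (C := fun x => f x = g x) hfg ?_ x
  intro x y hx hy
  simp [hx, hy]

include h in
theorem tensor_induction_homogeneous {C : B ⊗[R] B → Prop} (zero : C 0)
    (hom : ∀ i j x y, x ∈ gr i → y ∈ gr j → C (x ⊗ₜ y))
    (add : ∀ ξ η, C ξ → C η → C (ξ + η)) (ξ : B ⊗[R] B) : C ξ := by
  induction ξ with
  | zero => exact zero
  | add x y hx hy => exact add x y hx hy
  | tmul x y =>
    refine homogeneous_induction h (C := fun x => C (x ⊗ₜ y)) ?_ ?_ x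
    · intro i x hx
      refine homogeneous_induction h (C := fun y => C (x ⊗ₜ y)) ?_ ?_ y
      · intro j y hy
        exact hom i j x y hx hy
      · intro y y' hy hy'
        rw [TensorProduct.tmul_add]
        exact add _ _ hy hy'
    · intro x x' hx hx'
      rw [TensorProduct.add_tmul]
      exact add _ _ hx hx'

/-- The linear map which is `f i` in degree `i`. -/
def degreewise {X : Type*} [AddCommMonoid X] [Module R X] (f : ℤ → B →ₗ[R] X) : B →ₗ[R] X :=
  DirectSum.toModule R ℤ X (fun i => f i ∘ₗ (gr i).subtype) ∘ₗ (grEquiv gr h).symm.toLinearMap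

theorem degreewise_apply {X : Type*} [AddCommMonoid X] [Module R X] (f : ℤ → B →ₗ[R] X) {i : ℤ}
    {x : B} (hx : x ∈ gr i) : degreewise h f x = f i x := by
  simp [degreewise, grEquiv_symm_apply h hx]

theorem parity_apply {i : ℤ} {x : B} (hx : x ∈ gr i) : parity gr h x = i.negOnePow • x := by
  simp [parity, grEquiv_symm_apply h hx]

theorem koszulSwap_tmul {i j : ℤ} {x y : B} (hx : x ∈ gr i) (hy : y ∈ gr j) :
    koszulSwap gr h (x ⊗ₜ y) = (i * j).negOnePow • (y ⊗ₜ[R] x) := by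
  rw [koszulSwap]
  simp only [LinearMap.comp_apply, LinearEquiv.coe_coe, TensorProduct.congr_tmul,
    grEquiv_symm_apply h hx, grEquiv_symm_apply h hy]
  rw [TensorProduct.gradedComm_of_tmul_of, mul_comm i j, Units.smul_def, Units.smul_def,
    map_zsmul, TensorProduct.congr_tmul, grEquiv_lof, grEquiv_lof]
  rfl

theorem tensorOp_tmul (f g : B →ₗ[R] B →ₗ[R] B) {i j : ℤ} (x : B) {x' y : B} (y' : B)
    (hx' : x' ∈ gr i) (hy : y ∈ gr j) :
    tensorOp gr h f g (x ⊗ₜ x') (y ⊗ₜ y') = (i * j).negOnePow • (f x y ⊗ₜ[R] g x' y') := by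
  rw [tensorOp]
  simp only [TensorProduct.curry_apply, LinearMap.comp_apply, LinearEquiv.coe_coe,
    TensorProduct.assoc_tmul, LinearMap.lTensor_tmul, TensorProduct.assoc_symm_tmul,
    LinearMap.rTensor_tmul, koszulSwap_tmul h hx' hy]
  rcases Int.even_or_odd (i * j) with e | e
  · simp [Int.negOnePow_even _ e]
  · simp [Int.negOnePow_odd _ e, TensorProduct.neg_tmul, TensorProduct.tmul_neg]

/-- Once `x ⊗ y` is fixed, the Koszul sign depends only on the degree of `z`. Absorbing it into `τ`
makes the operation a tensor product of two maps, to which the calculus of convolutions applies. -/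
theorem tensorOp_tmul_eq_map (f g : B →ₗ[R] B →ₗ[R] B) {j : ℤ} (x : B) {y : B} (hy : y ∈ gr j)
    {τ : B →ₗ[R] B} (hτ : ∀ i z, z ∈ gr i → τ z = (j * i).negOnePow • z) :
    tensorOp gr h f g (x ⊗ₜ y) = TensorProduct.map (f x ∘ₗ τ) (g y) := by
  ext z w
  simp only [TensorProduct.AlgebraTensorModule.curry_apply, LinearMap.restrictScalars_self,
    TensorProduct.curry_apply, TensorProduct.map_tmul, LinearMap.comp_apply]
  refine homogeneous_induction h (C := fun z => tensorOp gr h f g (x ⊗ₜ y) (z ⊗ₜ w) =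
    f x (τ z) ⊗ₜ g y w) ?_ ?_ z
  · intro i z hz
    rw [tensorOp_tmul h f g x w hy hz, hτ i z hz, Units.smul_def, Units.smul_def,
      map_zsmul, TensorProduct.smul_tmul']
  · intro z z' hz hz'
    rw [TensorProduct.add_tmul, map_add, hz, hz', map_add, map_add, TensorProduct.add_tmul]

theorem apply_tmul_eq_map {F : B ⊗[R] B →ₗ[R] B ⊗[R] B →ₗ[R] B ⊗[R] B} {f g : B →ₗ[R] B →ₗ[R] B}
    (hF : F = tensorOp gr h f g) {j : ℤ} (x : B) {y : B} (hy : y ∈ gr j)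
    {τ : B →ₗ[R] B} (hτ : ∀ i z, z ∈ gr i → τ z = (j * i).negOnePow • z) :
    F (x ⊗ₜ y) = TensorProduct.map (f x ∘ₗ τ) (g y) := by
  rw [hF, tensorOp_tmul_eq_map h f g x hy hτ]

theorem koszulOp_apply (f : B →ₗ[R] B →ₗ[R] B) {i j : ℤ} {x y : B}
    (hx : x ∈ gr i) (hy : y ∈ gr j) :
    koszulOp gr h f x y = (i * j).negOnePow • f y x := by
  simp only [koszulOp, TensorProduct.curry_apply, LinearMap.comp_apply, koszulSwap_tmul h hx hy,
    Units.smul_def, map_zsmul, TensorProduct.lift.tmul]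

theorem tmul_mem_tensorGr {i j k : ℤ} {x y : B} (hx : x ∈ gr i) (hy : y ∈ gr j) (hk : i + j = k) :
    x ⊗ₜ[R] y ∈ tensorGr gr k := by
  refine Submodule.mem_iSup_of_mem i ?_
  refine Submodule.apply_mem_map₂ _ hx ?_
  rwa [show k - i = j by omega]

theorem tensorGr_induction {k : ℤ} {C : B ⊗[R] B → Prop} (zero : C 0)
    (tmul : ∀ i j x y, x ∈ gr i → y ∈ gr j → i + j = k → C (x ⊗ₜ y))
    (add : ∀ ξ η, C ξ → C η → C (ξ + η)) {ξ : B ⊗[R] B} (hξ : ξ ∈ tensorGr gr k) : C ξ := by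
  rw [tensorGr] at hξ
  induction hξ using Submodule.iSup_induction' with
  | zero => exact zero
  | add x y _ _ hx hy => exact add x y hx hy
  | mem j ξ hξ =>
    rw [Submodule.map₂_eq_span_image2] at hξ
    induction hξ using Submodule.closure_induction with
    | zero => exact zero
    | add x y _ _ hx hy => exact add x y hx hy
    | smul_mem r ξ hξ =>
      obtain ⟨x, hx, y, hy, rfl⟩ := hξ
      exact tmul _ _ (r • x) y (Submodule.smul_mem _ r hx) hy (by omega)

end Koszul

/-! ### The grading of the bar complex -/

section BarGrading

variable {R : Type*} [CommRing R] {A : Type*} [AddCommGroup A] [Module R A]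

local notation "𝕋" => TensorAlgebra R A
local notation "ιT" => TensorAlgebra.ι R

@[simp]
theorem word_zero (y : Fin 0 → A) : word R y = 1 := by
  simp [word, TensorAlgebra.tprod_apply]

theorem word_succ {n : ℕ} (y : Fin (n + 1) → A) :
    word R y = word R (fun i => y i.castSucc) * ιT (y (Fin.last n)) := by
  simp only [word, TensorAlgebra.tprod_apply, List.ofFn_succ', List.concat_eq_append,
    List.prod_append, List.prod_singleton]

theorem word_one (y : Fin 1 → A) : word R y = ιT (y 0) := by
  rw [word_succ, word_zero, one_mul]; rfl

variable {gr : ℤ → Submodule R A}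

theorem one_mem_barGr : (1 : TensorAlgebra R A) ∈ barGr gr 0 :=
  Submodule.subset_span ⟨0, 0, 0, by simp, by simp, by simp⟩

theorem word_mem_barGr {n : ℕ} {b : Fin n → ℤ} {y : Fin n → A} (hy : ∀ q, y q ∈ gr (b q)) :
    word R y ∈ barGr gr (∑ q, (b q - 1)) :=
  Submodule.subset_span ⟨n, b, y, hy, rfl, rfl⟩

theorem mul_ι_mem_barGr {i j : ℤ} {w : TensorAlgebra R A} {a : A} (hw : w ∈ barGr gr i)
    (ha : a ∈ gr j) : w * ιT a ∈ barGr gr (i + (j - 1)) := by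
  rw [barGr] at hw
  induction hw using Submodule.span_induction with
  | zero => simp
  | add x y _ _ hx hy => rw [add_mul]; exact add_mem hx hy
  | smul r x _ hx => rw [smul_mul_assoc]; exact Submodule.smul_mem _ r hx
  | mem x hx =>
    obtain ⟨n, b, y, hy, rfl, rfl⟩ := hx
    refine Submodule.subset_span ⟨n + 1, Fin.snoc b j, Fin.snoc y a, ?_, ?_, ?_⟩
    · intro q
      induction q using Fin.lastCases with
      | last => simpa using ha
      | cast q => simpa using hy q
    · simp [Fin.sum_univ_castSucc]; ring
    · rw [word_succ]; simp

theorem ι_mem_barGr {j : ℤ} {a : A} (ha : a ∈ gr j) : ιT a ∈ barGr gr (j - 1) := by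
  simpa using mul_ι_mem_barGr one_mem_barGr ha

theorem barGr_induction {C : ℤ → TensorAlgebra R A → Prop} (zero : ∀ i, C i 0) (one : C 0 1)
    (mul_ι : ∀ i j w a, w ∈ barGr gr i → C i w → a ∈ gr j → C (i + (j - 1)) (w * ιT a))
    (add : ∀ i v w, C i v → C i w → C i (v + w)) (smul : ∀ i (r : R) w, C i w → C i (r • w))
    {i : ℤ} {w : TensorAlgebra R A} (hw : w ∈ barGr gr i) : C i w := by
  rw [barGr] at hw
  induction hw using Submodule.span_induction with
  | zero => exact zero i
  | add x y _ _ hx hy => exact add i x y hx hy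
  | smul r x _ hx => exact smul i r x hx
  | mem x hx =>
    obtain ⟨n, b, y, hy, rfl, rfl⟩ := hx
    induction n with
    | zero => simpa using one
    | succ n ih =>
      rw [word_succ, Fin.sum_univ_castSucc]
      exact mul_ι _ _ _ _ (word_mem_barGr fun q => hy q.castSucc)
        (ih (fun q => b q.castSucc) (fun q => y q.castSucc) fun q => hy q.castSucc) (hy (Fin.last n))

theorem mul_mem_barGr {i j : ℤ} {v w : TensorAlgebra R A} (hv : v ∈ barGr gr i)
    (hw : w ∈ barGr gr j) : v * w ∈ barGr gr (i + j) := by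
  refine barGr_induction (C := fun j w => v * w ∈ barGr gr (i + j)) ?_ ?_ ?_ ?_ ?_ hw
  · simp
  · simpa using hv
  · intro j l w a _ hw ha
    rw [← mul_assoc, ← add_assoc]
    exact mul_ι_mem_barGr hw ha
  · intro j x y hx hy
    rw [mul_add]; exact add_mem hx hy
  · intro j r x hx
    rw [mul_smul_comm]; exact Submodule.smul_mem _ r hx

instance barGr_gradedMonoid : SetLike.GradedMonoid (barGr gr) where
  one_mem := one_mem_barGr
  mul_mem _ _ _ _ := mul_mem_barGr

variable (h : DirectSum.IsInternal gr)

/-- The inclusion of the letters in the graded tensor algebra. -/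
def barι : A →ₗ[R] ⨁ i, barGr gr i :=
  DirectSum.toModule R ℤ _ (fun i => DirectSum.lof R ℤ (fun i => barGr gr i) (i - 1) ∘ₗ
    (ιT ∘ₗ (gr i).subtype).codRestrict (barGr gr (i - 1)) (fun x => ι_mem_barGr x.2)) ∘ₗ
      (grEquiv gr h).symm.toLinearMap

theorem barι_apply {i : ℤ} {a : A} (ha : a ∈ gr i) :
    barι h a = DirectSum.of (fun i => barGr gr i) (i - 1) ⟨ιT a, ι_mem_barGr ha⟩ := by
  simp only [barι, LinearMap.comp_apply, LinearEquiv.coe_coe, grEquiv_symm_apply h ha,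
    DirectSum.toModule_lof]
  rfl

include h in
-- The universal property extends the graded inclusion of letters to an algebra map into the direct
-- sum; it inverts the sum map because both composites can be tested on letters and on homogeneous
-- words.
theorem isInternal_barGr : DirectSum.IsInternal (barGr gr) := by
  have : GradedAlgebra (barGr gr) := by
    refine GradedAlgebra.ofAlgHom (barGr gr) (TensorAlgebra.lift R (barι h)) ?_ ?_
    · refine TensorAlgebra.hom_ext (linearMap_ext_homogeneous h ?_)
      intro i a ha
      simp [barι_apply h ha]
    · intro i ⟨w, hw⟩
      -- The membership is part of the claim, so that the right-hand side makes sense along the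
      -- induction.
      have key : ∃ hw : w ∈ barGr gr i, TensorAlgebra.lift R (barι h) w =
          DirectSum.of (fun i => barGr gr i) i ⟨w, hw⟩ := by
        refine barGr_induction (C := fun i w => ∃ hw : w ∈ barGr gr i,
          TensorAlgebra.lift R (barι h) w = DirectSum.of (fun i => barGr gr i) i ⟨w, hw⟩)
          ?_ ?_ ?_ ?_ ?_ hw
        · intro i
          refine ⟨zero_mem _, ?_⟩
          rw [map_zero]
          exact (map_zero (DirectSum.of (fun i => barGr gr i) i)).symm
        · refine ⟨one_mem_barGr, ?_⟩
          rw [map_one]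
          rfl
        · rintro i j w a - ⟨hw, e⟩ ha
          refine ⟨mul_ι_mem_barGr hw ha, ?_⟩
          rw [map_mul, e, TensorAlgebra.lift_ι_apply, barι_apply h ha, DirectSum.of_mul_of]
          rfl
        · rintro i v w ⟨hv, ev⟩ ⟨hw, ew⟩
          refine ⟨add_mem hv hw, ?_⟩
          rw [map_add, ev, ew, ← map_add]
          rfl
        · rintro i r w ⟨hw, e⟩
          refine ⟨Submodule.smul_mem _ r hw, ?_⟩
          rw [map_smul, e, ← DirectSum.lof_eq_of R, ← DirectSum.lof_eq_of R, ← map_smul]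
          rfl
      exact key.2
  exact DirectSum.Decomposition.isInternal (barGr gr)

/-! ### Koszul twists -/

/-- The map `a ↦ (-1)^{j (|a| - 1)} a` on letters. -/
def letterTwist (j : ℤ) : A →ₗ[R] A :=
  degreewise h fun i => (j * (i - 1)).negOnePow • LinearMap.id

/-- The map `w ↦ (-1)^{j |w|} w` on the bar complex. -/
def twist (j : ℤ) : TensorAlgebra R A →ₐ[R] TensorAlgebra R A :=
  TensorAlgebra.lift R (ιT ∘ₗ letterTwist h j)

theorem letterTwist_apply (j : ℤ) {i : ℤ} {a : A} (ha : a ∈ gr i) :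
    letterTwist h j a = (j * (i - 1)).negOnePow • a := by
  rw [letterTwist, degreewise_apply h _ ha]; rfl

@[simp]
theorem twist_ι (j : ℤ) (a : A) : twist h j (ιT a) = ιT (letterTwist h j a) := by
  simp [twist]

theorem twist_apply (j : ℤ) {i : ℤ} {w : TensorAlgebra R A} (hw : w ∈ barGr gr i) :
    twist h j w = (j * i).negOnePow • w := by
  refine barGr_induction (C := fun i w => twist h j w = (j * i).negOnePow • w) ?_ ?_ ?_ ?_ ?_ hw
  · simp
  · simp
  · intro i l w a _ e ha
    rw [map_mul, e, twist_ι, letterTwist_apply h j ha, Units.smul_def, Units.smul_def,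
      Units.smul_def, map_zsmul, smul_mul_smul_comm, mul_add, Int.negOnePow_add, Units.val_mul]
  · intro i v w hv hw
    rw [map_add, hv, hw, smul_add]
  · intro i r w hw
    rw [map_smul, hw, smul_comm]

theorem twist_twist (i j : ℤ) :
    (twist h i).toLinearMap ∘ₗ (twist h j).toLinearMap = (twist h (i + j)).toLinearMap := by
  refine linearMap_ext_homogeneous (isInternal_barGr h) ?_
  intro l w hw
  simp only [LinearMap.comp_apply, AlgHom.toLinearMap_apply, twist_apply h _ hw, Units.smul_def,
    map_zsmul, smul_smul]
  rw [add_mul, add_comm, Int.negOnePow_add, Units.val_mul]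

theorem twist_zero : (twist h 0).toLinearMap = LinearMap.id := by
  refine linearMap_ext_homogeneous (isInternal_barGr h) ?_
  intro i w hw
  simp [twist_apply h _ hw]

theorem twist_mem (j : ℤ) {i : ℤ} {w : TensorAlgebra R A} (hw : w ∈ barGr gr i) :
    twist h j w ∈ barGr gr i := by
  rw [twist_apply h j hw, Units.smul_def]
  exact zsmul_mem hw _

theorem parity_eq_twist : parity (barGr gr) (isInternal_barGr h) = (twist h 1).toLinearMap := by
  refine linearMap_ext_homogeneous (isInternal_barGr h) ?_
  intro i w hw
  rw [parity_apply _ hw, AlgHom.toLinearMap_apply, twist_apply h _ hw, one_mul]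

theorem decon_twist (j : ℤ) : decon ∘ₗ (twist h j).toLinearMap =
    TensorProduct.map (twist h j).toLinearMap (twist h j).toLinearMap ∘ₗ decon := by
  apply linearMap_ext_right
  · simp
  · intro w a e
    have key : ∀ ξ : 𝕋 ⊗[R] 𝕋,
        TensorProduct.map (twist h j).toLinearMap (twist h j).toLinearMap (ξ * (1 ⊗ₜ ιT a)) =
        TensorProduct.map (twist h j).toLinearMap (twist h j).toLinearMap ξ *
          (1 ⊗ₜ ιT (letterTwist h j a)) := by
      intro ξ
      induction ξ with
      | zero => simp
      | add x y hx hy => simp only [map_add, add_mul, hx, hy]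
      | tmul x y => simp
    simp only [LinearMap.comp_apply, AlgHom.toLinearMap_apply] at e ⊢
    rw [map_mul, twist_ι, decon_mul_ι, e, decon_mul_ι, map_add, key]
    simp

theorem decon_mem_tensorGr {i : ℤ} {w : TensorAlgebra R A} (hw : w ∈ barGr gr i) :
    decon w ∈ tensorGr (barGr gr) i := by
  refine barGr_induction (C := fun i w => decon w ∈ tensorGr (barGr gr) i) ?_ ?_ ?_ ?_ ?_ hw
  · simp
  · rw [decon_one]
    exact tmul_mem_tensorGr one_mem_barGr one_mem_barGr (by simp)
  · intro i j w a hw e ha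
    rw [decon_mul_ι]
    refine add_mem ?_ (tmul_mem_tensorGr (mul_ι_mem_barGr hw ha) one_mem_barGr (by simp))
    refine tensorGr_induction (C := fun ξ => ξ * (1 ⊗ₜ ιT a) ∈ tensorGr (barGr gr) (i + (j - 1)))
      (by simp) ?_ ?_ e
    · intro p q x y hx hy hpq
      simp only [Algebra.TensorProduct.tmul_mul_tmul, mul_one]
      exact tmul_mem_tensorGr hx (mul_ι_mem_barGr hy ha) (by omega)
    · intro x y hx hy
      rw [add_mul]; exact add_mem hx hy
  · intro i v w hv hw
    rw [map_add]; exact add_mem hv hw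
  · intro i r w hw
    rw [map_smul]; exact Submodule.smul_mem _ r hw

theorem conv_mem_barGr {p q : ℤ} {f g : TensorAlgebra R A →ₗ[R] TensorAlgebra R A}
    (hf : ∀ i w, w ∈ barGr gr i → f w ∈ barGr gr (i + p))
    (hg : ∀ i w, w ∈ barGr gr i → g w ∈ barGr gr (i + q)) {i : ℤ} {w : TensorAlgebra R A}
    (hw : w ∈ barGr gr i) : conv f g w ∈ barGr gr (i + (p + q)) := by
  rw [conv_apply]
  refine tensorGr_induction (C := fun ξ => LinearMap.mul' R 𝕋 (TensorProduct.map f g ξ) ∈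
    barGr gr (i + (p + q))) (by simp) ?_ ?_ (decon_mem_tensorGr hw)
  · intro j l x y hx hy hi
    rw [TensorProduct.map_tmul, LinearMap.mul'_apply, ← hi,
      show j + l + (p + q) = (j + p) + (l + q) by ring]
    exact mul_mem_barGr (hf _ _ hx) (hg _ _ hy)
  · intro x y hx hy
    rw [map_add, map_add]; exact add_mem hx hy

theorem decounit_eq_zero {i : ℤ} {w : TensorAlgebra R A} (hw : w ∈ barGr gr i) (hi : i ≠ 0) :
    decounit w = (0 : R) := by
  refine barGr_induction (C := fun i w => i ≠ 0 → decounit w = (0 : R)) ?_ ?_ ?_ ?_ ?_ hw hi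
  · simp
  · simp
  · intro i j w a _ _ _ _
    simp
  · intro i v w hv hw hi
    rw [map_add, hv hi, hw hi, add_zero]
  · intro i r w hw hi
    rw [map_smul, hw hi, smul_zero]

theorem letter_mem {i : ℤ} {w : TensorAlgebra R A} (hw : w ∈ barGr gr i) :
    letter w ∈ gr (i + 1) := by
  refine barGr_induction (C := fun i w => letter w ∈ gr (i + 1)) ?_ ?_ ?_ ?_ ?_ hw
  · simp
  · simp
  · intro i j w a hw _ ha
    rw [letter_mul_ι]
    -- The letter part of `w * ι a` is `ε(w) a`, and `ε(w)` vanishes unless `w` has degree `0`.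
    by_cases hi : i = 0
    · subst hi
      rw [show (0 : ℤ) + (j - 1) + 1 = j by ring]
      exact Submodule.smul_mem _ _ ha
    · simp [decounit_eq_zero hw hi]
  · intro i v w hv hw
    rw [map_add]; exact add_mem hv hw
  · intro i r w hw
    rw [map_smul]; exact Submodule.smul_mem _ r hw

end BarGrading

/-! ### The product on the bar complex of a brace algebra -/

section BarProduct

variable {R : Type*} [CommRing R] {A : Type*} [AddCommGroup A] [Module R A]

local notation "𝕋" => TensorAlgebra R A
local notation "ιT" => TensorAlgebra.ι R

/-- The inclusion `w ↦ w ⊗ 1`. -/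
abbrev inclL : TensorAlgebra R A →ₐ[R] TensorAlgebra R A ⊗[R] TensorAlgebra R A :=
  Algebra.TensorProduct.includeLeft

/-- The inclusion `w ↦ 1 ⊗ w`. -/
abbrev inclR : TensorAlgebra R A →ₐ[R] TensorAlgebra R A ⊗[R] TensorAlgebra R A :=
  Algebra.TensorProduct.includeRight

/-- This is `decon_mul` applied to concatenations of values of `F` and `G`. -/
theorem decon_comp_conv (F G : TensorAlgebra R A →ₗ[R] TensorAlgebra R A) :
    decon ∘ₗ conv F G = conv (decon ∘ₗ F) (inclR.toLinearMap ∘ₗ G) +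
      conv (inclL.toLinearMap ∘ₗ F) (decon ∘ₗ G) -
      conv (inclL.toLinearMap ∘ₗ F) (inclR.toLinearMap ∘ₗ G) := by
  ext w
  simp only [LinearMap.comp_apply, LinearMap.add_apply, LinearMap.sub_apply, conv_apply]
  generalize decon w = ζ
  induction ζ with
  | zero => simp
  | add x y hx hy => simp only [map_add, hx, hy]; abel
  | tmul x y => simp [decon_mul]

theorem decon_eq_conv : (decon : TensorAlgebra R A →ₗ[R] _) =
    conv inclL.toLinearMap inclR.toLinearMap := by
  have := map_decon_eq_conv (R := R) (A := A) LinearMap.id LinearMap.id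
  simpa using this

/-- Maps into the primitive elements, composed with the identity, are coderivations. -/
theorem decon_comp_conv_ι_id (b : TensorAlgebra R A →ₗ[R] A) :
    decon ∘ₗ conv (ιT ∘ₗ b) LinearMap.id =
      inclR.toLinearMap ∘ₗ conv (ιT ∘ₗ b) LinearMap.id +
      conv (inclL.toLinearMap ∘ₗ conv (ιT ∘ₗ b) LinearMap.id) inclR.toLinearMap := by
  have h1 : decon ∘ₗ (ιT ∘ₗ b) =
      inclL.toLinearMap ∘ₗ (ιT ∘ₗ b) + inclR.toLinearMap ∘ₗ (ιT ∘ₗ b) := by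
    ext w; simp
  rw [decon_comp_conv, h1, conv_add_left, algHom_comp_conv, algHom_comp_conv, LinearMap.comp_id,
    LinearMap.comp_id, LinearMap.comp_id, decon_eq_conv, conv_assoc]
  abel

variable (S : BraceAlgebra R A)

theorem brace_mem_of_mem_barGr {i j : ℤ} {a : A} {w : TensorAlgebra R A} (ha : a ∈ S.gr i)
    (hw : w ∈ barGr S.gr j) : S.brace a w ∈ S.gr (i + j) := by
  rw [barGr] at hw
  induction hw using Submodule.span_induction with
  | zero => simp
  | add x y _ _ hx hy => rw [map_add]; exact add_mem hx hy
  | smul r x _ hx => rw [map_smul]; exact Submodule.smul_mem _ r hx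
  | mem x hx =>
    obtain ⟨n, b, y, hy, rfl, rfl⟩ := hx
    have := S.brace_mem n i b a y ha hy
    rw [show i + ∑ q, (b q - 1) = i + ∑ q, b q - (n : ℤ) by
      rw [Finset.sum_sub_distrib]; simp; ring]
    exact this

/-- The map `[y₁|...|yₙ] ↦ ∑ [a{y₁,...,y_l}|y_{l+1}|...|yₙ]`. -/
def leadingBrace : A →ₗ[R] TensorAlgebra R A →ₗ[R] TensorAlgebra R A :=
  convₗ.flip LinearMap.id ∘ₗ S.brace.compr₂ ιT

theorem leadingBrace_apply (a : A) :
    leadingBrace S a = conv (ιT ∘ₗ S.brace a) LinearMap.id := rfl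

/-- The step of the recursion for the product on the bar complex. -/
def barMulStep : A →ₗ[R] (TensorAlgebra R A →ₗ[R] TensorAlgebra R A) →ₗ[R]
    TensorAlgebra R A →ₗ[R] TensorAlgebra R A :=
  degreewise S.internal fun i =>
    -- The letters before the cut are multiplied by the rest of the left word, those after it are
    -- offered to `a`; the twist is the sign of moving `a` past the former.
    LinearMap.mk₂ R (fun a f => conv (f ∘ₗ (twist S.internal (i - 1)).toLinearMap)
        (leadingBrace S a))
      (fun a b f => by rw [map_add, conv_add_right])
      (fun r a f => by rw [map_smul, conv_smul_right])
      (fun a f g => by rw [LinearMap.add_comp, conv_add_left])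
      (fun r a f => by rw [LinearMap.smul_comp, conv_smul_left])

/-- The product on the bar complex of a brace algebra. -/
def barMul : TensorAlgebra R A →ₗ[R] TensorAlgebra R A →ₗ[R] TensorAlgebra R A :=
  (recRight (barMulStep S)).flip LinearMap.id

@[simp]
theorem barMul_one_left : barMul S 1 = LinearMap.id := by
  simp [barMul]

theorem barMul_mul_ι {i : ℤ} (w : TensorAlgebra R A) {a : A} (ha : a ∈ S.gr i) :
    barMul S (w * ιT a) =
      conv (barMul S w ∘ₗ (twist S.internal (i - 1)).toLinearMap) (leadingBrace S a) := by
  rw [barMul, LinearMap.flip_apply, recRight_mul_ι, barMulStep, degreewise_apply _ _ ha]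
  rfl

theorem barMul_one_right (w : TensorAlgebra R A) : barMul S w 1 = w := by
  have : (barMul S).flip 1 = LinearMap.id := by
    apply linearMap_ext_right
    · simp
    · intro w a hw
      rw [LinearMap.flip_apply, LinearMap.id_apply] at hw
      rw [LinearMap.flip_apply, LinearMap.id_apply]
      refine homogeneous_induction S.internal (C := fun a => barMul S (w * ιT a) 1 = w * ιT a)
        ?_ ?_ a
      · intro i a ha
        rw [barMul_mul_ι S w ha, leadingBrace_apply]
        simp [S.brace_one, hw]
      · intro a b ha hb
        rw [map_add, mul_add, map_add, LinearMap.add_apply, ha, hb]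
  exact LinearMap.congr_fun this w

theorem leadingBrace_mem {i j : ℤ} {a : A} {w : TensorAlgebra R A} (ha : a ∈ S.gr i)
    (hw : w ∈ barGr S.gr j) : leadingBrace S a w ∈ barGr S.gr (j + (i - 1)) := by
  rw [leadingBrace_apply]
  have := conv_mem_barGr (p := i - 1) (q := 0) (f := ιT ∘ₗ S.brace a) (g := LinearMap.id)
    (fun l v hv => by
      have := ι_mem_barGr (R := R) (brace_mem_of_mem_barGr S ha hv)
      rwa [show i + l - 1 = l + (i - 1) by ring] at this)
    (fun l v hv => by simpa using hv) hw
  simpa using this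

theorem barMul_mem {i j : ℤ} {v w : TensorAlgebra R A} (hv : v ∈ barGr S.gr i)
    (hw : w ∈ barGr S.gr j) : barMul S v w ∈ barGr S.gr (i + j) := by
  have := barGr_induction (gr := S.gr) (C := fun i v => ∀ j w, w ∈ barGr S.gr j →
    barMul S v w ∈ barGr S.gr (j + i)) ?_ ?_ ?_ ?_ ?_ hv j w hw
  · rwa [add_comm]
  · intro i j w _
    simp
  · intro j w hw
    simpa using hw
  · intro i l v a _ hv ha j w hw
    rw [barMul_mul_ι S v ha]
    exact conv_mem_barGr (fun j w hw => by simpa using hv j _ (twist_mem S.internal (l - 1) hw))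
      (fun j w hw => leadingBrace_mem S ha hw) hw
  · intro i v v' hv hv' j w hw
    rw [map_add]; exact add_mem (hv j w hw) (hv' j w hw)
  · intro i r v hv j w hw
    rw [map_smul]; exact Submodule.smul_mem _ r (hv j w hw)

variable {F : TensorAlgebra R A ⊗[R] TensorAlgebra R A →ₗ[R]
    TensorAlgebra R A ⊗[R] TensorAlgebra R A →ₗ[R] TensorAlgebra R A ⊗[R] TensorAlgebra R A}

theorem barMul_tmul (hF : F = tensorOp (barGr S.gr) (isInternal_barGr S.internal) (barMul S)
    (barMul S)) (v : TensorAlgebra R A) {j : ℤ} {w : TensorAlgebra R A} (hw : w ∈ barGr S.gr j) :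
    F (v ⊗ₜ w) =
      TensorProduct.map (barMul S v ∘ₗ (twist S.internal j).toLinearMap) (barMul S w) := by
  refine apply_tmul_eq_map (isInternal_barGr S.internal) hF v hw ?_
  intro i z hz
  rw [AlgHom.toLinearMap_apply, twist_apply S.internal j hz]

/-- The product on the bar complex is a morphism of coalgebras. -/
theorem decon_barMul (hF : F = tensorOp (barGr S.gr) (isInternal_barGr S.internal) (barMul S)
    (barMul S)) (v w : TensorAlgebra R A) :
    decon (barMul S v w) = F (decon v) (decon w) := by
  -- Appending `a` to the right leg raises its degree by `i - 1`, so the Koszul twist on the left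
  -- leg of the second argument changes by exactly the twist in the recursion for the product.
  have key : ∀ {i : ℤ} {a : A}, a ∈ S.gr i → ∀ ξ : 𝕋 ⊗[R] 𝕋, F (ξ * (1 ⊗ₜ ιT a)) ∘ₗ decon =
      conv ((F ξ ∘ₗ decon) ∘ₗ (twist S.internal (i - 1)).toLinearMap)
        (inclR.toLinearMap ∘ₗ leadingBrace S a) := by
    intro i a ha ξ
    refine tensor_induction_homogeneous (isInternal_barGr S.internal)
      (C := fun ξ => F (ξ * (1 ⊗ₜ ιT a)) ∘ₗ decon =
        conv ((F ξ ∘ₗ decon) ∘ₗ (twist S.internal (i - 1)).toLinearMap)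
        (inclR.toLinearMap ∘ₗ leadingBrace S a)) ?_ ?_ ?_ ξ
    · ext w; simp [conv_apply]
    · intro p q x y hx hy
      rw [Algebra.TensorProduct.tmul_mul_tmul, mul_one,
        barMul_tmul S hF _ (mul_ι_mem_barGr hy ha), barMul_tmul S hF _ hy,
        map_decon_eq_conv, map_decon_eq_conv, barMul_mul_ι S y ha,
        conv_comp _ _ _ (decon_twist S.internal (i - 1)), conv_assoc, algHom_comp_conv]
      simp only [LinearMap.comp_assoc, twist_twist]
    · intro ξ η hξ hη
      rw [add_mul, map_add, LinearMap.add_comp, hξ, hη, map_add, LinearMap.add_comp,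
        LinearMap.add_comp, conv_add_left]
  have main : ∀ v, decon ∘ₗ barMul S v = F (decon v) ∘ₗ decon := by
    intro v
    induction v using tensorAlgebra_induction_right with
    | one =>
      rw [barMul_one_left, LinearMap.comp_id, decon_one,
        barMul_tmul S hF _ one_mem_barGr, barMul_one_left]
      rw [twist_zero, LinearMap.comp_id, TensorProduct.map_id, LinearMap.id_comp]
    | mul_ι w a ih =>
      refine homogeneous_induction S.internal (C := fun a => decon ∘ₗ barMul S (w * ιT a) =
        F (decon (w * ιT a)) ∘ₗ decon) ?_ ?_ a
      · intro i a ha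
        have h1 : F ((w * ιT a) ⊗ₜ 1) ∘ₗ decon =
            conv (inclL.toLinearMap ∘ₗ barMul S (w * ιT a)) inclR.toLinearMap := by
          rw [barMul_tmul S hF _ one_mem_barGr, map_decon_eq_conv, barMul_one_left]
          rw [twist_zero, LinearMap.comp_id, LinearMap.comp_id]
        -- `key` treats the cuts before `a` and `h1` the cut after `a`. On the other side the
        -- correction term of `decon_comp_conv` cancels against one half of the coderivation formula
        -- for the leading brace.
        rw [decon_mul_ι, map_add, LinearMap.add_comp, key ha, h1, barMul_mul_ι S w ha,
          decon_comp_conv, ← ih, leadingBrace_apply, decon_comp_conv_ι_id, conv_add_right,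
          algHom_comp_conv inclL (barMul S w ∘ₗ _), conv_assoc, LinearMap.comp_assoc]
        abel
      · intro a b ha hb
        rw [map_add, mul_add, map_add, LinearMap.comp_add, ha, hb, map_add, map_add,
          LinearMap.add_comp]
    | add v w hv hw => rw [map_add, LinearMap.comp_add, hv, hw, map_add, map_add, LinearMap.add_comp]
    | smul r w hw => rw [map_smul, LinearMap.comp_smul, hw, map_smul, map_smul, LinearMap.smul_comp]
  exact LinearMap.congr_fun (main v) w

/-! ### The letter component of the product -/

theorem letter_mul (v w : TensorAlgebra R A) :
    letter (v * w) = decounit v • letter w + decounit w • letter v := by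
  induction w using tensorAlgebra_induction_right with
  | one => simp
  | mul_ι w a ih => rw [← mul_assoc]; simp [mul_smul]
  | add x y hx hy => rw [mul_add, map_add, hx, hy]; simp [add_smul]; abel
  | smul r x hx => rw [mul_smul_comm, map_smul, hx]; simp [mul_smul, smul_comm r]

theorem decounit_twist {gr : ℤ → Submodule R A} (h : DirectSum.IsInternal gr) (j : ℤ)
    (w : TensorAlgebra R A) : decounit (twist h j w) = decounit w := by
  have : decounit.comp (twist h j) = (decounit : 𝕋 →ₐ[R] R) := by
    ext a; simp
  exact congrArg (fun f : 𝕋 →ₐ[R] R => f w) this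

theorem decounit_conv_ι_id (b : TensorAlgebra R A →ₗ[R] A) (w : TensorAlgebra R A) :
    decounit (conv (ιT ∘ₗ b) LinearMap.id w) = 0 := by
  rw [conv_apply]
  generalize decon w = ζ
  induction ζ with
  | zero => simp
  | add x y hx hy => rw [map_add, map_add, map_add, hx, hy, add_zero]
  | tmul x y => simp

theorem letter_conv_ι_id (b : TensorAlgebra R A →ₗ[R] A) (w : TensorAlgebra R A) :
    letter (conv (ιT ∘ₗ b) LinearMap.id w) = b w := by
  have h : ∀ ζ : 𝕋 ⊗[R] 𝕋, letter (LinearMap.mul' R 𝕋 (TensorProduct.map (ιT ∘ₗ b)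
      LinearMap.id ζ)) = b (TensorProduct.rid R 𝕋 (decounit.toLinearMap.lTensor 𝕋 ζ)) := by
    intro ζ
    induction ζ with
    | zero => simp
    | add x y hx hy => simp only [map_add, hx, hy]
    | tmul x y => simp [letter_mul]
  rw [conv_apply, h, lTensor_decounit_decon]
  simp

theorem decounit_leadingBrace (a : A) : decounit.toLinearMap ∘ₗ leadingBrace S a = 0 :=
  LinearMap.ext (decounit_conv_ι_id (S.brace a))

theorem letter_leadingBrace (a : A) : letter ∘ₗ leadingBrace S a = S.brace a :=
  LinearMap.ext (letter_conv_ι_id (S.brace a))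

theorem decounit_barMul (v w : TensorAlgebra R A) :
    decounit (barMul S v w) = decounit v * decounit w := by
  induction v using tensorAlgebra_induction_right generalizing w with
  | one => simp
  | mul_ι v a ih =>
    refine homogeneous_induction S.internal (C := fun a => decounit (barMul S (v * ιT a) w) =
      decounit (v * ιT a) * decounit w) ?_ ?_ a
    · intro i a ha
      rw [barMul_mul_ι S v ha, conv_apply]
      have h := LinearMap.congr_fun (decounit_leadingBrace S a)
      simp only [LinearMap.comp_apply, AlgHom.toLinearMap_apply, LinearMap.zero_apply] at h
      rw [map_mul, decounit_ι, mul_zero, zero_mul]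
      generalize decon w = ζ
      induction ζ with
      | zero => simp
      | add x y hx hy => rw [map_add, map_add, map_add, hx, hy, add_zero]
      | tmul x y => simp [h]
    · intro a b ha hb
      rw [map_add, mul_add, map_add, LinearMap.add_apply, map_add, ha, hb, map_add, add_mul]
  | add x y hx hy => simp [hx, hy, add_mul]
  | smul r x hx => simp [hx, mul_assoc]

/-- A product of words has one letter only if the left word is empty and the right one is a letter,
or if the left word is a letter that takes the whole right word as arguments. -/
theorem letter_barMul (v w : TensorAlgebra R A) :
    letter (barMul S v w) = decounit v • letter w + S.brace (letter v) w := by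
  induction v using tensorAlgebra_induction_right generalizing w with
  | one => simp
  | mul_ι v a ih =>
    refine homogeneous_induction S.internal (C := fun a => letter (barMul S (v * ιT a) w) =
      decounit (v * ιT a) • letter w + S.brace (letter (v * ιT a)) w) ?_ ?_ a
    · intro i a ha
      have h := LinearMap.congr_fun (decounit_leadingBrace S a)
      have h' := LinearMap.congr_fun (letter_leadingBrace S a)
      simp only [LinearMap.comp_apply, AlgHom.toLinearMap_apply, LinearMap.zero_apply] at h h'
      have key : ∀ ζ : 𝕋 ⊗[R] 𝕋, letter (LinearMap.mul' R 𝕋 (TensorProduct.map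
          (barMul S v ∘ₗ (twist S.internal (i - 1)).toLinearMap) (leadingBrace S a) ζ)) =
          decounit v • S.brace a (TensorProduct.lid R 𝕋 (decounit.toLinearMap.rTensor 𝕋 ζ)) := by
        intro ζ
        induction ζ with
        | zero => simp
        | add x y hx hy => simp only [map_add, hx, hy, smul_add]
        | tmul x y => simp [letter_mul, h, h', decounit_barMul, decounit_twist, mul_smul]
      rw [barMul_mul_ι S v ha, conv_apply, key, rTensor_decounit_decon]
      simp
    · intro a b ha hb
      rw [map_add, mul_add, map_add, LinearMap.add_apply, map_add, ha, hb, map_add, map_add,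
        map_add, LinearMap.add_apply, add_smul]
      abel
  | add x y hx hy => simp [hx, hy, add_smul]; abel
  | smul r x hx => simp [hx, mul_smul]

end BarProduct

/-! ### Words given by lists -/

section ListWords

variable {R : Type*} [CommRing R] {A : Type*} [AddCommGroup A] [Module R A]

local notation "𝕋" => TensorAlgebra R A
local notation "ιT" => TensorAlgebra.ι R

/-- The word with the letters in a list. -/
def listWord (R : Type*) [CommRing R] {A : Type*} [AddCommGroup A] [Module R A] (l : List A) :
    TensorAlgebra R A :=
  (l.map (TensorAlgebra.ι R)).prod

@[simp]
theorem listWord_nil : listWord R ([] : List A) = 1 := rfl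

@[simp]
theorem listWord_singleton (a : A) : listWord R [a] = ιT a := by simp [listWord]

theorem listWord_cons (a : A) (l : List A) : listWord R (a :: l) = ιT a * listWord R l := by
  simp [listWord]

theorem listWord_append (l l' : List A) :
    listWord R (l ++ l') = listWord R l * listWord R l' := by
  simp [listWord]

theorem word_eq_listWord {n : ℕ} (y : Fin n → A) : word R y = listWord R (List.ofFn y) := by
  rw [word, TensorAlgebra.tprod_apply, listWord, List.map_ofFn]
  rfl

theorem seg_eq_listWord {m : ℕ} (y : Fin m → A) (s l : ℕ) :
    seg R y s l = listWord R (((List.ofFn y).drop s).take l) := by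
  rw [seg, listWord, List.map_take, List.map_drop, List.map_ofFn]
  rfl

theorem word_eq_seg {n : ℕ} (y : Fin n → A) : word R y = seg R y 0 n := by
  rw [word_eq_listWord, seg_eq_listWord, List.drop_zero, List.take_of_length_le (by simp)]

theorem seg_one {n : ℕ} (y : Fin n → A) (s : ℕ) (hs : s < n) :
    seg R y s 1 = ιT (y ⟨s, hs⟩) := by
  rw [seg_eq_listWord, List.drop_eq_getElem_cons (by simpa using hs)]
  simp

theorem seg_mul_seg {n : ℕ} (y : Fin n → A) (s k l : ℕ) :
    seg R y s k * seg R y (s + k) l = seg R y s (k + l) := by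
  rw [seg_eq_listWord, seg_eq_listWord, seg_eq_listWord, ← listWord_append, List.take_add,
    List.drop_drop]

/-- The initial part of a family. -/
abbrev initial {X : Type*} {m : ℕ} (y : Fin m → X) (i : ℕ) (hi : i ≤ m) : Fin i → X :=
  fun q => y (Fin.castLE hi q)

theorem seg_initial {m : ℕ} (y : Fin m → A) {i : ℕ} (hi : i ≤ m) {s l : ℕ} (hsl : s + l ≤ i) :
    seg R (initial y i hi) s l = seg R y s l := by
  have : List.ofFn (initial y i hi) = (List.ofFn y).take i := by
    apply List.ext_getElem
    · simp [hi]
    · intro q h1 h2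
      simp only [List.getElem_ofFn, List.getElem_take]
      rfl
  rw [seg_eq_listWord, seg_eq_listWord, this, List.drop_take, List.take_take,
    min_eq_left (by omega)]

theorem seg_zero_eq_word {m : ℕ} (y : Fin m → A) {i : ℕ} (hi : i ≤ m) :
    seg R y 0 i = word R (initial y i hi) := by
  rw [word_eq_seg, seg_initial y hi (by simp)]

theorem seg_eq_word {m : ℕ} (y : Fin m → A) {s l : ℕ} (hsl : s + l ≤ m) :
    seg R y s l = word R (fun q : Fin l => y ⟨s + q, by omega⟩) := by
  rw [word_eq_listWord, seg_eq_listWord]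
  congr 1
  apply List.ext_getElem
  · simp; omega
  · intro q h1 h2
    simp

theorem word_update {n : ℕ} (y : Fin n → A) (i : Fin n) (a : A) :
    word R (Function.update y i a) =
      seg R y 0 i * ιT a * seg R y (i + 1) (n - 1 - i) := by
  rw [word_eq_listWord, seg_eq_listWord, seg_eq_listWord, ← listWord_singleton (R := R) a,
    ← listWord_append, ← listWord_append]
  congr 1
  have hi := i.isLt
  apply List.ext_getElem
  · simp; omega
  · intro q h1 h2
    simp only [List.length_ofFn] at h1
    simp only [List.getElem_ofFn, List.getElem_append, List.drop_zero, List.length_take,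
      List.length_ofFn, List.getElem_take, List.getElem_drop, List.length_append,
      List.length_singleton, List.getElem_singleton]
    rcases lt_trichotomy q i with hq | hq | hq
    · rw [dif_pos (by omega), dif_pos (by omega), Function.update_of_ne]
      exact fun h => by rw [← h] at hq; simp at hq
    · subst hq
      rw [dif_pos (by omega), dif_neg (by omega)]
      simp
    · rw [dif_neg (by omega), Function.update_of_ne]
      · congr 2
        omega
      · exact fun h => by rw [← h] at hq; simp at hq

theorem decon_listWord (l : List A) : decon (listWord R l) =
    ∑ i ∈ Finset.range (l.length + 1), listWord R (l.take i) ⊗ₜ[R] listWord R (l.drop i) := by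
  induction l using List.reverseRecOn with
  | nil => simp
  | append_singleton l a ih =>
    rw [listWord_append, listWord_singleton, decon_mul_ι, ih, List.length_append,
      List.length_singleton, Finset.sum_range_succ _ (l.length + 1), Finset.sum_mul]
    congr 1
    · refine Finset.sum_congr rfl fun i hi => ?_
      have hi : i ≤ l.length := by simpa [Nat.lt_succ_iff] using hi
      rw [List.take_append_of_le_length hi, List.drop_append_of_le_length hi, listWord_append]
      simp
    · rw [List.take_of_length_le (by simp), List.drop_of_length_le (by simp), listWord_append]
      simp

theorem decon_word {n : ℕ} (y : Fin n → A) : decon (word R y) =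
    ∑ i ∈ Finset.range (n + 1), seg R y 0 i ⊗ₜ[R] seg R y i (n - i) := by
  rw [word_eq_listWord, decon_listWord, List.length_ofFn]
  refine Finset.sum_congr rfl fun i hi => ?_
  rw [seg_eq_listWord, seg_eq_listWord, List.drop_zero,
    List.take_of_length_le (l := (List.ofFn y).drop i) (by simp)]

theorem decounit_listWord (l : List A) :
    decounit (listWord R l) = if l.length = 0 then (1 : R) else 0 := by
  cases l with
  | nil => simp
  | cons a l => simp [listWord_cons]

theorem decounit_word {n : ℕ} (y : Fin n → A) :
    decounit (word R y) = if n = 0 then (1 : R) else 0 := by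
  rw [word_eq_listWord, decounit_listWord, List.length_ofFn]

theorem letter_listWord (l : List A) (hl : l.length ≠ 1) : letter (listWord R l) = 0 := by
  match l, hl with
  | [], _ => simp
  | [a], h => simp at h
  | a :: b :: l, _ => simp [listWord_cons, letter_mul]

theorem letter_seg_of_ne_one {m : ℕ} (y : Fin m → A) {s l : ℕ} (hl : s + l ≤ m) (h : l ≠ 1) :
    letter (seg R y s l) = 0 := by
  rw [seg_eq_listWord, letter_listWord]
  simp; omega

theorem letter_seg_one {m : ℕ} (y : Fin m → A) {s : ℕ} (hs : s < m) :
    letter (seg R y s 1) = y ⟨s, hs⟩ := by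
  rw [seg_one y s hs, letter_ι]

theorem decon_seg {m : ℕ} (y : Fin m → A) {s k : ℕ} (hk : s + k ≤ m) :
    decon (seg R y s k) =
      ∑ l ∈ Finset.range (k + 1), seg R y s l ⊗ₜ[R] seg R y (s + l) (k - l) := by
  have hlen : (((List.ofFn y).drop s).take k).length = k := by simp; omega
  rw [seg_eq_listWord, decon_listWord, hlen]
  refine Finset.sum_congr rfl fun l hl => ?_
  simp only [Finset.mem_range] at hl
  rw [seg_eq_listWord, seg_eq_listWord, List.take_take, min_eq_left (by omega), List.drop_take,
    List.drop_drop]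

/-- A threefold convolution sums over prefix, middle and suffix, which is the shape of both the
differential and one step of the product. -/
theorem conv_conv_word {n : ℕ} (f g h : TensorAlgebra R A →ₗ[R] TensorAlgebra R A)
    (y : Fin n → A) : conv f (conv g h) (word R y) =
      ∑ i ∈ Finset.range (n + 1), ∑ l ∈ Finset.range (n - i + 1),
        f (seg R y 0 i) * (g (seg R y i l) * h (seg R y (i + l) (n - i - l))) := by
  rw [conv_apply, decon_word, map_sum, map_sum]
  refine Finset.sum_congr rfl fun i hi => ?_
  simp only [Finset.mem_range] at hi
  rw [TensorProduct.map_tmul, LinearMap.mul'_apply, conv_apply, decon_seg y (by omega), map_sum,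
    map_sum, Finset.mul_sum]
  simp

variable {gr : ℤ → Submodule R A}

theorem seg_mem_barGr {m : ℕ} {y : Fin m → A} {b : Fin m → ℤ} (hy : ∀ q, y q ∈ gr (b q))
    {i : ℕ} (hi : i ≤ m) : seg R y 0 i ∈
      barGr gr (∑ q ∈ Finset.univ.filter (fun q : Fin m => (q : ℕ) < i), (b q - 1)) := by
  rw [seg_zero_eq_word y hi]
  have := word_mem_barGr (R := R) (gr := gr) (b := initial b i hi) (y := initial y i hi)
    fun q => hy _
  convert this using 2
  symm
  refine Finset.sum_bij (fun q _ => Fin.castLE hi q) ?_ ?_ ?_ ?_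
  · intro q _; simp
  · intro q _ q' _ h; simpa using h
  · intro q hq
    simp only [Finset.mem_filter, Finset.mem_univ, true_and] at hq
    exact ⟨⟨q, hq⟩, by simp, rfl⟩
  · intro q _; rfl

theorem sum_filter_initial {M : Type*} [AddCommMonoid M] {m : ℕ} (g : Fin m → M) {i : ℕ}
    (hi : i ≤ m) {s : ℕ} (hs : s ≤ i) :
    ∑ q ∈ Finset.univ.filter (fun q : Fin i => (q : ℕ) < s), initial g i hi q =
      ∑ q ∈ Finset.univ.filter (fun q : Fin m => (q : ℕ) < s), g q := by
  refine Finset.sum_bij (fun q _ => Fin.castLE hi q) ?_ ?_ ?_ ?_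
  · intro q hq; simpa using hq
  · intro q _ q' _ h; simpa using h
  · intro q hq
    simp only [Finset.mem_filter, Finset.mem_univ, true_and] at hq
    exact ⟨⟨q, by omega⟩, by simpa using hq, rfl⟩
  · intro q _; rfl

/-- A list of homogeneous letters. -/
def Homogeneous (gr : ℤ → Submodule R A) (l : List A) : Prop := ∀ a ∈ l, ∃ i, a ∈ gr i

theorem listWord_mem_barGr {l : List A} (hl : Homogeneous gr l) :
    ∃ i, listWord R l ∈ barGr gr i := by
  choose! b hb using hl
  have := word_mem_barGr (R := R) (gr := gr) (b := fun q => b (l.get q)) (y := l.get)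
    fun q => hb _ (l.get_mem q)
  rw [word_eq_listWord, List.ofFn_get] at this
  exact ⟨_, this⟩

theorem listWord_induction (h : DirectSum.IsInternal gr) {C : TensorAlgebra R A → Prop}
    (hom : ∀ l, Homogeneous gr l → C (listWord R l)) (add : ∀ v w, C v → C w → C (v + w))
    (smul : ∀ (r : R) w, C w → C (r • w)) (w : TensorAlgebra R A) : C w := by
  refine homogeneous_induction (isInternal_barGr h) (C := C) ?_ add w
  intro i w hw
  rw [barGr] at hw
  induction hw using Submodule.span_induction with
  | zero => simpa using smul 0 1 (hom [] (by simp [Homogeneous]))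
  | add x y _ _ hx hy => exact add x y hx hy
  | smul r x _ hx => exact smul r x hx
  | mem x hx =>
    obtain ⟨n, b, y, hy, rfl, rfl⟩ := hx
    rw [word_eq_listWord]
    refine hom _ fun a ha => ?_
    obtain ⟨q, rfl⟩ := List.mem_ofFn' y a |>.mp ha
    exact ⟨_, hy q⟩

theorem decon_listWord_induction {C : TensorAlgebra R A ⊗[R] TensorAlgebra R A → Prop} {l : List A}
    (hl : Homogeneous gr l) (zero : C 0) (add : ∀ ξ η, C ξ → C η → C (ξ + η))
    (tmul : ∀ l₁ l₂, Homogeneous gr l₁ → Homogeneous gr l₂ → l = l₁ ++ l₂ →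
      C (listWord R l₁ ⊗ₜ listWord R l₂)) : C (decon (listWord R l)) := by
  rw [decon_listWord]
  refine Finset.sum_induction _ C add zero fun i _ => tmul _ _ ?_ ?_ (by simp)
  · exact fun a ha => hl a (List.mem_of_mem_take ha)
  · exact fun a ha => hl a (List.mem_of_mem_drop ha)

end ListWords

/-! ### The product of words -/

section Insertions

variable {R : Type*} [CommRing R] {A : Type*} [AddCommGroup A] [Module R A]

local notation "𝕋" => TensorAlgebra R A
local notation "ιT" => TensorAlgebra.ι R

/-- Add a last brace, at the location `i` and of length `l`, to an insertion. -/
def snocInsertion {n m : ℕ} {i l : ℕ} (hil : i + l ≤ m)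
    (e : (Fin n → Fin (i + 1)) × (Fin n → Fin (i + 1))) :
    (Fin (n + 1) → Fin (m + 1)) × (Fin (n + 1) → Fin (m + 1)) :=
  (Fin.snoc (α := fun _ => Fin (m + 1)) (fun p => Fin.castLE (by omega) (e.1 p)) ⟨i, by omega⟩,
    Fin.snoc (α := fun _ => Fin (m + 1)) (fun p => Fin.castLE (by omega) (e.2 p)) ⟨l, by omega⟩)

section

variable {n m : ℕ} {i l : ℕ} (hil : i + l ≤ m) (e : (Fin n → Fin (i + 1)) × (Fin n → Fin (i + 1)))

@[simp]
theorem snocInsertion_fst_castSucc (p : Fin n) :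
    ((snocInsertion hil e).1 p.castSucc : ℕ) = e.1 p := by simp [snocInsertion]

@[simp]
theorem snocInsertion_snd_castSucc (p : Fin n) :
    ((snocInsertion hil e).2 p.castSucc : ℕ) = e.2 p := by simp [snocInsertion]

@[simp]
theorem snocInsertion_fst_last : ((snocInsertion hil e).1 (Fin.last n) : ℕ) = i := by
  simp [snocInsertion]

@[simp]
theorem snocInsertion_snd_last : ((snocInsertion hil e).2 (Fin.last n) : ℕ) = l := by
  simp [snocInsertion]

end

theorem mem_insertions {n m : ℕ} {e : (Fin n → Fin (m + 1)) × (Fin n → Fin (m + 1))} :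
    e ∈ insertions n m ↔ (∀ p, (e.1 p : ℕ) + e.2 p ≤ m) ∧
      ∀ p p', p < p' → (e.1 p : ℕ) + e.2 p ≤ e.1 p' := by
  simp [insertions]

theorem exists_snocInsertion {n m : ℕ} {c : (Fin (n + 1) → Fin (m + 1)) × (Fin (n + 1) → Fin (m + 1))}
    (hc : c ∈ insertions (n + 1) m) : ∃ (i l : ℕ) (hil : i + l ≤ m)
      (e : (Fin n → Fin (i + 1)) × (Fin n → Fin (i + 1))),
        e ∈ insertions n i ∧ snocInsertion hil e = c := by
  rw [mem_insertions] at hc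
  obtain ⟨h1, h2⟩ := hc
  have h3 : ∀ p : Fin n, (c.1 p.castSucc : ℕ) + c.2 p.castSucc ≤ c.1 (Fin.last n) :=
    fun p => h2 _ _ (Fin.castSucc_lt_last p)
  refine ⟨c.1 (Fin.last n), c.2 (Fin.last n), h1 _,
    (fun p => ⟨c.1 p.castSucc, by have := h3 p; omega⟩,
      fun p => ⟨c.2 p.castSucc, by have := h3 p; omega⟩), ?_, ?_⟩
  · rw [mem_insertions]
    exact ⟨fun p => h3 p, fun p p' hpp => h2 _ _ (by simpa using hpp)⟩
  · refine Prod.ext (funext fun p => Fin.ext ?_) (funext fun p => Fin.ext ?_)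
    · induction p using Fin.lastCases with
      | last => simp
      | cast p => simp
    · induction p using Fin.lastCases with
      | last => simp
      | cast p => simp

/-- An insertion of `n + 1` braces amounts to a last brace, at location `i` and of length `l`, and
an insertion of the other `n` into the first `i` letters. The condition `i + l ≤ m` always holds in
the range of summation; it is only there to form `snocInsertion`. -/
theorem sum_insertions_succ {M : Type*} [AddCommMonoid M] {n m : ℕ}
    (F : (Fin (n + 1) → Fin (m + 1)) × (Fin (n + 1) → Fin (m + 1)) → M) :
    ∑ e ∈ insertions (n + 1) m, F e =
      ∑ i ∈ Finset.range (m + 1), ∑ l ∈ Finset.range (m - i + 1), ∑ e ∈ insertions n i,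
        if hil : i + l ≤ m then F (snocInsertion hil e) else 0 := by
  have step : ∀ i ∈ Finset.range (m + 1), (∑ l ∈ Finset.range (m - i + 1), ∑ e ∈ insertions n i,
      if hil : i + l ≤ m then F (snocInsertion hil e) else 0) =
      ∑ s ∈ Finset.range (m - i + 1) ×ˢ insertions n i,
        if hil : i + s.1 ≤ m then F (snocInsertion hil s.2) else 0 := fun i _ => by
    rw [Finset.sum_product]
  rw [Finset.sum_congr rfl step, Finset.sum_sigma']
  symm
  refine Finset.sum_bij (fun s hs => snocInsertion (i := s.1) (l := s.2.1) (m := m)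
    (by simp at hs; omega) s.2.2) ?_ ?_ ?_ ?_
  · rintro ⟨i, l, e⟩ hs
    simp only [Finset.mem_sigma, Finset.mem_range, Finset.mem_product, mem_insertions] at hs ⊢
    obtain ⟨h1, h2, h3, h4⟩ := hs
    refine ⟨fun p => ?_, fun p p' hpp => ?_⟩
    · induction p using Fin.lastCases with
      | last => simp; omega
      | cast p => have := h3 p; simp; omega
    · induction p' using Fin.lastCases with
      | last =>
        induction p using Fin.lastCases with
        | last => exact absurd hpp (lt_irrefl _)
        | cast p => have := h3 p; simp; omega
      | cast p' =>
        induction p using Fin.lastCases with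
        | last => exact absurd hpp (by simp [Fin.le_last])
        | cast p => have := h4 p p' (by simpa using hpp); simp; omega
  · rintro ⟨i, l, e⟩ hs ⟨i', l', e'⟩ hs' h
    have hi : i = i' := by
      have := congrArg (fun c => (c.1 (Fin.last n) : ℕ)) h
      simpa using this
    have hl : l = l' := by
      have := congrArg (fun c => (c.2 (Fin.last n) : ℕ)) h
      simpa using this
    subst hi hl
    have he : e = e' := by
      refine Prod.ext (funext fun p => Fin.ext ?_) (funext fun p => Fin.ext ?_)
      · have := congrArg (fun c => (c.1 p.castSucc : ℕ)) h
        simpa using this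
      · have := congrArg (fun c => (c.2 p.castSucc : ℕ)) h
        simpa using this
    rw [he]
  · intro c hc
    obtain ⟨i, l, hil, e, he, rfl⟩ := exists_snocInsertion hc
    refine ⟨⟨i, l, e⟩, ?_, rfl⟩
    simp only [Finset.mem_sigma, Finset.mem_range, Finset.mem_product]
    exact ⟨by omega, by omega, he⟩
  · rintro ⟨i, l, e⟩ hs
    simp only [Finset.mem_sigma, Finset.mem_range, Finset.mem_product] at hs
    exact dif_pos (show i + l ≤ m by omega)

theorem insertionExp_snoc {n m : ℕ} {i l : ℕ} (hil : i + l ≤ m) (a : Fin (n + 1) → ℤ)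
    (b : Fin m → ℤ) (e : (Fin n → Fin (i + 1)) × (Fin n → Fin (i + 1))) :
    insertionExp a b (snocInsertion hil e) =
      insertionExp (fun p => a p.castSucc) (initial b i (by omega)) e +
        (a (Fin.last n) + 1) *
          ∑ q ∈ Finset.univ.filter (fun q : Fin m => (q : ℕ) < i), (b q + 1) := by
  rw [insertionExp, Fin.sum_univ_castSucc, insertionExp]
  simp only [snocInsertion_fst_castSucc, snocInsertion_fst_last]
  congr 1
  refine Finset.sum_congr rfl fun p _ => ?_
  have := sum_filter_initial (fun q => b q + 1) (show i ≤ m by omega) (s := e.1 p)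
    (by have := (e.1 p).isLt; omega)
  rw [← this]

theorem insertionEnd_snoc {n m : ℕ} {i l : ℕ} (hil : i + l ≤ m)
    (e : (Fin n → Fin (i + 1)) × (Fin n → Fin (i + 1))) {p : ℕ} (hp : p ≤ n) :
    insertionEnd (snocInsertion hil e) p = insertionEnd e p := by
  rw [insertionEnd, insertionEnd]
  apply le_antisymm
  · refine Finset.sup_le fun p' hp' => ?_
    simp only [Finset.mem_filter, Finset.mem_univ, true_and] at hp'
    induction p' using Fin.lastCases with
    | last => simp at hp'; omega
    | cast p' =>
      simp only [snocInsertion_fst_castSucc, snocInsertion_snd_castSucc]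
      exact Finset.le_sup (f := fun p' => (e.1 p' : ℕ) + e.2 p') (by simpa using hp')
  · refine Finset.sup_le fun p' hp' => ?_
    simp only [Finset.mem_filter, Finset.mem_univ, true_and] at hp'
    have := Finset.le_sup (s := Finset.univ.filter fun p' : Fin (n + 1) => (p' : ℕ) < p)
      (f := fun p' => ((snocInsertion hil e).1 p' : ℕ) + (snocInsertion hil e).2 p')
      (b := p'.castSucc) (by simpa using hp')
    simpa using this

theorem insertionEnd_le {n m : ℕ} {e : (Fin n → Fin (m + 1)) × (Fin n → Fin (m + 1))}
    (he : e ∈ insertions n m) (p : ℕ) : insertionEnd e p ≤ m :=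
  Finset.sup_le fun p' _ => (mem_insertions.mp he).1 p'

theorem insertionEnd_le_fst {n m : ℕ} {e : (Fin n → Fin (m + 1)) × (Fin n → Fin (m + 1))}
    (he : e ∈ insertions n m) (p : Fin n) : insertionEnd e p ≤ e.1 p :=
  Finset.sup_le fun p' hp' => (mem_insertions.mp he).2 p' p (by simpa using hp')

theorem insertionEnd_snoc_last {n m : ℕ} {i l : ℕ} (hil : i + l ≤ m)
    {e : (Fin n → Fin (i + 1)) × (Fin n → Fin (i + 1))} (he : e ∈ insertions n i) :
    insertionEnd (snocInsertion hil e) (n + 1) = i + l := by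
  rw [insertionEnd]
  apply le_antisymm
  · refine Finset.sup_le fun p' hp' => ?_
    induction p' using Fin.lastCases with
    | last => simp
    | cast p' =>
      have := (mem_insertions.mp he).1 p'
      simp; omega
  · have := Finset.le_sup (s := Finset.univ.filter fun p' : Fin (n + 1) => (p' : ℕ) < n + 1)
      (f := fun p' => ((snocInsertion hil e).1 p' : ℕ) + (snocInsertion hil e).2 p')
      (b := Fin.last n) (by simp)
    simpa using this

/-- Splitting off the last brace of a term puts it in the form produced by `barMul_mul_ι`. -/
theorem insertionWord_snoc (brace : A →ₗ[R] TensorAlgebra R A →ₗ[R] A) {n m : ℕ} {i l : ℕ}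
    (hil : i + l ≤ m) {e : (Fin n → Fin (i + 1)) × (Fin n → Fin (i + 1))}
    (he : e ∈ insertions n i) (x : Fin (n + 1) → A) (y : Fin m → A) :
    insertionWord brace x y (snocInsertion hil e) =
      insertionWord brace (fun p => x p.castSucc) (initial y i (by omega)) e *
        (ιT (brace (x (Fin.last n)) (seg R y i l)) * seg R y (i + l) (m - i - l)) := by
  rw [insertionWord, List.ofFn_succ', List.concat_eq_append, List.prod_append, List.prod_singleton,
    insertionWord]
  have h1 := insertionEnd_le he n
  simp only [Fin.val_castSucc, snocInsertion_fst_castSucc, snocInsertion_snd_castSucc,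
    Fin.val_last, snocInsertion_fst_last, snocInsertion_snd_last, insertionEnd_snoc hil e le_rfl,
    insertionEnd_snoc_last hil he]
  rw [seg_initial y (by omega) (by omega), show m - (i + l) = m - i - l by omega]
  have h2 : (fun p : Fin n => seg R (initial y i (by omega)) (insertionEnd e p)
      ((e.1 p : ℕ) - insertionEnd e p) *
        ιT (brace (x p.castSucc) (seg R (initial y i (by omega)) (e.1 p) (e.2 p)))) =
      fun p : Fin n => seg R y (insertionEnd (snocInsertion hil e) p)
          ((e.1 p : ℕ) - insertionEnd (snocInsertion hil e) p) *
        ιT (brace (x p.castSucc) (seg R y (e.1 p) (e.2 p))) := by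
    funext p
    rw [insertionEnd_snoc hil e p.isLt.le]
    have h3 := (mem_insertions.mp he).1 p
    have h4 := insertionEnd_le_fst he p
    rw [seg_initial y (by omega) (by omega), seg_initial y (by omega) (by omega)]
  rw [h2]
  simp only [mul_assoc]

theorem insertions_zero (m : ℕ) : insertions 0 m = {(Fin.elim0, Fin.elim0)} := by
  ext e
  rw [mem_insertions, Finset.mem_singleton]
  exact ⟨fun _ => Prod.ext (funext fun p => p.elim0) (funext fun p => p.elim0),
    fun _ => ⟨fun p => p.elim0, fun p => p.elim0⟩⟩

theorem even_mul_sub_mul {a b c d : ℤ} (h1 : Even (a - b)) (h2 : Even (c - d)) :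
    Even (a * c - b * d) := by
  obtain ⟨k, hk⟩ := h1
  obtain ⟨l, hl⟩ := h2
  exact ⟨k * c + b * l, by linear_combination c * hk + b * hl⟩

theorem even_sum_sub_sum {I : Type*} (s : Finset I) {f g : I → ℤ}
    (h : ∀ i ∈ s, Even (f i - g i)) : Even (∑ i ∈ s, f i - ∑ i ∈ s, g i) := by
  rw [← Finset.sum_sub_distrib]
  exact Finset.sum_induction _ Even (fun a b => Even.add) Even.zero h

/-- Induction on the left word: the cuts in the recursive definition are the location and length of
the last brace. -/
theorem barMul_word (S : BraceAlgebra R A) {n m : ℕ} {a : Fin n → ℤ} {b : Fin m → ℤ}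
    {x : Fin n → A} {y : Fin m → A} (hx : ∀ p, x p ∈ S.gr (a p)) (hy : ∀ q, y q ∈ S.gr (b q)) :
    barMul S (word R x) (word R y) =
      ∑ e ∈ insertions n m, (insertionExp a b e).negOnePow • insertionWord S.brace x y e := by
  induction n generalizing m with
  | zero =>
    rw [word_zero, barMul_one_left, insertions_zero, Finset.sum_singleton]
    simp [insertionExp, insertionWord, insertionEnd, word_eq_seg]
  | succ n ih =>
    rw [word_succ, barMul_mul_ι S _ (hx _), leadingBrace_apply, conv_conv_word,
      sum_insertions_succ]
    refine Finset.sum_congr rfl fun i hi => Finset.sum_congr rfl fun l hl => ?_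
    simp only [Finset.mem_range] at hi hl
    rw [LinearMap.comp_apply, AlgHom.toLinearMap_apply,
      twist_apply _ _ (seg_mem_barGr hy (show i ≤ m by omega)), Units.smul_def, map_zsmul,
      seg_zero_eq_word y (show i ≤ m by omega),
      ih (fun p => hx p.castSucc) (fun q => hy (Fin.castLE (show i ≤ m by omega) q)),
      Finset.smul_sum, Finset.sum_mul]
    refine Finset.sum_congr rfl fun e he => ?_
    rw [dif_pos (by omega), insertionWord_snoc S.brace (show i + l ≤ m by omega) he,
      insertionExp_snoc, Int.negOnePow_add, ← Units.smul_def, smul_smul, smul_mul_assoc]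
    congr 1
    rw [mul_comm]
    congr 1
    -- The insertion exponent uses `|x| + 1` and `|y| + 1`, the twist `|x| - 1` and `|y| - 1`; the
    -- parities agree.
    exact negOnePow_congr (even_mul_sub_mul ⟨-1, by ring⟩
      (even_sum_sub_sum _ fun q _ => ⟨-1, by ring⟩))

end Insertions

section BarDifferential

variable {R : Type*} [CommRing R] {A : Type*} [AddCommGroup A] [Module R A]

local notation "𝕋" => TensorAlgebra R A
local notation "ιT" => TensorAlgebra.ι R

/-! ### The differential of the bar complex -/

/-- The product of two letters, as an operation of degree `1` on the shifted module. -/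
def shiftedMul (S : DGA R A) : A →ₗ[R] A →ₗ[R] A := S.mul ∘ₗ letterTwist S.internal 1

theorem shiftedMul_apply (S : DGA R A) {i : ℤ} {a : A} (ha : a ∈ S.gr i) (b : A) :
    shiftedMul S a b = (i - 1).negOnePow • S.mul a b := by
  rw [shiftedMul, LinearMap.comp_apply, letterTwist_apply _ _ ha, one_mul, Units.smul_def,
    Units.smul_def, map_zsmul, LinearMap.smul_apply]

/-- The product of the letters of words of length `2`. -/
def twoMul (S : DGA R A) : TensorAlgebra R A →ₗ[R] A :=
  TensorProduct.lift (shiftedMul S) ∘ₗ TensorProduct.map letter letter ∘ₗ decon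

/-- The letter component of the differential. -/
def letterD (S : DGA R A) : TensorAlgebra R A →ₗ[R] A := S.d ∘ₗ letter + twoMul S

/-- The differential of the bar complex. -/
def barD (S : DGA R A) : TensorAlgebra R A →ₗ[R] TensorAlgebra R A :=
  conv (twist S.internal 1).toLinearMap (conv (ιT ∘ₗ letterD S) LinearMap.id)

variable (S : DGA R A)

/-- Convolving a coalgebra endomorphism `τ` with such a `G` yields a `τ`-twisted coderivation. The
middle terms cancel as in `decon_barMul`. -/
theorem decon_comp_conv_twist (τ G : TensorAlgebra R A →ₗ[R] TensorAlgebra R A)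
    (hτ : decon ∘ₗ τ = TensorProduct.map τ τ ∘ₗ decon)
    (hG : decon ∘ₗ G =
      inclR.toLinearMap ∘ₗ G + conv (inclL.toLinearMap ∘ₗ G) inclR.toLinearMap) :
    decon ∘ₗ conv τ G = ((conv τ G).rTensor 𝕋 + TensorProduct.map τ (conv τ G)) ∘ₗ decon := by
  rw [LinearMap.add_comp, LinearMap.rTensor, map_decon_eq_conv, map_decon_eq_conv,
    LinearMap.comp_id, decon_comp_conv, hG, hτ, map_decon_eq_conv, conv_add_right, conv_assoc,
    algHom_comp_conv, algHom_comp_conv, conv_assoc]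
  abel

theorem decon_barD (w : TensorAlgebra R A) : decon (barD S w) =
    ((barD S).rTensor 𝕋 + TensorProduct.map (twist S.internal 1).toLinearMap (barD S))
      (decon w) :=
  LinearMap.congr_fun (decon_comp_conv_twist _ _ (decon_twist S.internal 1)
    (decon_comp_conv_ι_id (letterD S))) w

theorem letter_twist {gr : ℤ → Submodule R A} (h : DirectSum.IsInternal gr) (j : ℤ)
    (w : TensorAlgebra R A) : letter (twist h j w) = letterTwist h j (letter w) := by
  induction w using tensorAlgebra_induction_right with
  | one => simp
  | mul_ι w a _ => simp [decounit_twist]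
  | add x y hx hy => simp [hx, hy]
  | smul r x hx => simp [hx]

theorem decounit_barD (w : TensorAlgebra R A) : decounit (barD S w) = 0 := by
  rw [barD, conv_apply]
  generalize decon w = ζ
  induction ζ with
  | zero => simp
  | add x y hx hy => rw [map_add, map_add, map_add, hx, hy, add_zero]
  | tmul x y => simp [decounit_conv_ι_id]

/-- Only the middle factor of the convolution can supply the single letter, so both outer factors
must be empty. -/
theorem letter_barD (w : TensorAlgebra R A) : letter (barD S w) = letterD S w := by
  have key : ∀ ζ : 𝕋 ⊗[R] 𝕋, letter (LinearMap.mul' R 𝕋 (TensorProduct.map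
      (twist S.internal 1).toLinearMap (conv (ιT ∘ₗ letterD S) LinearMap.id) ζ)) =
      letterD S (TensorProduct.lid R 𝕋 (decounit.toLinearMap.rTensor 𝕋 ζ)) := by
    intro ζ
    induction ζ with
    | zero => simp
    | add x y hx hy => simp only [map_add, hx, hy]
    | tmul x y => simp [letter_mul, decounit_conv_ι_id, letter_conv_ι_id, decounit_twist]
  rw [barD, conv_apply, key, rTensor_decounit_decon]
  simp

theorem twoMul_mem {i : ℤ} {w : TensorAlgebra R A} (hw : w ∈ barGr S.gr i) :
    twoMul S w ∈ S.gr (i + 2) := by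
  rw [twoMul, LinearMap.comp_apply, LinearMap.comp_apply]
  refine tensorGr_induction (C := fun ξ => TensorProduct.lift (shiftedMul S)
    (TensorProduct.map letter letter ξ) ∈ S.gr (i + 2)) (by simp) ?_ ?_ (decon_mem_tensorGr hw)
  · intro p q x y hx hy hpq
    rw [TensorProduct.map_tmul, TensorProduct.lift.tmul, shiftedMul_apply S (letter_mem hx),
      Units.smul_def]
    have := S.mul_mem _ _ _ _ (letter_mem hx) (letter_mem hy)
    rw [show p + 1 + (q + 1) = i + 2 by omega] at this
    exact zsmul_mem this _
  · intro x y hx hy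
    rw [map_add, map_add]; exact add_mem hx hy

theorem letterD_mem {i : ℤ} {w : TensorAlgebra R A} (hw : w ∈ barGr S.gr i) :
    letterD S w ∈ S.gr (i + 2) := by
  rw [letterD, LinearMap.add_apply, LinearMap.comp_apply]
  refine add_mem ?_ (twoMul_mem S hw)
  rw [show i + 2 = i + 1 + 1 by ring]
  exact S.d_mem _ _ (letter_mem hw)

theorem barD_mem {i : ℤ} {w : TensorAlgebra R A} (hw : w ∈ barGr S.gr i) :
    barD S w ∈ barGr S.gr (i + 1) := by
  have h1 : ∀ i w, w ∈ barGr S.gr i →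
      conv (ιT ∘ₗ letterD S) LinearMap.id w ∈ barGr S.gr (i + (1 + 0)) := fun i w hw =>
    conv_mem_barGr (f := ιT ∘ₗ letterD S) (g := LinearMap.id) (fun l v hv => by
      have := ι_mem_barGr (R := R) (letterD_mem S hv)
      rwa [show l + 2 - 1 = l + 1 by ring] at this)
      (fun l v hv => by simpa using hv) hw
  have := conv_mem_barGr (f := (twist S.internal 1).toLinearMap) (p := 0)
    (fun l v hv => by simpa using twist_mem S.internal 1 hv) h1 hw
  simpa [barD] using this

theorem twoMul_seg {n : ℕ} (y : Fin n → A) {s l : ℕ} (hl : s + l ≤ n) (h2 : l ≠ 2) :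
    twoMul S (seg R y s l) = 0 := by
  rw [twoMul, LinearMap.comp_apply, LinearMap.comp_apply, decon_seg y hl, map_sum, map_sum]
  refine Finset.sum_eq_zero fun i hi => ?_
  simp only [Finset.mem_range] at hi
  rw [TensorProduct.map_tmul, TensorProduct.lift.tmul]
  by_cases h : i = 1
  · rw [letter_seg_of_ne_one y (s := s + i) (by omega) (by omega), map_zero]
  · rw [letter_seg_of_ne_one y (s := s) (by omega) h, map_zero, LinearMap.zero_apply]

theorem twoMul_ι_mul_ι (a b : A) : twoMul S (ιT a * ιT b) = shiftedMul S a b := by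
  rw [twoMul, LinearMap.comp_apply, LinearMap.comp_apply, decon_mul_ι, decon_ι, add_mul]
  simp [letter_mul]

theorem seg_two {n : ℕ} (y : Fin n → A) {s : ℕ} (hs : s + 1 < n) :
    seg R y s 2 = ιT (y ⟨s, by omega⟩) * ιT (y ⟨s + 1, hs⟩) := by
  rw [← seg_mul_seg y s 1 1, seg_one y s (by omega), seg_one y (s + 1) hs]

theorem letterD_seg_zero {n : ℕ} (y : Fin n → A) {s : ℕ} (hs : s ≤ n) :
    letterD S (seg R y s 0) = 0 := by
  rw [letterD, LinearMap.add_apply, LinearMap.comp_apply, twoMul_seg S y (by omega) (by omega),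
    letter_seg_of_ne_one y (by omega) (by omega), map_zero, add_zero]

theorem letterD_seg_one {n : ℕ} (y : Fin n → A) {s : ℕ} (hs : s < n) :
    letterD S (seg R y s 1) = S.d (y ⟨s, hs⟩) := by
  rw [letterD, LinearMap.add_apply, LinearMap.comp_apply, twoMul_seg S y (by omega) (by omega),
    letter_seg_one y hs, add_zero]

theorem letterD_seg_two {n : ℕ} (y : Fin n → A) {s : ℕ} (hs : s + 1 < n) :
    letterD S (seg R y s 2) = shiftedMul S (y ⟨s, by omega⟩) (y ⟨s + 1, hs⟩) := by
  rw [letterD, LinearMap.add_apply, LinearMap.comp_apply,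
    letter_seg_of_ne_one y (by omega) (by omega), map_zero, zero_add, seg_two y hs,
    twoMul_ι_mul_ι]

theorem letterD_seg_of_three_le {n : ℕ} (y : Fin n → A) {s l : ℕ} (hs : s + l ≤ n) (hl : 3 ≤ l) :
    letterD S (seg R y s l) = 0 := by
  rw [letterD, LinearMap.add_apply, LinearMap.comp_apply, twoMul_seg S y (by omega) (by omega),
    letter_seg_of_ne_one y (by omega) (by omega), map_zero, add_zero]

/-- In the differential only middle parts of length one (the differential of a letter) and of length
two (a product of neighbours) contribute. -/
theorem sum_range_one_two {M : Type*} [AddCommMonoid M] (k : ℕ) (F : ℕ → M) (h0 : F 0 = 0)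
    (h3 : ∀ l, 3 ≤ l → l ≤ k → F l = 0) :
    ∑ l ∈ Finset.range (k + 1), F l =
      (if 1 ≤ k then F 1 else 0) + (if 2 ≤ k then F 2 else 0) := by
  match k with
  | 0 => simp [h0]
  | 1 => simp [Finset.sum_range_succ, h0]
  | k + 2 =>
    rw [Finset.sum_range_succ', Finset.sum_range_succ', Finset.sum_range_succ', h0,
      Finset.sum_eq_zero]
    · simp [add_comm]
    · intro l hl
      simp only [Finset.mem_range] at hl
      exact h3 _ (by omega) (by omega)

theorem barD_word {n : ℕ} {b : Fin n → ℤ} {y : Fin n → A} (hy : ∀ q, y q ∈ S.gr (b q)) :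
    barD S (word R y) =
      ∑ i : Fin n, (∑ q ∈ Finset.univ.filter (· < i), b q + ((i : ℕ) : ℤ)).negOnePow •
          word R (Function.update y i (S.d (y i)))
      + ∑ i : Fin n, if h : (i : ℕ) + 1 < n then
          (∑ q ∈ Finset.univ.filter (· ≤ i), b q + ((i : ℕ) + 1 : ℤ)).negOnePow •
            (seg R y 0 (i : ℕ) * TensorAlgebra.ι R (S.mul (y i) (y ⟨(i : ℕ) + 1, h⟩)) *
              seg R y ((i : ℕ) + 2) (n - 2 - (i : ℕ)))
        else 0 := by
  rw [barD, conv_conv_word, ← Finset.sum_add_distrib, Finset.sum_range_succ, Finset.sum_range]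
  have hlast : ∑ l ∈ Finset.range (n - n + 1), (twist S.internal 1).toLinearMap (seg R y 0 n) *
      ((ιT ∘ₗ letterD S) (seg R y n l) * LinearMap.id (R := R) (seg R y (n + l) (n - n - l))) =
      0 := by
    simp [letterD_seg_zero]
  rw [hlast, add_zero]
  refine Finset.sum_congr rfl fun i _ => ?_
  have hi := i.isLt
  have hcard : ∑ q ∈ Finset.univ.filter (fun q : Fin n => (q : ℕ) < i), (b q - 1) =
      ∑ q ∈ Finset.univ.filter (· < i), b q - (i : ℕ) := by
    rw [Finset.sum_sub_distrib, Finset.sum_const]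
    have : (Finset.univ.filter (fun q : Fin n => (q : ℕ) < i)).card = i := by
      rw [show (Finset.univ.filter (fun q : Fin n => (q : ℕ) < i)) = Finset.Iio i by ext; simp]
      simp
    rw [this]
    simp
  rw [sum_range_one_two]
  · have e1 : (twist S.internal 1).toLinearMap (seg R y 0 i) =
        (∑ q ∈ Finset.univ.filter (· < i), b q + ((i : ℕ) : ℤ)).negOnePow • seg R y 0 i := by
      rw [AlgHom.toLinearMap_apply, twist_apply _ _ (seg_mem_barGr hy hi.le), one_mul, hcard]
      congr 1
      exact negOnePow_congr ⟨-(i : ℕ), by ring⟩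
    rw [if_pos (by omega), e1]
    congr 1
    · rw [LinearMap.comp_apply, letterD_seg_one S y hi, word_update, LinearMap.id_apply,
        show n - i - 1 = n - 1 - i by omega, smul_mul_assoc, mul_assoc]
    · by_cases h : (i : ℕ) + 1 < n
      · rw [if_pos (by omega), dif_pos h, LinearMap.comp_apply, letterD_seg_two S y h,
          shiftedMul_apply S (hy _), LinearMap.id_apply, show n - i - 2 = n - 2 - i by omega,
          Units.smul_def (b i - 1).negOnePow, map_zsmul, ← Units.smul_def,
          smul_mul_assoc, smul_mul_assoc, mul_smul_comm, smul_smul, ← Int.negOnePow_add,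
          mul_assoc]
        congr 1
        -- The sign `|y_i| - 1` of the shifted product extends the sum over `q < i` to `q ≤ i`.
        refine negOnePow_congr ?_
        have : Finset.univ.filter (· ≤ i) = insert i (Finset.univ.filter (· < i)) := by
          ext q; simp [le_iff_eq_or_lt]
        rw [this, Finset.sum_insert (by simp)]
        exact ⟨-1, by ring⟩
      · rw [if_neg (by omega), dif_neg h]
  · simp [letterD_seg_zero S y hi.le]
  · intro l h3 hl
    simp [letterD_seg_of_three_le S y (show i + l ≤ n by omega) h3]

/-! ### The relations of a brace algebra in terms of the bar complex -/

variable (S : BraceAlgebra R A)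

/-- The associativity relation says that the braces make `A` a right module over the bar complex;
both sides are the same sum over insertions. -/
theorem brace_barMul (a : A) (v w : TensorAlgebra R A) :
    S.brace (S.brace a v) w = S.brace a (barMul S v w) := by
  have key : ∀ i v, v ∈ barGr S.gr i → ∀ j w, w ∈ barGr S.gr j →
      S.brace (S.brace a v) w = S.brace a (barMul S v w) := by
    intro i v hv j w hw
    rw [barGr] at hv hw
    induction hv using Submodule.span_induction with
    | zero => simp
    | add x y _ _ hx hy => simp only [map_add, LinearMap.add_apply, hx, hy]
    | smul r x _ hx => simp only [map_smul, LinearMap.smul_apply, hx]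
    | mem x hx =>
      induction hw using Submodule.span_induction with
      | zero => simp
      | add x y _ _ hx hy => simp only [map_add, hx, hy]
      | smul r x _ hx => simp only [map_smul, hx]
      | mem z hz =>
        obtain ⟨n, b, y, hy, -, rfl⟩ := hx
        obtain ⟨m, c, z, hz, -, rfl⟩ := hz
        have := S.brace_brace n m b c a y z hy hz
        simp only [one_pow, one_smul] at this
        rw [this, barMul_word S hy hz, map_sum]
        refine Finset.sum_congr rfl fun e _ => ?_
        rw [Units.smul_def, Units.smul_def, map_zsmul]
  refine homogeneous_induction (isInternal_barGr S.internal)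
    (C := fun v => S.brace (S.brace a v) w = S.brace a (barMul S v w)) ?_ ?_ v
  · intro i v hv
    refine homogeneous_induction (isInternal_barGr S.internal)
      (C := fun w => S.brace (S.brace a v) w = S.brace a (barMul S v w)) ?_ ?_ w
    · exact fun j w hw => key i v hv j w hw
    · intro x y hx hy
      rw [map_add, map_add, map_add, hx, hy]
  · intro x y hx hy
    simp only [map_add, LinearMap.add_apply, hx, hy]

/-- The distributivity relation. -/
theorem brace_shiftedMul {j : ℤ} (a : A) {b : A} (hb : b ∈ S.gr j) (w : TensorAlgebra R A) :
    S.brace (shiftedMul S.toDGA a b) w = TensorProduct.lift (shiftedMul S.toDGA)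
      (TensorProduct.map (S.brace a ∘ₗ (twist S.internal (j - 1)).toLinearMap) (S.brace b)
        (decon w)) := by
  refine homogeneous_induction S.internal (C := fun a => S.brace (shiftedMul S.toDGA a b) w =
    TensorProduct.lift (shiftedMul S.toDGA) (TensorProduct.map
      (S.brace a ∘ₗ (twist S.internal (j - 1)).toLinearMap) (S.brace b) (decon w))) ?_ ?_ a
  swap
  · intro a a' ha ha'
    simp only [map_add, LinearMap.add_apply, LinearMap.add_comp, TensorProduct.map_add_left, ha,
      ha']
  intro i a ha
  refine homogeneous_induction (isInternal_barGr S.internal) (C := fun w =>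
    S.brace (shiftedMul S.toDGA a b) w = TensorProduct.lift (shiftedMul S.toDGA)
      (TensorProduct.map (S.brace a ∘ₗ (twist S.internal (j - 1)).toLinearMap) (S.brace b)
        (decon w))) ?_ ?_ w
  swap
  · intro x y hx hy
    simp only [map_add, hx, hy]
  intro l w hw
  rw [barGr] at hw
  induction hw using Submodule.span_induction with
  | zero => simp
  | add x y _ _ hx hy => simp only [map_add, hx, hy]
  | smul r x _ hx => simp only [map_smul, hx]
  | mem w hw =>
    obtain ⟨n, c, y, hy, -, rfl⟩ := hw
    have := S.mul_brace n i j c a b y ha hb hy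
    simp only [one_pow, one_smul] at this
    rw [shiftedMul_apply _ ha, Units.smul_def, map_zsmul, LinearMap.smul_apply, ← this,
      decon_word, map_sum, map_sum, Finset.smul_sum]
    refine Finset.sum_congr rfl fun k hk => ?_
    simp only [Finset.mem_range] at hk
    have hmem := seg_mem_barGr (R := R) hy (show k ≤ n by omega)
    rw [TensorProduct.map_tmul, TensorProduct.lift.tmul, LinearMap.comp_apply,
      AlgHom.toLinearMap_apply, twist_apply _ _ hmem, Units.smul_def ((j - 1) * _).negOnePow, map_zsmul, map_zsmul,
      LinearMap.smul_apply, shiftedMul_apply _ (brace_mem_of_mem_barGr S ha hmem),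
      ← Units.smul_def, ← Units.smul_def, smul_smul, smul_smul, ← Int.negOnePow_add,
      ← Int.negOnePow_add]
    congr 1
    refine negOnePow_congr ?_
    have hcard : ∑ q ∈ Finset.univ.filter (fun q : Fin n => (q : ℕ) < k), (c q - 1) =
        ∑ q ∈ Finset.univ.filter (fun q : Fin n => (q : ℕ) < k), c q - k := by
      rw [Finset.sum_sub_distrib, Finset.sum_const]
      have : (Finset.univ.filter (fun q : Fin n => (q : ℕ) < k)).card = k := by
        simpa using Fin.card_filter_val_lt (n := n) (m := k) ▸ min_eq_right (show k ≤ n by omega)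
      rw [this]
      simp
    rw [hcard]
    exact ⟨j * k, by ring⟩

/-- The higher homotopy relation. -/
theorem d_brace_eq {i : ℤ} {a : A} (ha : a ∈ S.gr i) (w : TensorAlgebra R A) :
    S.d (S.brace a w) + TensorProduct.lift (shiftedMul S.toDGA)
      (TensorProduct.map (S.brace a) letter (decon w)) +
      TensorProduct.lift (shiftedMul S.toDGA) (TensorProduct.map
        (letter ∘ₗ (twist S.internal (i - 1)).toLinearMap) (S.brace a) (decon w)) =
      S.brace (S.d a) w + (i - 1).negOnePow • S.brace a (barD S.toDGA w) := by
  refine homogeneous_induction (isInternal_barGr S.internal) (C := fun w =>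
    S.d (S.brace a w) + TensorProduct.lift (shiftedMul S.toDGA)
      (TensorProduct.map (S.brace a) letter (decon w)) +
      TensorProduct.lift (shiftedMul S.toDGA) (TensorProduct.map
        (letter ∘ₗ (twist S.internal (i - 1)).toLinearMap) (S.brace a) (decon w)) =
      S.brace (S.d a) w + (i - 1).negOnePow • S.brace a (barD S.toDGA w)) ?_ ?_ w
  swap
  · intro x y hx hy
    have := congrArg₂ (· + ·) hx hy
    simp only [map_add, smul_add] at this ⊢
    rw [← sub_eq_zero] at this ⊢
    rw [← this]
    abel
  intro l w hw
  rw [barGr] at hw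
  induction hw using Submodule.span_induction with
  | zero => simp
  | add x y _ _ hx hy =>
    have := congrArg₂ (· + ·) hx hy
    simp only [map_add, smul_add] at this ⊢
    rw [← sub_eq_zero] at this ⊢
    rw [← this]
    abel
  | smul r x _ hx =>
    simp only [map_smul, ← smul_add, hx]
    rw [smul_add, smul_comm r]
  | mem w hw =>
    obtain ⟨n, c, y, hy, -, rfl⟩ := hw
    cases n with
    | zero =>
      -- The relation is imposed only for at least one argument; for the empty word both sides are
      -- `d a`.
      have : barD S.toDGA 1 = 0 := by
        have := barD_word S.toDGA (n := 0) (b := 0) (y := fun q => q.elim0) (fun q => q.elim0)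
        simpa using this
      simp [this, S.brace_one]
    | succ n =>
      have hd := S.d_brace n i c a y ha hy
      simp only [one_pow, one_smul] at hd
      -- Only the cut that leaves exactly the last letter on the right contributes.
      have h1 : TensorProduct.lift (shiftedMul S.toDGA)
          (TensorProduct.map (S.brace a) letter (decon (word R y))) =
          (i + ∑ q : Fin n, c q.castSucc + (n + 1 : ℤ)).negOnePow •
          S.mul (S.brace a (seg R y 0 n)) (y (Fin.last n)) := by
        rw [decon_word, map_sum, map_sum, Finset.sum_eq_single n]
        · have hmem := seg_mem_barGr (R := R) hy (show n ≤ n + 1 by omega)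
          rw [TensorProduct.map_tmul, TensorProduct.lift.tmul, show n + 1 - n = 1 by omega,
            letter_seg_one y (by omega), shiftedMul_apply _ (brace_mem_of_mem_barGr S ha hmem)]
          congr 1
          refine negOnePow_congr ?_
          have : ∑ q ∈ Finset.univ.filter (fun q : Fin (n + 1) => (q : ℕ) < n), (c q - 1) =
              ∑ q : Fin n, c q.castSucc - n := by
            rw [← sum_filter_initial (fun q => c q - 1) (show n ≤ n + 1 by omega) le_rfl,
              Finset.filter_true_of_mem (fun q _ => q.isLt), Finset.sum_sub_distrib]
            simp
            rfl
          rw [this]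
          exact ⟨-n - 1, by ring⟩
        · intro k hk hkn
          simp only [Finset.mem_range] at hk
          rw [TensorProduct.map_tmul, TensorProduct.lift.tmul,
            letter_seg_of_ne_one y (by omega) (by omega), map_zero]
        · simp
      -- Only the cut after the first letter contributes; the twist moves `a` past that letter.
      have h2 : TensorProduct.lift (shiftedMul S.toDGA) (TensorProduct.map
          (letter ∘ₗ (twist S.internal (i - 1)).toLinearMap) (S.brace a) (decon (word R y))) =
          ((c 0 + 1) * i).negOnePow • S.mul (y 0) (S.brace a (seg R y 1 n)) := by
        rw [decon_word, map_sum, map_sum, Finset.sum_eq_single 1]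
        · rw [TensorProduct.map_tmul, TensorProduct.lift.tmul, LinearMap.comp_apply,
            AlgHom.toLinearMap_apply, letter_twist, letter_seg_one y (by omega),
            letterTwist_apply _ _ (hy _), Units.smul_def, map_zsmul, LinearMap.smul_apply,
            shiftedMul_apply _ (hy _), ← Units.smul_def, smul_smul, ← Int.negOnePow_add]
          congr 1
          refine negOnePow_congr ?_
          change Even ((i - 1) * (c 0 - 1) + (c 0 - 1) - (c 0 + 1) * i)
          exact ⟨-i, by ring⟩
        · intro k hk hkn
          simp only [Finset.mem_range] at hk
          rw [TensorProduct.map_tmul, TensorProduct.lift.tmul, LinearMap.comp_apply,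
            AlgHom.toLinearMap_apply, letter_twist,
            letter_seg_of_ne_one y (by omega) (by omega), map_zero, map_zero,
            LinearMap.zero_apply]
        · simp
      rw [hd, h1, h2, barD_word S.toDGA hy, map_add, smul_add, map_sum, map_sum, Finset.smul_sum,
        Finset.smul_sum]
      have h3 : ∑ k : Fin (n + 1),
          (i + ∑ q ∈ Finset.univ.filter (· < k), c q + ((k : ℕ) + 1 : ℤ)).negOnePow •
            S.brace a (word R (Function.update y k (S.d (y k)))) =
          ∑ k : Fin (n + 1), (i - 1).negOnePow • S.brace a
            ((∑ q ∈ Finset.univ.filter (· < k), c q + ((k : ℕ) : ℤ)).negOnePow •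
              word R (Function.update y k (S.d (y k)))) := by
        refine Finset.sum_congr rfl fun k _ => ?_
        rw [Units.smul_def (∑ q ∈ _, c q + _).negOnePow, map_zsmul, ← Units.smul_def, smul_smul,
          ← Int.negOnePow_add]
        congr 1
        exact negOnePow_congr ⟨1, by ring⟩
      have h4 : ∑ k : Fin n,
          (i + ∑ q ∈ Finset.univ.filter (· ≤ k.castSucc), c q + ((k : ℕ) + 1 : ℤ) + 1).negOnePow •
            S.brace a (seg R y 0 (k : ℕ) * TensorAlgebra.ι R (S.mul (y k.castSucc) (y k.succ)) *
              seg R y ((k : ℕ) + 2) (n - 1 - (k : ℕ))) =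
          ∑ k : Fin (n + 1), (i - 1).negOnePow • S.brace a
            (if h : (k : ℕ) + 1 < n + 1 then
              (∑ q ∈ Finset.univ.filter (· ≤ k), c q + ((k : ℕ) + 1 : ℤ)).negOnePow •
              (seg R y 0 (k : ℕ) * TensorAlgebra.ι R (S.mul (y k) (y ⟨(k : ℕ) + 1, h⟩)) *
              seg R y ((k : ℕ) + 2) (n + 1 - 2 - (k : ℕ))) else 0) := by
        rw [Fin.sum_univ_castSucc, dif_neg (by simp), map_zero, smul_zero, add_zero]
        refine Finset.sum_congr rfl fun k _ => ?_
        rw [dif_pos (by simp), Units.smul_def (∑ q ∈ _, c q + _).negOnePow, map_zsmul,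
          ← Units.smul_def, smul_smul, ← Int.negOnePow_add]
        congr 1
        exact negOnePow_congr ⟨1, by simp; ring⟩
      rw [h3, h4]
      abel

end BarDifferential

/-! ### Koszul signs on tensor squares, and induction on length in a coalgebra of words -/

section KoszulSteps

variable {R : Type*} [CommRing R]

theorem units_smul_tmul_left {M N : Type*} [AddCommGroup M] [Module R M] [AddCommGroup N]
    [Module R N] (u : ℤˣ) (x : M) (y : N) : (u • x) ⊗ₜ[R] y = u • (x ⊗ₜ[R] y) := by
  rw [Units.smul_def, Units.smul_def, TensorProduct.smul_tmul']

theorem units_smul_tmul_right {M N : Type*} [AddCommGroup M] [Module R M] [AddCommGroup N]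
    [Module R N] (u : ℤˣ) (x : M) (y : N) : x ⊗ₜ[R] (u • y) = u • (x ⊗ₜ[R] y) := by
  rw [Units.smul_def, Units.smul_def, TensorProduct.tmul_smul]

theorem map_units_smul {M N : Type*} [AddCommGroup M] [Module R M] [AddCommGroup N]
    [Module R N] (f : M →ₗ[R] N) (u : ℤˣ) (x : M) : f (u • x) = u • f x := by
  rw [Units.smul_def, Units.smul_def, map_zsmul]

theorem map_units_smul₂ {M N P : Type*} [AddCommGroup M] [Module R M] [AddCommGroup N]
    [Module R N] [AddCommGroup P] [Module R P] (f : M →ₗ[R] N →ₗ[R] P) (u : ℤˣ) (x : M) (y : N) :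
    f (u • x) y = u • f x y := by
  rw [map_units_smul, LinearMap.smul_apply]

variable {B : Type*} [AddCommGroup B] [Module R B] {gr : ℤ → Submodule R B}
  (h : DirectSum.IsInternal gr) {A : Type*} [AddCommGroup A] [Module R A] (L : B →ₗ[R] A)
  (f : B →ₗ[R] B →ₗ[R] B) (hf : ∀ i j x y, x ∈ gr i → y ∈ gr j → f x y ∈ gr (i + j))

include hf in
-- Both ways of multiplying three elements of the tensor square give the same Koszul sign, so only
-- the unsigned identity `e` has to be known, and only after `L` on the second leg.
theorem lTensor_tensorOp_assoc {p q q' r : ℤ} {x x' y y' z z' : B} (hp : x' ∈ gr p) (hq : y ∈ gr q)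
    (hq' : y' ∈ gr q') (hr : z ∈ gr r)
    (e : f (f x y) z ⊗ₜ[R] L (f (f x' y') z') = f x (f y z) ⊗ₜ[R] L (f x' (f y' z'))) :
    L.lTensor B (tensorOp gr h f f (tensorOp gr h f f (x ⊗ₜ x') (y ⊗ₜ y')) (z ⊗ₜ z')) =
      L.lTensor B (tensorOp gr h f f (x ⊗ₜ x') (tensorOp gr h f f (y ⊗ₜ y') (z ⊗ₜ z'))) := by
  rw [tensorOp_tmul h f f _ _ hp hq, map_units_smul₂, tensorOp_tmul h f f _ _ (hf _ _ _ _ hp hq') hr,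
    tensorOp_tmul h f f _ _ hq' hr, map_units_smul, map_units_smul, map_units_smul,
    tensorOp_tmul h f f _ _ hp (hf _ _ _ _ hq hr), map_units_smul, map_units_smul,
    LinearMap.lTensor_tmul, LinearMap.lTensor_tmul, smul_smul, smul_smul, ← Int.negOnePow_add,
    ← Int.negOnePow_add, e]
  congr 2
  ring

include hf in
-- The same reduction for the Leibniz rule: it is needed in full on the first leg, and only after
-- `L` on the second. The condition `hD` is tensored with the second leg because the rule on the
-- first leg will be available only when that leg is shorter than the whole.
theorem lTensor_tensorOp_leibniz {τ d : B →ₗ[R] B}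
    (hτ : ∀ i x, x ∈ gr i → τ x = i.negOnePow • x) (hd : ∀ i x, x ∈ gr i → d x ∈ gr (i + 1))
    {p p' q : ℤ} {x x' y y' : B} (hp : x ∈ gr p) (hp' : x' ∈ gr p') (hq : y ∈ gr q)
    (hD : d (f x y) ⊗ₜ[R] L (f x' y') =
      (f (d x) y + p.negOnePow • f x (d y)) ⊗ₜ[R] L (f x' y'))
    (hL : L (d (f x' y')) = L (f (d x') y') + p'.negOnePow • L (f x' (d y'))) :
    L.lTensor B ((d.rTensor B + TensorProduct.map τ d)
      (tensorOp gr h f f (x ⊗ₜ x') (y ⊗ₜ y'))) =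
    L.lTensor B (tensorOp gr h f f ((d.rTensor B + TensorProduct.map τ d) (x ⊗ₜ x')) (y ⊗ₜ y')) +
    L.lTensor B (tensorOp gr h f f (TensorProduct.map τ τ (x ⊗ₜ x'))
      ((d.rTensor B + TensorProduct.map τ d) (y ⊗ₜ y'))) := by
  have e1 : p + (p' + 1) * q = p' * q + (p + q) := by ring
  have e2 : (p' * q + p).negOnePow = (p' + p + p' * (q + 1)).negOnePow :=
    negOnePow_congr ⟨-p', by ring⟩
  have e3 : p' + p + (q + p' * q) = p' * q + (p + q) + p' := by ring
  simp only [LinearMap.add_apply, LinearMap.rTensor_tmul, TensorProduct.map_tmul,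
    map_add, hτ _ _ hp, hτ _ _ hp', hτ _ _ hq, units_smul_tmul_left, units_smul_tmul_right,
    map_units_smul, LinearMap.smul_apply, tensorOp_tmul h f f _ _ hp' hq,
    tensorOp_tmul h f f _ _ hp' (hd _ _ hq), tensorOp_tmul h f f _ _ (hd _ _ hp') hq,
    hτ _ _ (hf _ _ _ _ hp hq),
    LinearMap.lTensor_tmul, hD, hL, TensorProduct.add_tmul, TensorProduct.tmul_add, smul_add,
    smul_smul, ← Int.negOnePow_add, e1, e2, e3]
  abel

/-- The cross terms `dτ ⊗ d` and `τd ⊗ d` cancel. -/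
theorem rTensor_add_map_sq {τ d : B →ₗ[R] B} (hττ : τ ∘ₗ τ = LinearMap.id)
    (hτd : τ ∘ₗ d = -(d ∘ₗ τ)) (ξ : B ⊗[R] B) :
    (d.rTensor B + TensorProduct.map τ d) ((d.rTensor B + TensorProduct.map τ d) ξ) =
      ((d ∘ₗ d).rTensor B + (d ∘ₗ d).lTensor B) ξ := by
  have h1 := fun x => LinearMap.congr_fun hττ x
  have h2 := fun x => LinearMap.congr_fun hτd x
  simp only [LinearMap.comp_apply, LinearMap.neg_apply, LinearMap.id_apply] at h1 h2
  induction ξ with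
  | zero => simp
  | add x y hx hy => simp only [map_add, hx, hy]
  | tmul x y =>
    simp [h1, h2, TensorProduct.neg_tmul]




/-- A coalgebra spanned by homogeneous words, in which the length is additive under the
comultiplication, and which is cogenerated by the letter component `L`. -/
structure IsWordCoalgebra (gr : ℤ → Submodule R B) (Δ : B →ₗ[R] B ⊗[R] B) (ε : B →ₗ[R] R)
    (L : B →ₗ[R] A) (one : B) (W : ℕ → B → Prop) : Prop where
  mem : ∀ n w, W n w → ∃ i, w ∈ gr i
  span : ∀ C : B → Prop, (∀ n w, W n w → C w) → (∀ v w, C v → C w → C (v + w)) →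
    (∀ (r : R) w, C w → C (r • w)) → ∀ w, C w
  comul : ∀ n w, W n w → ∀ C : B ⊗[R] B → Prop, C 0 → (∀ ξ η, C ξ → C η → C (ξ + η)) →
    (∀ p q x y, W p x → W q y → p + q = n → C (x ⊗ₜ y)) → C (Δ w)
  eq_one : ∀ w, W 0 w → w = one
  letter_one : L one = 0
  eq_zero : ∀ w, ε w = 0 → L.lTensor B (Δ w) = 0 → w = 0

section WordCoalgebra

variable {h} {Δ : B →ₗ[R] B ⊗[R] B} {ε : B →ₗ[R] R} {L} {one : B} {W : ℕ → B → Prop}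
  (hW : IsWordCoalgebra gr Δ ε L one W)

include hW

theorem IsWordCoalgebra.ext_comul {X : Type*} [AddCommGroup X] [Module R X]
    {F G : B ⊗[R] B →ₗ[R] X} {n : ℕ} {w : B} (hw : W n w)
    (hFG : ∀ p q x y, W p x → W q y → p + q = n → F (x ⊗ₜ y) = G (x ⊗ₜ y)) : F (Δ w) = G (Δ w) :=
  hW.comul n w hw (fun ξ => F ξ = G ξ) (by rw [map_zero, map_zero])
    (fun ξ η hξ hη => by rw [map_add, map_add, hξ, hη]) hFG

/-- Strong induction on the length, by cogeneration. In `(1 ⊗ L) Δ (d² w)` the terms with `d²` on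
the right leg vanish by `hL`; those with `d²` on the left leg vanish by induction if the right leg
is nonempty, and by `L one = 0` otherwise. -/
theorem IsWordCoalgebra.d_d {τ d : B →ₗ[R] B} (hττ : τ ∘ₗ τ = LinearMap.id)
    (hτd : τ ∘ₗ d = -(d ∘ₗ τ))
    (hΔd : Δ ∘ₗ d = (d.rTensor B + TensorProduct.map τ d) ∘ₗ Δ) (hεd : ∀ x, ε (d x) = 0)
    (hL : ∀ n x, W n x → L (d (d x)) = 0) (w : B) : d (d w) = 0 := by
  replace hΔd := fun x => LinearMap.congr_fun hΔd x
  simp only [LinearMap.comp_apply] at hΔd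
  refine hW.span (fun w => d (d w) = 0) ?_ (fun x y hx hy => by
    simp only [map_add, hx, hy, add_zero]) (fun r x hx => by
    simp only [map_smul, hx, smul_zero]) w
  intro n
  induction n using Nat.strong_induction_on with
  | _ n ih =>
    intro w hw
    refine hW.eq_zero _ (hεd _) ?_
    rw [hΔd, hΔd, rTensor_add_map_sq hττ hτd]
    refine hW.ext_comul (F := L.lTensor B ∘ₗ ((d ∘ₗ d).rTensor B + (d ∘ₗ d).lTensor B)) (G := 0)
      hw ?_
    intro p q x y hx hy hn
    simp only [LinearMap.comp_apply, LinearMap.add_apply, LinearMap.rTensor_tmul,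
      LinearMap.lTensor_tmul, map_add, hL _ _ hy, TensorProduct.tmul_zero, add_zero,
      LinearMap.zero_apply]
    by_cases h0 : q = 0
    · subst h0
      rw [hW.eq_one _ hy, hW.letter_one, TensorProduct.tmul_zero]
    · rw [ih p (by omega) x hx, TensorProduct.zero_tmul]

variable {f}

include hf

/-- Since the product is a coalgebra map, `(1 ⊗ L) Δ` of both sides is a sum over cuts of the three
words. The right legs agree by `hL`, and the left legs by induction on the total length. -/
theorem IsWordCoalgebra.mul_assoc_words (one_mul : ∀ x, f one x = x)
    (hΔ : ∀ x y, Δ (f x y) = tensorOp gr h f f (Δ x) (Δ y)) (hε : ∀ x y, ε (f x y) = ε x * ε y)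
    (hL : ∀ x y z, L (f (f x y) z) = L (f x (f y z))) (N : ℕ) :
    ∀ l m n u v w, W l u → W m v → W n w → l + m + n = N → f (f u v) w = f u (f v w) := by
  induction N using Nat.strong_induction_on with
  | _ N ih =>
    intro l m n u v w hu hv hw hN
    rw [← sub_eq_zero]
    refine hW.eq_zero _ (by simp [hε, mul_assoc]) ?_
    rw [map_sub, hΔ, hΔ, hΔ, hΔ, map_sub, sub_eq_zero]
    refine hW.ext_comul (F := L.lTensor B ∘ₗ (tensorOp gr h f f).flip (Δ w) ∘ₗ
        (tensorOp gr h f f).flip (Δ v)) (G := L.lTensor B ∘ₗ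
        (tensorOp gr h f f).flip (tensorOp gr h f f (Δ v) (Δ w))) hu ?_
    intro p p' x x' hx hx' hp
    refine hW.ext_comul (F := L.lTensor B ∘ₗ (tensorOp gr h f f).flip (Δ w) ∘ₗ
        tensorOp gr h f f (x ⊗ₜ x')) (G := L.lTensor B ∘ₗ tensorOp gr h f f (x ⊗ₜ x') ∘ₗ
          (tensorOp gr h f f).flip (Δ w)) hv ?_
    intro q q' y y' hy hy' hq
    refine hW.ext_comul (F := L.lTensor B ∘ₗ
        tensorOp gr h f f (tensorOp gr h f f (x ⊗ₜ x') (y ⊗ₜ y'))) (G := L.lTensor B ∘ₗ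
          tensorOp gr h f f (x ⊗ₜ x') ∘ₗ tensorOp gr h f f (y ⊗ₜ y')) hw ?_
    intro r r' z z' hz hz' hr
    obtain ⟨ip, hip⟩ := hW.mem _ _ hx'
    obtain ⟨iq, hiq⟩ := hW.mem _ _ hy
    obtain ⟨iq', hiq'⟩ := hW.mem _ _ hy'
    obtain ⟨ir, hir⟩ := hW.mem _ _ hz
    refine lTensor_tensorOp_assoc h L f hf hip hiq hiq' hir ?_
    rw [hL]
    -- If all right legs are empty their product is `one`, which `L` kills; otherwise the left legs
    -- are shorter in total.
    by_cases h0 : p' + q' + r' = 0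
    · obtain rfl : p' = 0 := by omega
      obtain rfl : q' = 0 := by omega
      obtain rfl : r' = 0 := by omega
      rw [hW.eq_one _ hx', hW.eq_one _ hy', hW.eq_one _ hz', one_mul, one_mul, hW.letter_one,
        TensorProduct.tmul_zero, TensorProduct.tmul_zero]
    · rw [ih (p + q + r) (by omega) p q r x y z hx hy hz rfl]

theorem IsWordCoalgebra.mul_assoc (one_mul : ∀ x, f one x = x)
    {F} (hF : F = tensorOp gr h f f)
    (hΔ : ∀ x y, Δ (f x y) = F (Δ x) (Δ y)) (hε : ∀ x y, ε (f x y) = ε x * ε y)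
    (hL : ∀ x y z, L (f (f x y) z) = L (f x (f y z))) (u v w : B) :
    f (f u v) w = f u (f v w) := by
  subst hF
  refine hW.span (fun u => f (f u v) w = f u (f v w)) ?_ (fun x y hx hy => by
    simp only [map_add, LinearMap.add_apply, hx, hy]) (fun r x hx => by
    simp only [map_smul, LinearMap.smul_apply, hx]) u
  intro l u hu
  refine hW.span (fun v => f (f u v) w = f u (f v w)) ?_ (fun x y hx hy => by
    simp only [map_add, LinearMap.add_apply, hx, hy]) (fun r x hx => by
    simp only [map_smul, LinearMap.smul_apply, hx]) v
  intro m v hv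
  refine hW.span (fun w => f (f u v) w = f u (f v w)) ?_ (fun x y hx hy => by
    simp only [map_add, hx, hy]) (fun r x hx => by simp only [map_smul, hx]) w
  exact fun n w hw => hW.mul_assoc_words hf one_mul hΔ hε hL _ l m n u v w hu hv hw rfl

theorem IsWordCoalgebra.d_mul_words {τ d : B →ₗ[R] B} (one_mul : ∀ x, f one x = x)
    (hΔ : ∀ x y, Δ (f x y) = tensorOp gr h f f (Δ x) (Δ y)) (hε : ∀ x y, ε (f x y) = ε x * ε y)
    (hτ : ∀ i x, x ∈ gr i → τ x = i.negOnePow • x) (hd : ∀ i x, x ∈ gr i → d x ∈ gr (i + 1))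
    (hΔτ : ∀ x, Δ (τ x) = TensorProduct.map τ τ (Δ x))
    (hΔd : ∀ x, Δ (d x) = (d.rTensor B + TensorProduct.map τ d) (Δ x)) (hεd : ∀ x, ε (d x) = 0)
    (hL : ∀ n x y, W n x → L (d (f x y)) = L (f (d x) y) + L (f (τ x) (d y))) (N : ℕ) :
    ∀ m n v w, W m v → W n w → m + n = N → d (f v w) = f (d v) w + f (τ v) (d w) := by
  induction N using Nat.strong_induction_on with
  | _ N ih =>
    intro m n v w hv hw hN
    rw [← sub_eq_zero]
    refine hW.eq_zero _ (by simp [hε, hεd]) ?_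
    rw [map_sub, map_add, hΔd, hΔ, hΔ, hΔ, hΔd, hΔd, hΔτ, map_sub, sub_eq_zero, map_add]
    refine hW.ext_comul (F := L.lTensor B ∘ₗ (d.rTensor B + TensorProduct.map τ d) ∘ₗ
        (tensorOp gr h f f).flip (Δ w)) (G := L.lTensor B ∘ₗ
        (tensorOp gr h f f).flip (Δ w) ∘ₗ (d.rTensor B + TensorProduct.map τ d) +
        L.lTensor B ∘ₗ (tensorOp gr h f f).flip ((d.rTensor B + TensorProduct.map τ d) (Δ w)) ∘ₗ
          TensorProduct.map τ τ) hv ?_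
    intro p p' x x' hx hx' hp
    refine hW.ext_comul (F := L.lTensor B ∘ₗ (d.rTensor B + TensorProduct.map τ d) ∘ₗ
        tensorOp gr h f f (x ⊗ₜ x')) (G := L.lTensor B ∘ₗ
        tensorOp gr h f f ((d.rTensor B + TensorProduct.map τ d) (x ⊗ₜ x')) +
        L.lTensor B ∘ₗ tensorOp gr h f f (TensorProduct.map τ τ (x ⊗ₜ x')) ∘ₗ
          (d.rTensor B + TensorProduct.map τ d)) hw ?_
    intro q q' y y' hy hy' hq
    obtain ⟨ip, hip⟩ := hW.mem _ _ hx
    obtain ⟨ip', hip'⟩ := hW.mem _ _ hx'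
    obtain ⟨iq, hiq⟩ := hW.mem _ _ hy
    refine lTensor_tensorOp_leibniz h L f hf hτ hd hip hip' hiq ?_ ?_
    -- As for associativity: empty right legs are killed by `L`, and otherwise the induction
    -- hypothesis applies to the left legs.
    · by_cases h0 : p' + q' = 0
      · obtain rfl : p' = 0 := by omega
        obtain rfl : q' = 0 := by omega
        rw [hW.eq_one _ hx', hW.eq_one _ hy', one_mul, hW.letter_one,
          TensorProduct.tmul_zero, TensorProduct.tmul_zero]
      · rw [ih (p + q) (by omega) p q x y hx hy rfl, hτ _ _ hip, map_units_smul₂]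
    · rw [hL _ _ _ hx', hτ _ _ hip', map_units_smul₂, map_units_smul]

theorem IsWordCoalgebra.d_mul {τ d : B →ₗ[R] B} (one_mul : ∀ x, f one x = x)
    {F} (hF : F = tensorOp gr h f f)
    (hΔ : ∀ x y, Δ (f x y) = F (Δ x) (Δ y)) (hε : ∀ x y, ε (f x y) = ε x * ε y)
    (hτ : ∀ i x, x ∈ gr i → τ x = i.negOnePow • x) (hd : ∀ i x, x ∈ gr i → d x ∈ gr (i + 1))
    (hΔτ : Δ ∘ₗ τ = TensorProduct.map τ τ ∘ₗ Δ)
    (hΔd : Δ ∘ₗ d = (d.rTensor B + TensorProduct.map τ d) ∘ₗ Δ) (hεd : ∀ x, ε (d x) = 0)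
    (hL : ∀ n x y, W n x → L (d (f x y)) = L (f (d x) y) + L (f (τ x) (d y))) (v w : B) :
    d (f v w) = f (d v) w + f (τ v) (d w) := by
  subst hF
  refine hW.span (fun v => d (f v w) = f (d v) w + f (τ v) (d w)) ?_ (fun x y hx hy => by
    simp only [map_add, LinearMap.add_apply, hx, hy]; abel) (fun r x hx => by
    simp only [map_smul, LinearMap.smul_apply, hx, smul_add]) v
  intro m v hv
  refine hW.span (fun w => d (f v w) = f (d v) w + f (τ v) (d w)) ?_ (fun x y hx hy => by
    simp only [map_add, hx, hy]; abel) (fun r x hx => by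
    simp only [map_smul, hx, smul_add]) w
  exact fun n w hw => hW.d_mul_words hf one_mul hΔ hε hτ hd (LinearMap.congr_fun hΔτ)
    (LinearMap.congr_fun hΔd) hεd hL _ m n v w hv hw rfl

end WordCoalgebra

end KoszulSteps

section BarBialgebra

variable {R : Type*} [CommRing R] {A : Type*} [AddCommGroup A] [Module R A]

local notation "𝕋" => TensorAlgebra R A
local notation "ιT" => TensorAlgebra.ι R

/-! ### The dg bialgebra axioms -/

theorem isWordCoalgebra_bar {gr : ℤ → Submodule R A} (h : DirectSum.IsInternal gr) :
    IsWordCoalgebra (barGr gr) (decon (R := R) (A := A)) (decounit : 𝕋 →ₐ[R] R).toLinearMap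
      letter 1 (fun n w => ∃ l : List A, Homogeneous gr l ∧ l.length = n ∧ w = listWord R l) where
  mem := by
    rintro n w ⟨l, hl, -, rfl⟩
    exact listWord_mem_barGr hl
  span C hom add smul w := listWord_induction h (fun l hl => hom _ _ ⟨l, hl, rfl, rfl⟩) add smul w
  comul := by
    rintro n w ⟨l, hl, rfl, rfl⟩ C zero add tmul
    refine decon_listWord_induction hl zero add fun x x' hx hx' e => ?_
    exact tmul _ _ _ _ ⟨x, hx, rfl, rfl⟩ ⟨x', hx', rfl, rfl⟩ (by rw [e, List.length_append])
  eq_one := by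
    rintro w ⟨l, -, hl, rfl⟩
    rw [List.length_eq_zero_iff.mp hl, listWord_nil]
  letter_one := letter_one
  eq_zero w h0 h1 := eq_zero_of_lTensor_letter_decon h0 h1

section Axioms

variable (S : BraceAlgebra R A)

theorem letter_barMul_assoc (u v w : TensorAlgebra R A) :
    letter (barMul S (barMul S u v) w) = letter (barMul S u (barMul S v w)) := by
  simp only [letter_barMul, decounit_barMul, map_add, map_smul, LinearMap.add_apply,
    LinearMap.smul_apply, smul_add, brace_barMul, mul_smul, add_assoc]

theorem barMul_assoc (u v w : TensorAlgebra R A) :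
    barMul S (barMul S u v) w = barMul S u (barMul S v w) :=
  have key (F) (hF : F = tensorOp (barGr S.gr) (isInternal_barGr S.internal) (barMul S)
      (barMul S)) : barMul S (barMul S u v) w = barMul S u (barMul S v w) :=
    (isWordCoalgebra_bar S.internal).mul_assoc (f := barMul S) (F := F)
      (fun _ _ _ _ hx hy => barMul_mem S hx hy) (LinearMap.congr_fun (barMul_one_left S)) hF (decon_barMul S hF) (decounit_barMul S) (letter_barMul_assoc S) u v w
  key _ rfl

theorem letter_listWord_two (a b : A) (l : List A) :
    letter (listWord R (a :: b :: l)) = 0 :=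
  letter_listWord _ (by simp)

theorem twoMul_listWord_three (S : DGA R A) (l : List A) (hl : l.length ≠ 2) :
    twoMul S (listWord R l) = 0 := by
  have := twoMul_seg (R := R) S l.get (s := 0) (l := l.length) (by simp) hl
  rwa [← word_eq_seg, word_eq_listWord, List.ofFn_get] at this

/-- The convolution of two maps to `A` with respect to the shifted product of `A`. -/
def cup (S : DGA R A) (f g : TensorAlgebra R A →ₗ[R] A) : TensorAlgebra R A →ₗ[R] A :=
  TensorProduct.lift (shiftedMul S) ∘ₗ TensorProduct.map f g ∘ₗ decon

theorem twoMul_eq_cup (S : DGA R A) : twoMul S = cup S letter letter := rfl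

@[simp]
theorem cup_zero_left (S : DGA R A) (g : TensorAlgebra R A →ₗ[R] A) : cup S 0 g = 0 := by
  rw [cup, TensorProduct.map_zero_left, LinearMap.zero_comp, LinearMap.comp_zero]

@[simp]
theorem cup_zero_right (S : DGA R A) (f : TensorAlgebra R A →ₗ[R] A) : cup S f 0 = 0 := by
  rw [cup, TensorProduct.map_zero_right, LinearMap.zero_comp, LinearMap.comp_zero]

theorem brace_shiftedMul_eq_cup (a : A) {j : ℤ} {b : A} (hb : b ∈ S.gr j) :
    S.brace (shiftedMul S.toDGA a b) =
      cup S.toDGA (S.brace a ∘ₗ (twist S.internal (j - 1)).toLinearMap) (S.brace b) :=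
  LinearMap.ext (brace_shiftedMul S a hb)

theorem d_brace_eq_cup {i : ℤ} {a : A} (ha : a ∈ S.gr i) (w : TensorAlgebra R A) :
    S.d (S.brace a w) + cup S.toDGA (S.brace a) letter w +
      cup S.toDGA (letter ∘ₗ (twist S.internal (i - 1)).toLinearMap) (S.brace a) w =
      S.brace (S.d a) w + (i - 1).negOnePow • S.brace a (barD S.toDGA w) :=
  d_brace_eq S ha w

variable {F : TensorAlgebra R A ⊗[R] TensorAlgebra R A →ₗ[R]
    TensorAlgebra R A ⊗[R] TensorAlgebra R A →ₗ[R] TensorAlgebra R A ⊗[R] TensorAlgebra R A}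

theorem lift_shiftedMul_comp_tmul (hF : F = tensorOp (barGr S.gr) (isInternal_barGr S.internal)
    (barMul S) (barMul S)) (v : TensorAlgebra R A) {j : ℤ} {w : TensorAlgebra R A}
    (hw : w ∈ barGr S.gr j) :
    TensorProduct.lift (shiftedMul S.toDGA) ∘ₗ TensorProduct.map letter letter ∘ₗ F (v ⊗ₜ w) ∘ₗ
      decon = cup S.toDGA ((letter ∘ₗ barMul S v) ∘ₗ (twist S.internal j).toLinearMap)
        (letter ∘ₗ barMul S w) := by
  rw [barMul_tmul S hF v hw, cup, LinearMap.comp_assoc, TensorProduct.map_comp,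
    LinearMap.comp_assoc]

theorem twoMul_comp_barMul (hF : F = tensorOp (barGr S.gr) (isInternal_barGr S.internal)
    (barMul S) (barMul S)) (v : TensorAlgebra R A) :
    twoMul S.toDGA ∘ₗ barMul S v = TensorProduct.lift (shiftedMul S.toDGA) ∘ₗ
      TensorProduct.map letter letter ∘ₗ F (decon v) ∘ₗ decon := by
  ext w
  simp only [twoMul, LinearMap.comp_apply, decon_barMul S hF]

theorem twist_one_apply {gr : ℤ → Submodule R A} (h : DirectSum.IsInternal gr) {i : ℤ}
    {w : TensorAlgebra R A} (hw : w ∈ barGr gr i) :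
    (twist h 1).toLinearMap w = i.negOnePow • w := by
  rw [AlgHom.toLinearMap_apply, twist_apply h 1 hw, one_mul]


/-- The letter component of the Leibniz rule. -/
theorem letterD_barMul {l : List A} (hl : Homogeneous S.gr l) (w : TensorAlgebra R A) :
    letterD S.toDGA (barMul S (listWord R l) w) =
      letter (barMul S (barD S.toDGA (listWord R l)) w) +
      letter (barMul S (twist S.internal 1 (listWord R l)) (barD S.toDGA w)) := by
  obtain ⟨F, hF⟩ : ∃ F, F = tensorOp (barGr S.gr) (isInternal_barGr S.internal) (barMul S)
    (barMul S) := ⟨_, rfl⟩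
  have hcup := LinearMap.congr_fun (twoMul_comp_barMul S hF (listWord R l)) w
  rw [LinearMap.comp_apply] at hcup
  have h2 : ∀ a, letter ∘ₗ barMul S (ιT a) = S.brace a := by
    intro a
    ext w; simp [letter_barMul]
  have h1 : letter ∘ₗ barMul S 1 = letter := by
    ext w; simp
  rw [letterD, LinearMap.add_apply, LinearMap.comp_apply, hcup, letter_barMul, letter_barMul,
    letter_barMul, decounit_barD, letter_barD, letter_barD,
    decounit_twist, letter_twist, zero_smul, zero_add]
  match l, hl with
  | [], _ =>
    rw [listWord_nil, decon_one, lift_shiftedMul_comp_tmul S hF _ one_mem_barGr, h1, twist_zero,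
      LinearMap.comp_id, ← twoMul_eq_cup]
    have hc : cup S.toDGA letter letter (1 : 𝕋) = 0 := by simp [cup]
    simp [hc, letterD, twoMul_eq_cup, LinearMap.add_apply]
  -- For a single letter the identity is the higher homotopy relation. The two cuts of `[a]` give
  -- its terms in which a letter is multiplied with a brace of `a` from the right or from the left.
  | [a], hl =>
    obtain ⟨i, ha⟩ := hl a (by simp)
    rw [listWord_singleton, decon_ι, map_add F, LinearMap.add_comp, LinearMap.comp_add,
      LinearMap.comp_add, lift_shiftedMul_comp_tmul S hF _ one_mem_barGr,
      lift_shiftedMul_comp_tmul S hF _ (ι_mem_barGr ha), h1, h2, twist_zero,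
      LinearMap.comp_id, decounit_ι, zero_smul, zero_smul,
      zero_add, letter_ι, letterTwist_apply _ _ ha, map_units_smul₂, zero_add, one_mul]
    have h1 : letterD S.toDGA (ιT a) = S.d a := by
      have := letterD_seg_one (R := R) S.toDGA (n := 1) (s := 0) (fun _ => a) (by omega)
      rwa [seg_one _ _ (by omega)] at this
    rw [h1, ← d_brace_eq_cup S ha w, LinearMap.add_apply]
    abel
  -- For two letters the identity is distributivity: only the cut between them survives, and the
  -- differential of the word contributes the brace of the product.
  | [a, b], hl =>
    obtain ⟨i, ha⟩ := hl a (by simp)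
    obtain ⟨j, hb⟩ := hl b (by simp)
    have e : listWord R [a, b] = ιT a * ιT b := by simp [listWord]
    have h3 : letterD S.toDGA (ιT a * ιT b) = shiftedMul S.toDGA a b := by
      rw [letterD, LinearMap.add_apply, twoMul_ι_mul_ι]
      simp
    have h4 : letter ∘ₗ barMul S (ιT a * ιT b) = 0 := by
      ext w; simp [letter_barMul]
    rw [e, decon_mul_ι, decon_ι, add_mul, Algebra.TensorProduct.tmul_mul_tmul,
      Algebra.TensorProduct.tmul_mul_tmul, map_add F, map_add F,
      LinearMap.add_comp, LinearMap.comp_add,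
      LinearMap.comp_add, LinearMap.add_comp, LinearMap.comp_add,
      LinearMap.comp_add, mul_one, one_mul, mul_one,
      lift_shiftedMul_comp_tmul S hF _ one_mem_barGr,
      lift_shiftedMul_comp_tmul S hF _ (ι_mem_barGr hb),
      lift_shiftedMul_comp_tmul S hF _ (mul_ι_mem_barGr (ι_mem_barGr ha) hb), h3, h4, h2, h2,
      brace_shiftedMul_eq_cup S a hb]
    simp
  -- From three letters on everything vanishes: in each cut one part has at least two letters, and
  -- the letter component of a product with such a left factor is zero.
  | a :: b :: c :: l, hl =>
    have h3 : letterD S.toDGA (listWord R (a :: b :: c :: l)) = 0 := by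
      rw [letterD, LinearMap.add_apply, LinearMap.comp_apply, letter_listWord_two, map_zero,
        twoMul_listWord_three _ _ (by simp), add_zero]
    rw [h3, letter_listWord_two, decounit_listWord]
    simp only [List.length_cons, Nat.add_eq_zero_iff, one_ne_zero, and_false, if_false, map_zero,
      LinearMap.zero_apply, zero_smul, add_zero, zero_add]
    suffices TensorProduct.lift (shiftedMul S.toDGA) ∘ₗ TensorProduct.map letter letter ∘ₗ
        F (decon (listWord R (a :: b :: c :: l))) ∘ₗ decon = 0 by
      rw [this, LinearMap.zero_apply]
    refine decon_listWord_induction (C := fun ξ => TensorProduct.lift (shiftedMul S.toDGA) ∘ₗ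
      TensorProduct.map letter letter ∘ₗ F ξ ∘ₗ decon = 0) hl
      (by simp only [map_zero, LinearMap.zero_comp, LinearMap.comp_zero])
      (fun ξ η hξ hη => by simp only [map_add, LinearMap.add_comp, LinearMap.comp_add, hξ, hη,
        add_zero]) ?_
    intro x y hx hy e
    have e := congrArg List.length e
    simp only [List.length_cons, List.length_append] at e
    have h0 : ∀ m : List A, 2 ≤ m.length → letter ∘ₗ barMul S (listWord R m) = 0 := by
      intro m hm
      ext w
      rw [LinearMap.comp_apply, letter_barMul, letter_listWord m (by omega), decounit_listWord,
        if_neg (by omega)]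
      simp
    obtain ⟨j, hj⟩ := listWord_mem_barGr (R := R) hy
    rw [lift_shiftedMul_comp_tmul S hF _ hj]
    by_cases hx2 : 2 ≤ x.length
    · rw [h0 x hx2, LinearMap.zero_comp, cup_zero_left]
    · rw [h0 y (by omega), cup_zero_right]

theorem barD_barMul (v w : TensorAlgebra R A) :
    barD S.toDGA (barMul S v w) =
      barMul S (barD S.toDGA v) w + barMul S (twist S.internal 1 v) (barD S.toDGA w) := by
  obtain ⟨F, hF⟩ : ∃ F, F = tensorOp (barGr S.gr) (isInternal_barGr S.internal) (barMul S)
    (barMul S) := ⟨_, rfl⟩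
  refine (isWordCoalgebra_bar S.internal).d_mul (τ := (twist S.internal 1).toLinearMap)
    (f := barMul S) (F := F) (d := barD S.toDGA) (fun _ _ _ _ hx hy => barMul_mem S hx hy) (LinearMap.congr_fun (barMul_one_left S)) hF
    (decon_barMul S hF) (decounit_barMul S) (fun _ _ hx => twist_one_apply S.internal hx)
    (fun _ _ hx => barD_mem S.toDGA hx) (decon_twist S.internal 1)
    (LinearMap.ext (decon_barD S.toDGA)) (decounit_barD S.toDGA) ?_ v w
  rintro n x y ⟨l, hl, -, rfl⟩
  rw [letter_barD]
  exact letterD_barMul S hl y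

end Axioms

end BarBialgebra

section BarComplexSquare

variable {R : Type*} [CommRing R] {A : Type*} [AddCommGroup A] [Module R A]

local notation "𝕋" => TensorAlgebra R A
local notation "ιT" => TensorAlgebra.ι R

/-! ### The differential squares to zero -/

variable (S : DGA R A)

/-- The Leibniz rule of `A`; the shift of degrees turns it into a sum equal to zero. -/
theorem d_cup_letter (w : TensorAlgebra R A) :
    S.d (cup S letter letter w) + cup S (S.d ∘ₗ letter) letter w +
      cup S (letter ∘ₗ (twist S.internal 1).toLinearMap) (S.d ∘ₗ letter) w = 0 := by
  simp only [cup, LinearMap.comp_apply]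
  generalize decon w = ξ
  refine tensor_induction_homogeneous (isInternal_barGr S.internal) (C := fun ξ =>
    S.d (TensorProduct.lift (shiftedMul S) (TensorProduct.map letter letter ξ)) +
      TensorProduct.lift (shiftedMul S) (TensorProduct.map (S.d ∘ₗ letter) letter ξ) +
      TensorProduct.lift (shiftedMul S) (TensorProduct.map
        (letter ∘ₗ (twist S.internal 1).toLinearMap) (S.d ∘ₗ letter) ξ) = 0) (by simp) ?_ ?_ ξ
  · intro i j x y hx hy
    have hlx := letter_mem hx
    simp only [TensorProduct.map_tmul, TensorProduct.lift.tmul, LinearMap.comp_apply,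
      AlgHom.toLinearMap_apply, letter_twist, letterTwist_apply _ _ hlx, LinearMap.smul_apply,
      shiftedMul_apply S hlx, shiftedMul_apply S (S.d_mem _ _ hlx), map_units_smul,
      S.d_mul _ _ _ hlx, smul_add, smul_smul, ← Int.negOnePow_add]
    have e1 : (i + 1 + 1 - 1).negOnePow = -(i + 1 - 1).negOnePow := by
      rw [show i + 1 + 1 - 1 = i + 1 - 1 + 1 by ring, Int.negOnePow_succ]
    have e2 : (i + 1 - 1 + (i + 1)).negOnePow = -1 := Int.negOnePow_odd _ ⟨i, by ring⟩
    have e3 : (1 * (i + 1 - 1) + (i + 1 - 1)).negOnePow = 1 := Int.negOnePow_even _ ⟨i, by ring⟩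
    rw [e1, e2, e3, Units.neg_smul, Units.neg_smul, one_smul]
    abel
  · intro ξ η hξ hη
    simp only [map_add]
    have := congrArg₂ (· + ·) hξ hη
    rw [add_zero] at this
    rw [← this]
    abel

theorem cup_letter_mul_ι (f : TensorAlgebra R A →ₗ[R] A) (w : TensorAlgebra R A) (a : A) :
    cup S f letter (w * ιT a) = shiftedMul S (f w) a := by
  have key : ∀ ξ : 𝕋 ⊗[R] 𝕋, TensorProduct.lift (shiftedMul S) (TensorProduct.map f letter
      (ξ * (1 ⊗ₜ ιT a))) =
      shiftedMul S (f (TensorProduct.rid R 𝕋 (decounit.toLinearMap.lTensor 𝕋 ξ))) a := by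
    intro ξ
    induction ξ with
    | zero => simp
    | add x y hx hy => rw [add_mul]; simp only [map_add, LinearMap.add_apply, hx, hy]
    | tmul x y => simp
  rw [cup, LinearMap.comp_apply, LinearMap.comp_apply, decon_mul_ι, map_add, map_add, key,
    lTensor_decounit_decon]
  simp

theorem cup_comp_twoMul_mul_ι (f : TensorAlgebra R A →ₗ[R] A) (w : TensorAlgebra R A) (a : A) :
    cup S f (twoMul S) (w * ιT a) = TensorProduct.lift (shiftedMul S)
      (TensorProduct.map f ((shiftedMul S).flip a ∘ₗ letter) (decon w)) := by
  have key : ∀ ξ : 𝕋 ⊗[R] 𝕋, TensorProduct.lift (shiftedMul S) (TensorProduct.map f (twoMul S)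
      (ξ * (1 ⊗ₜ ιT a))) = TensorProduct.lift (shiftedMul S)
      (TensorProduct.map f ((shiftedMul S).flip a ∘ₗ letter) ξ) := by
    intro ξ
    induction ξ with
    | zero => simp
    | add x y hx hy => rw [add_mul]; simp only [map_add, hx, hy]
    | tmul x y => simp [twoMul_eq_cup, cup_letter_mul_ι]
  rw [cup, LinearMap.comp_apply, LinearMap.comp_apply, decon_mul_ι, map_add, map_add, key]
  simp [twoMul_eq_cup, cup]

/-- Associativity of `A`: after the shift the two bracketings appear with opposite signs. -/
theorem cup_twoMul_letter (w : TensorAlgebra R A) :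
    cup S (twoMul S) letter w +
      cup S (letter ∘ₗ (twist S.internal 1).toLinearMap) (twoMul S) w = 0 := by
  rw [← LinearMap.add_apply]
  refine LinearMap.congr_fun (g := 0) (linearMap_ext_right ?_ ?_) w
  · simp [cup]
  intro w c _
  rw [LinearMap.add_apply, cup_letter_mul_ι, cup_comp_twoMul_mul_ι, twoMul, LinearMap.comp_apply,
    LinearMap.comp_apply, LinearMap.zero_apply]
  generalize decon w = ξ
  refine tensor_induction_homogeneous (isInternal_barGr S.internal) (C := fun ξ =>
    shiftedMul S (TensorProduct.lift (shiftedMul S) (TensorProduct.map letter letter ξ)) c +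
      TensorProduct.lift (shiftedMul S) (TensorProduct.map
        (letter ∘ₗ (twist S.internal 1).toLinearMap) ((shiftedMul S).flip c ∘ₗ letter) ξ) = 0)
    (by simp) ?_ ?_ ξ
  · intro i j x y hx hy
    have hlx := letter_mem hx
    have hly := letter_mem hy
    simp only [TensorProduct.map_tmul, TensorProduct.lift.tmul, LinearMap.comp_apply,
      AlgHom.toLinearMap_apply, letter_twist, letterTwist_apply _ _ hlx, LinearMap.smul_apply,
      shiftedMul_apply S hlx, shiftedMul_apply S hly, LinearMap.flip_apply, map_units_smul,
      shiftedMul_apply S (S.mul_mem _ _ _ _ hlx hly), S.mul_assoc, smul_smul,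
      ← Int.negOnePow_add]
    rw [show (1 * (i + 1 - 1) + (i + 1 - 1 + (j + 1 - 1))).negOnePow =
      -(i + 1 - 1 + (i + 1 + (j + 1) - 1)).negOnePow by
      rw [← Int.negOnePow_succ]; exact negOnePow_congr ⟨-1, by ring⟩, Units.neg_smul,
      add_neg_cancel]
  · intro ξ η hξ hη
    simp only [map_add, LinearMap.add_apply]
    have := congrArg₂ (· + ·) hξ hη
    rw [add_zero] at this
    rw [← this]
    abel

theorem cup_add_left (f f' g : TensorAlgebra R A →ₗ[R] A) :
    cup S (f + f') g = cup S f g + cup S f' g := by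
  rw [cup, cup, cup, TensorProduct.map_add_left, LinearMap.add_comp, LinearMap.comp_add]

theorem cup_add_right (f g g' : TensorAlgebra R A →ₗ[R] A) :
    cup S f (g + g') = cup S f g + cup S f g' := by
  rw [cup, cup, cup, TensorProduct.map_add_right, LinearMap.add_comp, LinearMap.comp_add]

theorem letter_comp_barD : letter ∘ₗ barD S = letterD S := LinearMap.ext (letter_barD S)

theorem cup_letter_letter_barD : cup S letter letter ∘ₗ barD S = cup S (letterD S) letter +
    cup S (letter ∘ₗ (twist S.internal 1).toLinearMap) (letterD S) := by
  have h : decon ∘ₗ barD S = ((barD S).rTensor 𝕋 +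
      TensorProduct.map (twist S.internal 1).toLinearMap (barD S)) ∘ₗ decon :=
    LinearMap.ext (decon_barD S)
  have e : ∀ f g : 𝕋 →ₗ[R] 𝕋, TensorProduct.map letter letter ∘ₗ TensorProduct.map f g ∘ₗ decon =
      TensorProduct.map (letter ∘ₗ f) (letter ∘ₗ g) ∘ₗ decon := fun f g => by
    rw [← LinearMap.comp_assoc, ← TensorProduct.map_comp]
  rw [cup, cup, cup, LinearMap.comp_assoc, LinearMap.comp_assoc, h, LinearMap.add_comp,
    LinearMap.comp_add, LinearMap.comp_add, LinearMap.rTensor, e, e, letter_comp_barD, LinearMap.comp_id]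

/-- By the number of letters: one gives `d² = 0` in `A`, two the Leibniz rule (`d_cup_letter`),
three associativity (`cup_twoMul_letter`). -/
theorem letter_barD_barD (w : TensorAlgebra R A) : letter (barD S (barD S w)) = 0 := by
  rw [letter_barD, letterD, LinearMap.add_apply, LinearMap.comp_apply, letter_barD,
    twoMul_eq_cup, ← LinearMap.comp_apply (cup S letter letter), cup_letter_letter_barD]
  have h1 := d_cup_letter S w
  have h2 := cup_twoMul_letter S w
  have h3 := S.d_d (letter w)
  have := congrArg₂ (· + ·) h1 h2
  rw [add_zero] at this
  rw [letterD, cup_add_left, cup_add_right, LinearMap.add_apply, LinearMap.add_apply,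
    LinearMap.add_apply, LinearMap.add_apply, map_add, LinearMap.comp_apply, h3]
  rw [twoMul_eq_cup] at this ⊢
  refine Eq.trans ?_ this
  abel

theorem barD_barD (w : TensorAlgebra R A) : barD S (barD S w) = 0 := by
  refine (isWordCoalgebra_bar S.internal).d_d (τ := (twist S.internal 1).toLinearMap)
    (d := barD S) ?_ ?_ (LinearMap.ext (decon_barD S)) (decounit_barD S)
    (fun n x _ => letter_barD_barD S x) w
  · rw [twist_twist]
    refine linearMap_ext_homogeneous (isInternal_barGr S.internal) fun i w hw => ?_
    rw [AlgHom.toLinearMap_apply, twist_apply _ _ hw, Int.negOnePow_even _ ⟨i, by ring⟩, one_smul,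
      LinearMap.id_apply]
  · refine linearMap_ext_homogeneous (isInternal_barGr S.internal) fun i w hw => ?_
    rw [LinearMap.comp_apply, twist_one_apply _ (barD_mem S hw), LinearMap.neg_apply,
      LinearMap.comp_apply, twist_one_apply _ hw, Int.negOnePow_succ, Units.neg_smul,
      map_units_smul]

end BarComplexSquare

/-! ### Assembling a dg bialgebra from a dg algebra and a coalgebra -/

section Builder

variable {R : Type*} [CommRing R] {B : Type*} [AddCommGroup B] [Module R B]

/-- A dg algebra and a coalgebra whose structure maps are compatible form a dg bialgebra. -/
def DGA.toDGBialgebra (D : DGA R B) (C : Coalgebra R B) (one : B) (one_mem : one ∈ D.gr 0)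
    (one_mul : ∀ x, D.mul one x = x) (mul_one : ∀ x, D.mul x one = x)
    (comul_mem : ∀ i x, x ∈ D.gr i → C.comul x ∈ tensorGr D.gr i)
    (counit_mem : ∀ i x, x ∈ D.gr i → i ≠ 0 → C.counit x = 0)
    (comul_d : ∀ E, E = D.d.rTensor B + TensorProduct.map (parity D.gr D.internal) D.d →
      ∀ x, C.comul (D.d x) = E (C.comul x))
    (counit_d : ∀ x, C.counit (D.d x) = 0)
    (comul_mul : ∀ F, F = tensorOp D.gr D.internal D.mul D.mul →
      ∀ x y, C.comul (D.mul x y) = F (C.comul x) (C.comul y))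
    (comul_one : C.comul one = one ⊗ₜ one)
    (counit_mul : ∀ x y, C.counit (D.mul x y) = C.counit x * C.counit y)
    (counit_one : C.counit one = 1) : DGBialgebra R B where
  toDGA := D
  one := one
  one_mem := one_mem
  one_mul := one_mul
  mul_one := mul_one
  coalg := C
  comul_mem := comul_mem
  counit_mem := counit_mem
  comul_d := comul_d _ rfl
  counit_d := counit_d
  comul_mul := comul_mul _ rfl
  comul_one := comul_one
  counit_mul := counit_mul
  counit_one := counit_one

end Builder

section BarBialgebraConstruction

variable {R : Type*} [CommRing R] {A : Type*} [AddCommGroup A] [Module R A]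

local notation "𝕋" => TensorAlgebra R A
local notation "ιT" => TensorAlgebra.ι R

/-! ### The bar bialgebra of a brace algebra -/

theorem rTensor_add_map_comp_decon (S : DGA R A) {E : 𝕋 ⊗[R] 𝕋 →ₗ[R] 𝕋 ⊗[R] 𝕋}
    (hE : E = (barD S).rTensor 𝕋 + TensorProduct.map (twist S.internal 1).toLinearMap (barD S))
    (w : TensorAlgebra R A) : decon (barD S w) = E (decon w) := by
  rw [hE, decon_barD]

/-- The dg algebra structure on the bar complex of a brace algebra. -/
def barDGA (S : BraceAlgebra R A) : DGA R (TensorAlgebra R A) where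
  gr := barGr S.gr
  internal := isInternal_barGr S.internal
  d := barD S.toDGA
  d_mem _ _ hx := barD_mem S.toDGA hx
  d_d := barD_barD S.toDGA
  mul := barMul S
  mul_mem _ _ _ _ hx hy := barMul_mem S hx hy
  mul_assoc := barMul_assoc S
  d_mul i x y hx := by
    rw [barD_barMul, twist_apply S.internal 1 hx, one_mul, map_units_smul₂]

/-- The dg bialgebra structure on the bar complex of a brace algebra. -/
def barBialgebra (S : BraceAlgebra R A) : DGBialgebra R (TensorAlgebra R A) :=
  (barDGA S).toDGBialgebra deconCoalgebra 1 one_mem_barGr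
    (LinearMap.congr_fun (barMul_one_left S)) (barMul_one_right S)
    (fun _ _ hx => decon_mem_tensorGr hx) (fun _ _ hx hi => decounit_eq_zero hx hi)
    (fun _ hE => rTensor_add_map_comp_decon S.toDGA
      (by rw [hE, ← parity_eq_twist]; rfl))
    (decounit_barD S.toDGA) (fun _ hF => decon_barMul S hF) decon_one (decounit_barMul S)
    (map_one decounit)

theorem isBarBialgebra_barBialgebra (S : BraceAlgebra R A) : IsBarBialgebra S (barBialgebra S) where
  gr_eq := rfl
  one_eq := rfl
  comul_word _ y := decon_word y
  counit_word _ y := decounit_word y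
  d_word _ _ _ hy := barD_word S.toDGA hy
  mul_word _ _ _ _ _ _ hx hy := by
    simp only [one_pow, one_smul]
    exact barMul_word S hx hy

end BarBialgebraConstruction

/-! ### Uniqueness: the structure maps are determined on homogeneous words -/

section BarUnique

theorem coalgebra_ext {R : Type*} [CommRing R] {B : Type*} [AddCommGroup B] [Module R B]
    {C C' : Coalgebra R B} (comul : C.comul = C'.comul) (counit : C.counit = C'.counit) :
    C = C' := by
  cases C with | @mk X _ _ _ => cases C' with | @mk X' _ _ _ =>
  cases X; cases X'
  dsimp only [CoalgebraStruct.comul, CoalgebraStruct.counit] at comul counit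
  subst comul counit
  rfl

theorem DGBialgebra.ext_of_maps {R : Type*} [CommRing R] {B : Type*} [AddCommGroup B] [Module R B]
    {D D' : DGBialgebra R B} (gr : D.gr = D'.gr) (d : D.d = D'.d) (mul : D.mul = D'.mul)
    (one : D.one = D'.one) (comul : D.coalg.comul = D'.coalg.comul)
    (counit : D.coalg.counit = D'.coalg.counit) : D = D' := by
  have hC : D.coalg = D'.coalg := coalgebra_ext comul counit
  clear comul counit
  cases D with | mk X => cases D' with | mk X' =>
  cases X; cases X'
  dsimp only at gr d mul one hC
  subst gr d mul one hC
  rfl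

variable {R : Type*} [CommRing R] {A : Type*} [AddCommGroup A] [Module R A]

theorem linearMap_ext_word {gr : ℤ → Submodule R A} (h : DirectSum.IsInternal gr) {X : Type*}
    [AddCommGroup X] [Module R X] {f g : TensorAlgebra R A →ₗ[R] X}
    (hfg : ∀ (n : ℕ) (b : Fin n → ℤ) (y : Fin n → A), (∀ q, y q ∈ gr (b q)) →
      f (word R y) = g (word R y)) : f = g := by
  refine linearMap_ext_homogeneous (isInternal_barGr h) fun i w hw => ?_
  rw [barGr] at hw
  induction hw using Submodule.span_induction with
  | zero => simp
  | add x y _ _ hx hy => rw [map_add, map_add, hx, hy]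
  | smul r x _ hx => rw [map_smul, map_smul, hx]
  | mem w hw =>
    obtain ⟨n, b, y, hy, -, rfl⟩ := hw
    exact hfg n b y hy

theorem IsBarBialgebra.unique {t : R} {S : WeightedBraceAlgebra R t A}
    {D D' : DGBialgebra R (TensorAlgebra R A)} (hD : IsBarBialgebra S D)
    (hD' : IsBarBialgebra S D') : D = D' := by
  refine DGBialgebra.ext_of_maps (hD.gr_eq.trans hD'.gr_eq.symm) ?_ ?_
    (hD.one_eq.trans hD'.one_eq.symm) ?_ ?_
  · refine linearMap_ext_word S.internal fun n b y hy => ?_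
    rw [hD.d_word n b y hy, hD'.d_word n b y hy]
  · refine linearMap_ext_word S.internal fun n a x hx => ?_
    refine linearMap_ext_word S.internal fun m b y hy => ?_
    rw [hD.mul_word n m a b x y hx hy, hD'.mul_word n m a b x y hx hy]
  · refine linearMap_ext_word S.internal fun n b y _ => ?_
    rw [hD.comul_word, hD'.comul_word]
  · refine linearMap_ext_word S.internal fun n b y _ => ?_
    rw [hD.counit_word, hD'.counit_word]

end BarUnique

/-! ### Rescaling the braces -/

section Rescale

variable {R : Type*} [CommRing R] {A : Type*} [AddCommGroup A] [Module R A]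

local notation "𝕋" => TensorAlgebra R A
local notation "ιT" => TensorAlgebra.ι R

/-- `w` is a word of length `N`. -/
def IsWord (N : ℕ) (w : TensorAlgebra R A) : Prop := ∃ l : List A, l.length = N ∧ listWord R l = w

theorem isWord_word {n : ℕ} (y : Fin n → A) : IsWord n (word R y) :=
  ⟨List.ofFn y, by simp, (word_eq_listWord y).symm⟩

theorem isWord_seg {m : ℕ} (y : Fin m → A) {s l : ℕ} (hsl : s + l ≤ m) : IsWord l (seg R y s l) := by
  rw [seg_eq_word y hsl]
  exact isWord_word _

theorem isWord_ι (a : A) : IsWord 1 (ιT a) := ⟨[a], rfl, listWord_singleton a⟩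

theorem IsWord.mul {p q : ℕ} {v w : TensorAlgebra R A} (hv : IsWord p v) (hw : IsWord q w) :
    IsWord (p + q) (v * w) := by
  obtain ⟨l, rfl, rfl⟩ := hv
  obtain ⟨l', rfl, rfl⟩ := hw
  exact ⟨l ++ l', by simp, listWord_append l l'⟩

theorem sum_le_and_isWord_insertionWord (brace : A →ₗ[R] TensorAlgebra R A →ₗ[R] A) {n m : ℕ}
    {e : (Fin n → Fin (m + 1)) × (Fin n → Fin (m + 1))} (he : e ∈ insertions n m)
    (x : Fin n → A) (y : Fin m → A) : ∑ p, (e.2 p : ℕ) ≤ m ∧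
      IsWord (n + m - ∑ p, (e.2 p : ℕ)) (insertionWord brace x y e) := by
  induction n generalizing m with
  | zero => exact ⟨by simp, by simpa [insertionWord, insertionEnd, ← word_eq_seg] using isWord_word y⟩
  | succ n ih =>
    obtain ⟨i, l, hil, e, he', rfl⟩ := exists_snocInsertion he
    obtain ⟨h1, h2⟩ := ih he' (fun p => x p.castSucc) (initial y i (by omega))
    rw [Fin.sum_univ_castSucc, insertionWord_snoc brace hil he']
    simp only [snocInsertion_snd_castSucc, snocInsertion_snd_last]
    refine ⟨by omega, ?_⟩
    have := h2.mul ((isWord_ι (brace (x (Fin.last n)) (seg R y i l))).mul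
      (isWord_seg y (show i + l + (m - i - l) ≤ m by omega)))
    convert this using 1
    omega

/-- The map which multiplies a word of length `n` by `t ^ wt n`. -/
def weightScale (t : R) : TensorAlgebra R A →ₗ[R] TensorAlgebra R A :=
  -- Words of length `0` and `1` should keep the factor `1`, so the projection to these lengths is
  -- added with the factor `1 - t`.
  t • LinearMap.id + (1 - t) • (Algebra.linearMap R (TensorAlgebra R A) ∘ₗ decounit.toLinearMap +
    ιT ∘ₗ letter)

theorem IsWord.weightScale (t : R) {n : ℕ} {w : TensorAlgebra R A} (hw : IsWord n w) :
    weightScale t w = t ^ wt n • w := by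
  obtain ⟨l, rfl, rfl⟩ := hw
  match l with
  | [] => simp [BDBar.weightScale, wt, ← add_smul]
  | [a] => simp [BDBar.weightScale, wt, ← add_smul]
  | a :: b :: l =>
    rw [BDBar.weightScale]
    simp only [LinearMap.add_apply, LinearMap.smul_apply, LinearMap.id_coe, id_eq,
      LinearMap.comp_apply, AlgHom.toLinearMap_apply, decounit_listWord,
      letter_listWord (a :: b :: l) (by simp)]
    simp [wt]

/-- The braces `t ^ wt n x{y₁,...,yₙ}`. -/
def rescaledBrace (t : R) (brace : A →ₗ[R] TensorAlgebra R A →ₗ[R] A) :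
    A →ₗ[R] TensorAlgebra R A →ₗ[R] A :=
  LinearMap.lcomp R A (weightScale t) ∘ₗ brace

variable {t : R}

theorem rescaledBrace_apply (brace : A →ₗ[R] TensorAlgebra R A →ₗ[R] A) {n : ℕ}
    {w : TensorAlgebra R A} (hw : IsWord n w) (x : A) :
    rescaledBrace t brace x w = t ^ wt n • brace x w := by
  rw [rescaledBrace, LinearMap.comp_apply, LinearMap.lcomp_apply, hw.weightScale, map_smul]

theorem insertionWord_rescaledBrace (brace : A →ₗ[R] TensorAlgebra R A →ₗ[R] A) {n m : ℕ}
    {e : (Fin n → Fin (m + 1)) × (Fin n → Fin (m + 1))} (he : e ∈ insertions n m)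
    (x : Fin n → A) (y : Fin m → A) : insertionWord (rescaledBrace t brace) x y e =
      t ^ (∑ p, wt (e.2 p)) • insertionWord brace x y e := by
  induction n generalizing m with
  | zero => simp [insertionWord]
  | succ n ih =>
    obtain ⟨i, l, hil, e, he', rfl⟩ := exists_snocInsertion he
    rw [Fin.sum_univ_castSucc, insertionWord_snoc _ hil he', insertionWord_snoc _ hil he', ih he',
      rescaledBrace_apply brace (isWord_seg y hil), map_smul, pow_add, mul_smul]
    simp only [snocInsertion_snd_castSucc, snocInsertion_snd_last, smul_mul_assoc, mul_smul_comm]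
    rw [smul_comm]

/-- This makes the subtraction of natural numbers in the exponents of the associativity relation a
true one. For `n = 1` and `m ≥ 2`, either the inner brace or the outer one has at least two
arguments; for `n ≥ 2` the outer one has. -/
theorem wt_add_wt_le {n m : ℕ} {e : (Fin n → Fin (m + 1)) × (Fin n → Fin (m + 1))}
    (he : ∑ p, (e.2 p : ℕ) ≤ m) : wt n + wt m ≤
      wt (n + m - ∑ p, (e.2 p : ℕ)) + ∑ p, wt (e.2 p) + wt n * wt m := by
  match n with
  | 0 => simp [wt]
  | 1 =>
    simp only [Finset.univ_unique, Finset.sum_singleton] at he ⊢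
    simp only [wt]
    grind
  | n + 2 =>
    have h1 : wt (n + 2 + m - ∑ p, (e.2 p : ℕ)) = 1 := if_pos (by omega)
    have h2 : wt (n + 2) = 1 := if_pos (by omega)
    rw [h1, h2]
    omega

/-- The brace algebra with the braces `t ^ wt n x{y₁,...,yₙ}`. -/
def WeightedBraceAlgebra.rescale (S : WeightedBraceAlgebra R t A) : BraceAlgebra R A where
  toDGA := S.toDGA
  brace := rescaledBrace t S.brace
  brace_one x := by
    have := rescaledBrace_apply (t := t) S.brace (n := 0) (w := 1) ⟨[], rfl, rfl⟩ x
    rw [this, S.brace_one]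
    simp [wt]
  brace_mem n a b x y hx hy := by
    rw [rescaledBrace_apply _ (isWord_word y)]
    exact Submodule.smul_mem _ _ (S.brace_mem n a b x y hx hy)
  brace_brace n m b c x y z hy hz := by
    -- The weighted relation is normalized by its least weight `wt n + wt m - wt n * wt m`;
    -- multiplying by this power of `t` restores the full weights.
    have h := congrArg (t ^ (wt n + wt m - wt n * wt m) • ·) (S.brace_brace n m b c x y z hy hz)
    have hnm : wt n * wt m ≤ wt n + wt m := by
      simp only [wt]
      split_ifs <;> simp
    rw [smul_smul, ← pow_add, Nat.sub_add_cancel hnm, Finset.smul_sum] at h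
    rw [rescaledBrace_apply _ (isWord_word z), rescaledBrace_apply _ (isWord_word y), map_smul,
      LinearMap.smul_apply, one_pow, one_smul, smul_smul, ← pow_add, add_comm (wt m), h]
    refine Finset.sum_congr rfl fun e he => ?_
    obtain ⟨h1, h2⟩ := sum_le_and_isWord_insertionWord S.brace he y z
    rw [insertionWord_rescaledBrace _ he, map_smul, rescaledBrace_apply _ h2, one_pow, one_smul,
      smul_comm, smul_smul, smul_smul, ← pow_add, ← pow_add]
    congr 3
    have := wt_add_wt_le h1
    omega
  d_brace n a b x y hx hy := by
    -- The terms with `n` arguments need the factor `t ^ wt n`. The power already on the terms with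
    -- `n + 1` arguments makes up the difference to `wt (n + 1)`.
    have h := congrArg (t ^ wt n • ·) (S.d_brace n a b x y hx hy)
    have hn : wt n + (if n + 1 = 2 then 1 else 0) = wt (n + 1) := by
      simp only [wt]
      split_ifs <;> omega
    have hmul : ∀ z : A, t ^ wt n • t ^ (if n + 1 = 2 then 1 else 0) • z = t ^ wt (n + 1) • z :=
      fun z => by rw [smul_smul, ← pow_add, hn]
    have hcomm : ∀ (r : R) (u : ℤˣ) (z : A), r • u • z = u • r • z := fun r u z => smul_comm r u z
    simp only [smul_add, smul_sub, hmul, Finset.smul_sum, hcomm] at h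
    have h0 : rescaledBrace t S.brace x (seg R y 0 n) = t ^ wt n • S.brace x (seg R y 0 n) :=
      rescaledBrace_apply _ (isWord_seg y (by omega)) x
    have h1 : rescaledBrace t S.brace x (seg R y 1 n) = t ^ wt n • S.brace x (seg R y 1 n) :=
      rescaledBrace_apply _ (isWord_seg y (by omega)) x
    have h2 : ∀ i : Fin n, rescaledBrace t S.brace x (seg R y 0 (i : ℕ) *
        ιT (S.mul (y i.castSucc) (y i.succ)) * seg R y ((i : ℕ) + 2) (n - 1 - (i : ℕ))) =
        t ^ wt n • S.brace x (seg R y 0 (i : ℕ) *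
          ιT (S.mul (y i.castSucc) (y i.succ)) * seg R y ((i : ℕ) + 2) (n - 1 - (i : ℕ))) :=
      fun i => by
        have hi := i.isLt
        have := ((isWord_seg (R := R) y (show 0 + (i : ℕ) ≤ n + 1 by omega)).mul
          (isWord_ι (R := R) (S.mul (y i.castSucc) (y i.succ)))).mul
            (isWord_seg (R := R) y (show (i : ℕ) + 2 + (n - 1 - (i : ℕ)) ≤ n + 1 by omega))
        rw [show (i : ℕ) + 1 + (n - 1 - (i : ℕ)) = n by omega] at this
        exact rescaledBrace_apply _ this x
    have hw : ∀ (x : A) (y : Fin (n + 1) → A), rescaledBrace t S.brace x (word R y) =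
        t ^ wt (n + 1) • S.brace x (word R y) := fun x y => rescaledBrace_apply _ (isWord_word y) x
    simp only [one_pow, one_smul, hw, map_smul, h0, h1, h2,
      LinearMap.smul_apply]
    exact h
  mul_brace n a₁ a₂ b x₁ x₂ y hx₁ hx₂ hy := by
    -- Here the least weight is `wt n`, except for `n = 2`, where it is `0` and the relation already
    -- contains the factor `t`.
    have h := congrArg (t ^ (wt n - if n = 2 then 1 else 0) • ·)
      (S.mul_brace n a₁ a₂ b x₁ x₂ y hx₁ hx₂ hy)
    have hn : wt n - (if n = 2 then 1 else 0) + (if n = 2 then 1 else 0) = wt n := by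
      simp only [wt]
      split_ifs <;> omega
    rw [smul_smul, ← pow_add, hn, Finset.smul_sum] at h
    rw [rescaledBrace_apply _ (isWord_word y), one_pow, one_smul, ← h]
    refine Finset.sum_congr rfl fun j hj => ?_
    rw [Finset.mem_range] at hj
    rw [rescaledBrace_apply _ (isWord_seg y (show 0 + j ≤ n by omega)),
      rescaledBrace_apply _ (isWord_seg y (show j + (n - j) ≤ n by omega)), one_pow, one_smul,
      map_smul, map_smul, LinearMap.smul_apply, smul_smul, smul_comm (t ^ _) (Int.negOnePow _),
      smul_smul, ← pow_add, ← pow_add]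
    congr 3
    simp only [wt] at hn ⊢
    split_ifs <;> omega

/-- Each brace in a term of the product with at least two arguments contributes one factor `t`,
which is just what rescaling builds into it. The other formulas do not involve braces. -/
theorem isBarBialgebra_rescale_iff {S : WeightedBraceAlgebra R t A}
    {D : DGBialgebra R (TensorAlgebra R A)} : IsBarBialgebra S.rescale D ↔ IsBarBialgebra S D := by
  have key : ∀ {n m : ℕ} (a : Fin n → ℤ) (b : Fin m → ℤ) (x : Fin n → A) (y : Fin m → A),
      ∑ e ∈ insertions n m, (insertionExp a b e).negOnePow • (1 : R) ^ (∑ p, wt (e.2 p)) •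
          insertionWord S.rescale.brace x y e =
        ∑ e ∈ insertions n m, (insertionExp a b e).negOnePow •
          t ^ (∑ p, wt (e.2 p)) • insertionWord S.brace x y e := fun a b x y =>
    Finset.sum_congr rfl fun e he => by
      rw [one_pow, one_smul, WeightedBraceAlgebra.rescale, insertionWord_rescaledBrace _ he]
  constructor
  · exact fun h => ⟨h.gr_eq, h.one_eq, h.comul_word, h.counit_word, h.d_word,
      fun n m a b x y hx hy => (h.mul_word n m a b x y hx hy).trans (key a b x y)⟩
  · exact fun h => ⟨h.gr_eq, h.one_eq, h.comul_word, h.counit_word, h.d_word,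
      fun n m a b x y hx hy => (h.mul_word n m a b x y hx hy).trans (key a b x y).symm⟩

end Rescale

/-! ### The product modulo braces with several arguments -/

section ModEq

variable {R : Type*} [CommRing R] {M N : Type*} [AddCommGroup M] [Module R M] [AddCommGroup N]
  [Module R N]

/-- Congruence modulo multiples of `s`. -/
def ModEq (s : R) (x y : M) : Prop := ∃ z, x = y + s • z

variable {s : R} {x x' y y' z : M}

theorem ModEq.of_eq (h : x = y) : ModEq s x y := ⟨0, by simp [h]⟩

theorem ModEq.refl (s : R) (x : M) : ModEq s x x := .of_eq rfl

theorem ModEq.symm (h : ModEq s x y) : ModEq s y x := by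
  obtain ⟨z, rfl⟩ := h
  exact ⟨-z, by simp⟩

theorem ModEq.trans (h : ModEq s x y) (h' : ModEq s y z) : ModEq s x z := by
  obtain ⟨u, rfl⟩ := h
  obtain ⟨v, rfl⟩ := h'
  exact ⟨v + u, by rw [smul_add, add_assoc]⟩

theorem ModEq.add (h : ModEq s x y) (h' : ModEq s x' y') : ModEq s (x + x') (y + y') := by
  obtain ⟨u, rfl⟩ := h
  obtain ⟨v, rfl⟩ := h'
  exact ⟨u + v, by rw [smul_add]; abel⟩

theorem ModEq.map (h : ModEq s x y) (f : M →ₗ[R] N) : ModEq s (f x) (f y) := by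
  obtain ⟨u, rfl⟩ := h
  exact ⟨f u, by rw [map_add, map_smul]⟩

theorem ModEq.units_smul (h : ModEq s x y) (u : ℤˣ) : ModEq s (u • x) (u • y) := by
  obtain ⟨z, rfl⟩ := h
  exact ⟨u • z, by rw [smul_add, smul_comm]⟩

theorem ModEq.smul (h : ModEq s x y) (r : R) : ModEq s (r • x) (r • y) :=
  h.map (r • LinearMap.id)

theorem ModEq.mul {B : Type*} [Ring B] [Algebra R B] {x x' y y' : B} (h : ModEq s x y)
    (h' : ModEq s x' y') : ModEq s (x * x') (y * y') :=
  (h.map (LinearMap.mulRight R x')).trans (h'.map (LinearMap.mulLeft R y))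

theorem ModEq.dvd {r : R} (h : ModEq s x y) (hr : r ∣ s) : ModEq r x y := by
  obtain ⟨z, rfl⟩ := h
  obtain ⟨q, rfl⟩ := hr
  exact ⟨q • z, by rw [mul_smul]⟩

end ModEq

/-! ### The quasi-shuffle recursion and commutativity modulo `s` -/

section ProductModEq

variable {R : Type*} [CommRing R] {A : Type*} [AddCommGroup A] [Module R A]

local notation "𝕋" => TensorAlgebra R A
local notation "ιT" => TensorAlgebra.ι R

theorem conv_modEq {s : R} (f : TensorAlgebra R A →ₗ[R] TensorAlgebra R A)
    {g g' : TensorAlgebra R A →ₗ[R] TensorAlgebra R A} (h : ∀ w, ModEq s (g w) (g' w))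
    (w : TensorAlgebra R A) : ModEq s (conv f g w) (conv f g' w) := by
  rw [conv_apply, conv_apply]
  generalize decon w = ζ
  induction ζ with
  | zero => exact .of_eq (by simp)
  | add x y hx hy => simpa only [map_add] using hx.add hy
  | tmul u v =>
    rw [TensorProduct.map_tmul, TensorProduct.map_tmul, LinearMap.mul'_apply, LinearMap.mul'_apply]
    exact (ModEq.refl s _).mul (h v)

theorem conv_mulRight (f g : TensorAlgebra R A →ₗ[R] TensorAlgebra R A) (v w : TensorAlgebra R A) :
    conv f (LinearMap.mulRight R v ∘ₗ g) w = conv f g w * v := by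
  rw [conv_apply, conv_apply]
  generalize decon w = ζ
  induction ζ with
  | zero => simp
  | add x y hx hy => simp only [map_add, add_mul, hx, hy]
  | tmul x y => simp [mul_assoc]

theorem conv_decounit_smulRight (f : TensorAlgebra R A →ₗ[R] TensorAlgebra R A)
    (v w : TensorAlgebra R A) : conv f (decounit.toLinearMap.smulRight v) w = f w * v := by
  have h := congrArg (fun ζ => f (TensorProduct.rid R (TensorAlgebra R A) ζ) * v)
    (lTensor_decounit_decon w)
  simp only [TensorProduct.rid_tmul, one_smul] at h
  rw [← h, conv_apply]
  generalize decon w = ζ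
  induction ζ with
  | zero => simp
  | add x y hx hy => simp only [map_add, add_mul, hx, hy]
  | tmul x y => simp

variable (S : BraceAlgebra R A) {s : R}

/-- The hypothesis says that a brace sees at most one letter modulo `s`. Hence the last letter `b`
stays outside the brace of `a`, unless it is the only letter. -/
theorem leadingBrace_mul_ι_modEq
    (hS : ∀ a w, ModEq s (S.brace a w) (decounit w • a + S.brace a (ιT (letter w))))
    (a b : A) (y : TensorAlgebra R A) : ModEq s (leadingBrace S a (y * ιT b))
      (leadingBrace S a y * ιT b + decounit y • ιT (S.brace a (ιT b))) := by
  rw [leadingBrace_apply, conv_mul_ι, LinearMap.id_comp, ← LinearMap.comp_id (LinearMap.mulRight R _),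
    conv_mulRight, LinearMap.id_apply, mul_one]
  refine (ModEq.refl s _).add ?_
  rw [LinearMap.comp_apply, ← map_smul ιT]
  refine ModEq.map ?_ ιT
  simpa using hS a (y * ιT b)

/-- The quasi-shuffle recursion: the last letter of the product is `b`, `a{b}` or `a`. It serves
modulo `ħ` for commutativity and the shuffle limit, and modulo `ħ²` for the limit of the bracket. -/
theorem barMul_mul_ι_mul_ι_modEq
    (hS : ∀ a w, ModEq s (S.brace a w) (decounit w • a + S.brace a (ιT (letter w))))
    {i j k : ℤ} {a b : A} (ha : a ∈ S.gr i) (hb : b ∈ S.gr j) (w : TensorAlgebra R A)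
    {y : TensorAlgebra R A} (hy : y ∈ barGr S.gr k) :
    ModEq s (barMul S (w * ιT a) (y * ιT b))
      (barMul S (w * ιT a) y * ιT b
        + ((i - 1) * k).negOnePow • (barMul S w y * ιT (S.brace a (ιT b)))
        + ((i - 1) * (k + (j - 1))).negOnePow • (barMul S w (y * ιT b) * ιT a)) := by
  rw [barMul_mul_ι S w ha, conv_mul_ι]
  refine ModEq.add ?_ (.of_eq ?_)
  · refine (conv_modEq _ (g' := LinearMap.mulRight R (ιT b) ∘ₗ leadingBrace S a +
      decounit.toLinearMap.smulRight (ιT (S.brace a (ιT b))))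
        (fun y => leadingBrace_mul_ι_modEq S hS a b y) y).trans (.of_eq ?_)
    rw [conv_add_right, LinearMap.add_apply, conv_mulRight, conv_decounit_smulRight,
      LinearMap.comp_apply, AlgHom.toLinearMap_apply, twist_apply _ _ hy, map_units_smul,
      smul_mul_assoc]
  · rw [LinearMap.comp_apply, AlgHom.toLinearMap_apply,
      twist_apply _ _ (mul_ι_mem_barGr hy hb), map_units_smul, smul_mul_assoc, leadingBrace_apply,
      conv_one]
    simp [S.brace_one]

/-- Double induction with the quasi-shuffle recursion for both orders of the factors: the two outer
terms are exchanged, and the middle one is symmetric by `hcomm`. -/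
theorem barMul_comm_modEq
    (hS : ∀ a w, ModEq s (S.brace a w) (decounit w • a + S.brace a (ιT (letter w))))
    (hcomm : ∀ i j a b, a ∈ S.gr i → b ∈ S.gr j → ModEq s (S.brace a (ιT b))
      (((i - 1) * (j - 1)).negOnePow • S.brace b (ιT a)))
    {p q : ℤ} {v w : TensorAlgebra R A} (hv : v ∈ barGr S.gr p) (hw : w ∈ barGr S.gr q) :
    ModEq s (barMul S v w) ((p * q).negOnePow • barMul S w v) := by
  refine barGr_induction (C := fun p v => ∀ q w, w ∈ barGr S.gr q →
    ModEq s (barMul S v w) ((p * q).negOnePow • barMul S w v)) ?_ ?_ ?_ ?_ ?_ hv q w hw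
  · exact fun _ _ _ _ => .of_eq (by simp)
  · intro q w _
    exact .of_eq (by simp [barMul_one_right])
  · intro p i v a hv ihv ha q w hw
    refine barGr_induction (C := fun q w => ModEq s (barMul S (v * ιT a) w)
      (((p + (i - 1)) * q).negOnePow • barMul S w (v * ιT a))) ?_ ?_ ?_ ?_ ?_ hw
    · exact fun _ => .of_eq (by simp)
    · exact .of_eq (by simp [barMul_one_right])
    · intro q j w b hw ihw hb
      have h2 := ihv q w hw
      have h3 := ihv _ _ (mul_ι_mem_barGr hw hb)
      have hl := barMul_mul_ι_mul_ι_modEq S hS ha hb v hw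
      have hr := (barMul_mul_ι_mul_ι_modEq S hS hb ha w hv).units_smul
        ((p + (i - 1)) * (q + (j - 1))).negOnePow
      refine (hl.trans ?_).trans hr.symm
      refine (((ihw.mul (.refl s _)).add ((h2.mul ((hcomm i j a b ha hb).map ιT)).units_smul _)).add
        ((h3.mul (.refl s _)).units_smul _)).trans (.of_eq ?_)
      simp only [map_units_smul, smul_mul_assoc, mul_smul_comm, smul_add, smul_smul,
        ← Int.negOnePow_add]
      -- The signs are brought to a common form; those that differ in shape differ by an even
      -- exponent.
      rw [negOnePow_congr (i := (p + (i - 1)) * q) (j := (p + (i - 1)) * (q + (j - 1)) +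
          (j - 1) * (p + (i - 1))) ⟨-((j - 1) * (p + (i - 1))), by ring⟩,
        negOnePow_congr (i := (i - 1) * q + ((i - 1) * (j - 1) + p * q))
          (j := (p + (i - 1)) * (q + (j - 1)) + (j - 1) * p) ⟨-((j - 1) * p), by ring⟩,
        show (i - 1) * (q + (j - 1)) + p * (q + (j - 1)) = (p + (i - 1)) * (q + (j - 1)) by ring]
      abel
    · intro q w w' hw hw'
      simpa only [map_add, LinearMap.add_apply, smul_add] using hw.add hw'
    · intro q r w hw
      simpa only [map_smul, LinearMap.smul_apply, smul_comm r] using hw.smul r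
  · intro p v v' hv hv' q w hw
    simpa only [map_add, LinearMap.add_apply, smul_add] using (hv q w hw).add (hv' q w hw)
  · intro p r v hv q w hw
    simpa only [map_smul, LinearMap.smul_apply, smul_comm r] using (hv q w hw).smul r

end ProductModEq

/-! ### Torsion and flatness -/

section Flatness

theorem flat_tensorPower (R : Type*) [CommRing R] (M : Type*) [AddCommGroup M] [Module R M]
    [Module.Flat R M] (n : ℕ) : Module.Flat R (TensorPower R n M) := by
  induction n with
  | zero => exact Module.Flat.of_linearEquiv (TensorPower.algebraMap₀ (R := R) (M := M)).symm
  | succ n ih =>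
    have : Module.Flat R (TensorPower R 1 M) :=
      Module.Flat.of_linearEquiv (PiTensorProduct.subsingletonEquiv (R := R) (s := fun _ => M) (0 : Fin 1))
    exact Module.Flat.of_linearEquiv (TensorPower.mulEquiv (R := R) (M := M) (n := n) (m := 1)).symm

instance flat_tensorAlgebra (R : Type*) [CommRing R] (M : Type*) [AddCommGroup M] [Module R M]
    [Module.Flat R M] : Module.Flat R (TensorAlgebra R M) := by
  have := flat_tensorPower R M
  exact Module.Flat.of_linearEquiv (TensorAlgebra.equivDirectSum (R := R) (M := M)).toLinearEquiv

/-- A nonzero power series is a unit times a power of `X`, so absence of `X`-torsion is absence of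
torsion, which is flatness over a Dedekind domain. Flatness, unlike the hypothesis, passes to tensor
powers and tensor squares directly. -/
theorem flat_of_X_smul_eq_zero {k : Type*} [Field k] {M : Type*} [AddCommGroup M] [Module k⟦X⟧ M]
    (h : ∀ a : M, (PowerSeries.X : k⟦X⟧) • a = 0 → a = 0) : Module.Flat k⟦X⟧ M := by
  rw [IsDedekindDomain.flat_iff_torsion_eq_bot, eq_bot_iff]
  intro a ha
  obtain ⟨⟨r, hr⟩, hra⟩ := (Submodule.mem_torsion_iff a).mp ha
  obtain ⟨n, hn⟩ := IsDiscreteValuationRing.associated_pow_irreducible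
    (nonZeroDivisors.ne_zero hr) (PowerSeries.X_irreducible (R := k))
  have hX : ∀ n : ℕ, ∀ a : M, (PowerSeries.X : k⟦X⟧) ^ n • a = 0 → a = 0 := by
    intro n
    induction n with
    | zero => simp
    | succ n ih => exact fun a ha => ih a (h _ (by rwa [smul_smul, ← pow_succ']))
  obtain ⟨u, hu⟩ := hn
  refine hX n a ?_
  have hra : r • a = 0 := hra
  rw [← hu, mul_comm, mul_smul, hra, smul_zero]

theorem eq_zero_of_X_smul_eq_zero {k : Type*} [Field k] {M : Type*} [AddCommGroup M]
    [Module k⟦X⟧ M] [Module.Flat k⟦X⟧ M] (a : M) (ha : (PowerSeries.X : k⟦X⟧) • a = 0) : a = 0 :=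
  (Module.Flat.isSMulRegular_of_nonZeroDivisors (M := M)
    (mem_nonZeroDivisors_of_ne_zero PowerSeries.X_ne_zero)) (ha.trans (smul_zero _).symm)

end Flatness

/-! ### Dividing commutators -/

section BracketOfCommutator

variable {R : Type*} [CommRing R] {B : Type*} [AddCommGroup B] [Module R B]

/-- The components of `b` in degrees other than `i` are killed by `t`, hence zero. This gives the
degree of a bracket obtained by division. -/
theorem mem_gr_of_smul_mem {gr : ℤ → Submodule R B} (h : DirectSum.IsInternal gr) {t : R}
    (ht : ∀ b : B, t • b = 0 → b = 0) {i : ℤ} {b : B} (hb : t • b ∈ gr i) : b ∈ gr i := by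
  obtain ⟨u, rfl⟩ := (grEquiv gr h).surjective b
  have hu : t • u = DirectSum.lof R ℤ (fun i => gr i) i ⟨_, hb⟩ := by
    rw [← grEquiv_symm_apply h hb, ← map_smul, LinearEquiv.symm_apply_apply]
  have h0 : ∀ j, j ≠ i → u j = 0 := fun j hj => by
    have := congrArg (fun v => ((v j : gr j) : B)) hu
    refine Subtype.ext (ht _ ?_)
    rw [DirectSum.lof_eq_of, DirectSum.of_eq_of_ne _ _ _ hj] at this
    exact this
  have hui : u = DirectSum.lof R ℤ (fun i => gr i) i (u i) := by
    refine DFinsupp.ext fun j => ?_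
    by_cases hj : j = i
    · subst hj
      exact (DirectSum.of_eq_same (β := fun i => gr i) _ _).symm
    · rw [h0 j hj]
      exact (DirectSum.of_eq_of_ne (β := fun i => gr i) _ _ _ hj).symm
  rw [hui, grEquiv_lof]
  exact (u i).2

theorem exists_bilinear_smul_eq {t : R} (ht : ∀ b : B, t • b = 0 → b = 0) (c : B →ₗ[R] B →ₗ[R] B)
    (hc : ∀ x y, ∃ z, c x y = t • z) : ∃ f : B →ₗ[R] B →ₗ[R] B, ∀ x y, t • f x y = c x y := by
  choose f hf using hc
  have inj : ∀ x y : B, t • x = t • y → x = y := fun x y h =>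
    sub_eq_zero.mp (ht _ (by rw [smul_sub, h, sub_self]))
  refine ⟨LinearMap.mk₂ R f ?_ ?_ ?_ ?_, fun x y => (hf x y).symm⟩
  · exact fun x x' y => inj _ _ (by simp [← hf, smul_add])
  · exact fun r x y => inj _ _ (by simp [← hf, smul_comm t r])
  · exact fun x y y' => inj _ _ (by simp [← hf, smul_add])
  · exact fun r x y => inj _ _ (by simp [← hf, smul_comm t r])

/-- The commutator of homogeneous elements, as a bilinear map. -/
def commutator (D : DGA R B) : B →ₗ[R] B →ₗ[R] B := D.mul - koszulOp D.gr D.internal D.mul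

theorem commutator_apply (D : DGA R B) {i j : ℤ} {x y : B} (hx : x ∈ D.gr i) (hy : y ∈ D.gr j) :
    commutator D x y = D.mul x y - (i * j).negOnePow • D.mul y x := by
  rw [commutator, LinearMap.sub_apply, LinearMap.sub_apply, koszulOp_apply _ _ hx hy]

theorem exists_commutator_eq (D : DGA R B) {t : R} (h : ∀ i j u v, u ∈ D.gr i → v ∈ D.gr j →
    ∃ w, D.mul u v - (i * j).negOnePow • D.mul v u = t • w) (x y : B) :
    ∃ z, commutator D x y = t • z := by
  refine homogeneous_induction D.internal (C := fun x => ∃ z, commutator D x y = t • z) ?_ ?_ x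
  · intro i x hx
    refine homogeneous_induction D.internal (C := fun y => ∃ z, commutator D x y = t • z) ?_ ?_ y
    · intro j y hy
      rw [commutator_apply D hx hy]
      exact h i j x y hx hy
    · rintro y y' ⟨z, hz⟩ ⟨z', hz'⟩
      exact ⟨z + z', by rw [map_add, hz, hz', smul_add]⟩
  · rintro x x' ⟨z, hz⟩ ⟨z', hz'⟩
    exact ⟨z + z', by rw [map_add, LinearMap.add_apply, hz, hz', smul_add]⟩

/-- The opposite of a tensor square is the tensor square of the opposite. Hence the comultiplication
is also multiplicative for the opposite products (`comul_koszulOp`). -/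
theorem koszulOp_tensorOp (D : DGA R B) {i j : ℤ} {ξ η : B ⊗[R] B} (hξ : ξ ∈ tensorGr D.gr i)
    (hη : η ∈ tensorGr D.gr j) : (i * j).negOnePow • tensorOp D.gr D.internal D.mul D.mul η ξ =
      tensorOp D.gr D.internal (koszulOp D.gr D.internal D.mul) (koszulOp D.gr D.internal D.mul)
        ξ η := by
  refine tensorGr_induction (C := fun ξ => (i * j).negOnePow • tensorOp D.gr D.internal D.mul D.mul η ξ =
      tensorOp D.gr D.internal (koszulOp D.gr D.internal D.mul) (koszulOp D.gr D.internal D.mul)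
        ξ η) (by simp) ?_
        (fun x y hx hy => by simp only [map_add, LinearMap.add_apply, smul_add, hx, hy]) hξ
  rintro p p' x x' hx hx' rfl
  refine tensorGr_induction (C := fun η => ((p + p') * j).negOnePow •
      tensorOp D.gr D.internal D.mul D.mul η (x ⊗ₜ x') =
      tensorOp D.gr D.internal (koszulOp D.gr D.internal D.mul) (koszulOp D.gr D.internal D.mul)
        (x ⊗ₜ x') η) (by simp) ?_
        (fun x y hx hy => by simp only [map_add, LinearMap.add_apply, smul_add, hx, hy]) hη
  rintro q q' y y' hy hy' rfl
  rw [tensorOp_tmul _ _ _ _ _ hy' hx, tensorOp_tmul _ _ _ _ _ hx' hy, koszulOp_apply _ _ hx hy,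
    koszulOp_apply _ _ hx' hy', units_smul_tmul_left, units_smul_tmul_right, smul_smul, smul_smul,
    smul_smul, ← Int.negOnePow_add, ← Int.negOnePow_add, ← Int.negOnePow_add]
  congr 1
  exact negOnePow_congr ⟨p * q', by ring⟩

theorem comul_koszulOp (D : DGBialgebra R B) (x y : B) :
    D.coalg.comul (koszulOp D.gr D.internal D.mul x y) =
      tensorOp D.gr D.internal (koszulOp D.gr D.internal D.mul) (koszulOp D.gr D.internal D.mul)
        (D.coalg.comul x) (D.coalg.comul y) := by
  induction x using homogeneous_induction D.internal with
  | add x x' hx hx' => simp only [map_add, LinearMap.add_apply, hx, hx']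
  | hom i x hx =>
  induction y using homogeneous_induction D.internal with
  | add y y' hy hy' => simp only [map_add, hy, hy']
  | hom j y hy =>
  rw [koszulOp_apply _ _ hx hy, map_units_smul, D.comul_mul,
    koszulOp_tensorOp D.toDGA (D.comul_mem i x hx) (D.comul_mem j y hy)]

/-- Write `m` for the product and `m°` for its opposite: `(m - m°) ⊗ m° + m ⊗ (m - m°) = m ⊗ m - m°
⊗ m°`. This is why the bracket on the tensor square has the opposite product in one summand, and why
it is the commutator of the tensor square divided by `t`. -/
theorem smul_tensorOp_bracket (D : DGA R B) {t : R} {br : B →ₗ[R] B →ₗ[R] B}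
    (hbr : ∀ x y, t • br x y = commutator D x y) (ξ η : B ⊗[R] B) :
    t • (tensorOp D.gr D.internal br (koszulOp D.gr D.internal D.mul) +
        tensorOp D.gr D.internal D.mul br) ξ η =
      tensorOp D.gr D.internal D.mul D.mul ξ η -
        tensorOp D.gr D.internal (koszulOp D.gr D.internal D.mul) (koszulOp D.gr D.internal D.mul)
          ξ η := by
  induction ξ using tensor_induction_homogeneous D.internal with
  | zero => simp
  | add x y hx hy =>
    rw [map_add, LinearMap.add_apply, smul_add, hx, hy, map_add, map_add, LinearMap.add_apply,
      LinearMap.add_apply]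
    abel
  | hom p p' x x' hx hx' =>
  induction η using tensor_induction_homogeneous D.internal with
  | zero => simp
  | add x y hx hy =>
    simp only [map_add, smul_add, hx, hy]
    abel
  | hom q q' y y' hy hy' =>
    rw [LinearMap.add_apply, LinearMap.add_apply, tensorOp_tmul _ _ _ _ _ hx' hy,
      tensorOp_tmul _ _ _ _ _ hx' hy, tensorOp_tmul _ _ _ _ _ hx' hy,
      tensorOp_tmul _ _ _ _ _ hx' hy, ← smul_add, smul_comm t, ← smul_sub]
    congr 1
    rw [smul_add, TensorProduct.smul_tmul', ← TensorProduct.tmul_smul, hbr, hbr, commutator,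
      LinearMap.sub_apply, LinearMap.sub_apply, LinearMap.sub_apply, LinearMap.sub_apply,
      TensorProduct.sub_tmul, TensorProduct.tmul_sub]
    abel

end BracketOfCommutator

/-! ### The `𝔹𝔻₁`-axioms from identities between commutators -/

section BD1

variable {k : Type*} [Field k] {B : Type*} [AddCommGroup B] [Module k⟦X⟧ B]

/-- The `𝔹𝔻₁`-structure on a dg bialgebra with the bracket given by dividing the commutator. -/
def DGBialgebra.toBD1Bialgebra (D : DGBialgebra k⟦X⟧ B)
    (hB : ∀ b : B, (PowerSeries.X : k⟦X⟧) • b = 0 → b = 0)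
    (hBB : ∀ b : B ⊗[k⟦X⟧] B, (PowerSeries.X : k⟦X⟧) • b = 0 → b = 0)
    (br : B →ₗ[k⟦X⟧] B →ₗ[k⟦X⟧] B)
    (hbr : ∀ x y, (PowerSeries.X : k⟦X⟧) • br x y = commutator D.toDGA x y) :
    BD1Bialgebra k B := by
  have inj : ∀ x y : B, (PowerSeries.X : k⟦X⟧) • x = (PowerSeries.X : k⟦X⟧) • y → x = y :=
    fun x y h => sub_eq_zero.mp (hB _ (by rw [smul_sub, h, sub_self]))
  have hh : ∀ {i j : ℤ} {x y : B}, x ∈ D.gr i → y ∈ D.gr j → (PowerSeries.X : k⟦X⟧) • br x y =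
      D.mul x y - (i * j).negOnePow • D.mul y x := fun hx hy => by
    rw [hbr, commutator_apply _ hx hy]
  have hmem : ∀ i j x y, x ∈ D.gr i → y ∈ D.gr j → br x y ∈ D.gr (i + j) := fun i j x y hx hy => by
    refine mem_gr_of_smul_mem D.internal hB ?_
    rw [hh hx hy, Units.smul_def]
    have := D.mul_mem _ _ _ _ hy hx
    rw [add_comm] at this
    exact sub_mem (D.mul_mem _ _ _ _ hx hy) (zsmul_mem this _)
  exact
  { D with
    bracket := br
    bracket_mem := hmem
    bracket_symm := fun i j x y hx hy => inj _ _ <| by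
      rw [smul_neg, smul_comm, hh hx hy, hh hy hx, mul_comm j i, smul_sub, smul_smul,
        Int.units_mul_self, one_smul, neg_sub]
    jacobi := fun i j x y z hx hy => by
      induction z using homogeneous_induction D.internal with
      | add z z' hz hz' =>
        simp only [map_add, smul_add, hz, hz']
        abel
      | hom l z hz =>
      -- After multiplication by `ħ²` this is the graded Jacobi identity for commutators in an
      -- associative algebra.
      refine inj _ _ (inj _ _ ?_)
      have hmul := fun {i j x y} hx hy => D.mul_mem i j x y hx hy
      have e1 : (PowerSeries.X : k⟦X⟧) • (PowerSeries.X : k⟦X⟧) • br x (br y z) =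
          commutator D.toDGA x (commutator D.toDGA y z) := by
        rw [← hbr, ← hbr, map_smul]
      have e2 : (PowerSeries.X : k⟦X⟧) • (PowerSeries.X : k⟦X⟧) • br (br x y) z =
          commutator D.toDGA (commutator D.toDGA x y) z := by
        rw [← hbr, ← hbr, map_smul, LinearMap.smul_apply]
      have e3 : (PowerSeries.X : k⟦X⟧) • (PowerSeries.X : k⟦X⟧) • br y (br x z) =
          commutator D.toDGA y (commutator D.toDGA x z) := by
        rw [← hbr, ← hbr, map_smul]
      rw [smul_add, smul_add, smul_comm _ (Int.negOnePow _), smul_comm _ (Int.negOnePow _), e1, e2,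
        e3, commutator_apply _ hx hy, commutator_apply _ hy hz, commutator_apply _ hx hz, map_sub,
        map_sub, map_sub, LinearMap.sub_apply, map_units_smul, map_units_smul₂, map_units_smul,
        commutator_apply _ hx (hmul hy hz), commutator_apply _ hx (hmul hz hy),
        commutator_apply _ (hmul hx hy) hz, commutator_apply _ (hmul hy hx) hz,
        commutator_apply _ hy (hmul hx hz), commutator_apply _ hy (hmul hz hx)]
      simp only [D.mul_assoc, mul_add, add_mul, Int.negOnePow_add, mul_comm j i]
      generalize (i * j).negOnePow = a
      generalize (i * l).negOnePow = b
      generalize (j * l).negOnePow = c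
      -- All signs are products of the three signs of pairs, which leaves eight ungraded identities.
      rcases Int.units_eq_one_or a with rfl | rfl <;> rcases Int.units_eq_one_or b with rfl | rfl <;>
        rcases Int.units_eq_one_or c with rfl | rfl <;> simp <;> abel
    d_bracket := fun i x y hx => by
      induction y using homogeneous_induction D.internal with
      | add y y' hy hy' =>
        simp only [map_add, smul_add, hy, hy']
        abel
      | hom j y hy =>
      refine inj _ _ ?_
      rw [smul_add, smul_comm _ (Int.negOnePow _), hh (D.d_mem _ _ hx) hy, hh hx (D.d_mem _ _ hy),
        ← map_smul, hh hx hy, map_sub, map_units_smul, D.d_mul _ _ _ hx, D.d_mul _ _ _ hy]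
      rw [add_mul, Int.one_mul, mul_add, Int.mul_one, Int.negOnePow_add, Int.negOnePow_add]
      generalize (i * j).negOnePow = a
      generalize i.negOnePow = b
      generalize j.negOnePow = c
      rcases Int.units_eq_one_or a with rfl | rfl <;> rcases Int.units_eq_one_or b with rfl | rfl <;>
        rcases Int.units_eq_one_or c with rfl | rfl <;> simp <;> abel
    hbar_bracket := fun i j x y hx hy => hh hx hy
    leibniz := fun i j x y z hx hy => by
      induction z using homogeneous_induction D.internal with
      | add z z' hz hz' =>
        simp only [map_add, smul_add, hz, hz']
        abel
      | hom l z hz =>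
      refine inj _ _ ?_
      have e : (PowerSeries.X : k⟦X⟧) • D.mul (br x y) z =
          D.mul ((PowerSeries.X : k⟦X⟧) • br x y) z := by rw [map_smul, LinearMap.smul_apply]
      rw [smul_add, smul_comm _ (Int.negOnePow _), e, ← map_smul (D.mul y), hh hx hy, hh hx hz, hh hx (D.mul_mem _ _ _ _ hy hz), map_sub, map_sub, LinearMap.sub_apply,
        map_units_smul₂, map_units_smul]
      simp only [D.mul_assoc, mul_add, Int.negOnePow_add]
      generalize (i * j).negOnePow = a
      generalize (i * l).negOnePow = b
      rcases Int.units_eq_one_or a with rfl | rfl <;> rcases Int.units_eq_one_or b with rfl | rfl <;>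
        simp [sub_eq_add_neg]
    comul_bracket := fun x y => by
      -- After multiplication by `ħ` in the tensor square, both sides are the coproduct of the
      -- commutator.
      refine sub_eq_zero.mp (hBB _ ?_)
      rw [smul_sub, smul_tensorOp_bracket D.toDGA hbr, ← map_smul, hbr, commutator,
        LinearMap.sub_apply, LinearMap.sub_apply, map_sub, D.comul_mul, comul_koszulOp, sub_self] }

end BD1

/-! ### Shuffles -/

section LinearExtensions

variable {I J : Type*}

/-- Extend an enumeration of `J` to an enumeration of `Option J`, with `none` at the end. -/
def snocEquiv {N : ℕ} (ψ : Option J ≃ I) (τ : Fin N ≃ J) : Fin (N + 1) ≃ I :=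
  finSuccEquivLast.trans (τ.optionCongr.trans ψ)

variable {N : ℕ} (ψ : Option J ≃ I) (τ : Fin N ≃ J)

@[simp]
theorem snocEquiv_last : snocEquiv ψ τ (Fin.last N) = ψ none := by
  simp [snocEquiv]

@[simp]
theorem snocEquiv_castSucc (u : Fin N) : snocEquiv ψ τ u.castSucc = ψ (some (τ u)) := by
  simp [snocEquiv]

@[simp]
theorem snocEquiv_symm_none : (snocEquiv ψ τ).symm (ψ none) = Fin.last N := by
  rw [Equiv.symm_apply_eq, snocEquiv_last]

@[simp]
theorem snocEquiv_symm_some (j : J) :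
    (snocEquiv ψ τ).symm (ψ (some j)) = (τ.symm j).castSucc := by
  rw [Equiv.symm_apply_eq, snocEquiv_castSucc, Equiv.apply_symm_apply]

variable [Fintype I] [DecidableEq I] [Fintype J] [DecidableEq J]

theorem sum_snocEquiv {M : Type*} [AddCommMonoid M] (F : (Fin (N + 1) ≃ I) → M) :
    ∑ σ : Fin (N + 1) ≃ I, (if σ (Fin.last N) = ψ none then F σ else 0) =
      ∑ τ : Fin N ≃ J, F (snocEquiv ψ τ) := by
  rw [← Finset.sum_filter]
  symm
  refine Finset.sum_bij (fun τ _ => snocEquiv ψ τ) ?_ ?_ ?_ ?_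
  · intro τ _
    simp
  · intro τ _ τ' _ h
    refine Equiv.ext fun u => ?_
    have := congrArg (fun σ => σ u.castSucc) h
    simpa using this
  · intro σ hσ
    simp only [Finset.mem_filter, Finset.mem_univ, true_and] at hσ
    have he : ((finSuccEquivLast.symm.trans σ).trans ψ.symm) none = none := by simp [hσ]
    refine ⟨Equiv.removeNone ((finSuccEquivLast.symm.trans σ).trans ψ.symm), by simp, ?_⟩
    refine Equiv.ext fun u => ?_
    induction u using Fin.lastCases with
    | last => simp [hσ]
    | cast u =>
      rw [snocEquiv_castSucc, Equiv.removeNone_some]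
      · simp
      · refine Option.ne_none_iff_exists'.mp fun h => ?_
        rw [← he] at h
        simpa using (Equiv.injective _ h)
  · exact fun _ _ => rfl

variable {R : Type*} [CommRing R] {A : Type*} [AddCommGroup A] [Module R A]

local notation "ιT" => TensorAlgebra.ι R

open Classical in
/-- The sum of the words in the letters `z i`, over all enumerations of `I` compatible with `r`,
with the sign given by the weights of the pairs of letters. -/
def linExt (R : Type*) [CommRing R] {A : Type*} [AddCommGroup A] [Module R A] (N : ℕ)
    (r : I → I → Prop) (w : I → I → ℤ) (z : I → A) : TensorAlgebra R A :=
  ∑ σ : Fin N ≃ I, if ∀ i j, r i j → σ.symm i < σ.symm j then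
    (∑ u, ∑ v ∈ Finset.univ.filter (u < ·), w (σ u) (σ v)).negOnePow • word R (z ∘ σ) else 0

open Classical in
/-- The part of `linExt` in which the last letter is `z i`. -/
def linExtPart (R : Type*) [CommRing R] {A : Type*} [AddCommGroup A] [Module R A] (N : ℕ)
    (r : I → I → Prop) (w : I → I → ℤ) (z : I → A) (i : I) : TensorAlgebra R A :=
  ∑ σ : Fin (N + 1) ≃ I, if σ (Fin.last N) = i then
    (if ∀ i j, r i j → σ.symm i < σ.symm j then
      (∑ u, ∑ v ∈ Finset.univ.filter (u < ·), w (σ u) (σ v)).negOnePow • word R (z ∘ σ) else 0)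
    else 0

theorem sum_snoc_lt {N : ℕ} (w : Fin (N + 1) → Fin (N + 1) → ℤ) :
    ∑ u, ∑ v ∈ Finset.univ.filter (u < ·), w u v =
      ∑ u : Fin N, ∑ v ∈ Finset.univ.filter (u < ·), w u.castSucc v.castSucc +
        ∑ u : Fin N, w u.castSucc (Fin.last N) := by
  simp only [Finset.sum_filter]
  rw [Fin.sum_univ_castSucc]
  have : ∑ v, (if Fin.last N < v then w (Fin.last N) v else 0) = 0 :=
    Finset.sum_eq_zero fun v _ => if_neg (not_lt.mpr (Fin.le_last v))
  rw [this, add_zero, ← Finset.sum_add_distrib]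
  refine Finset.sum_congr rfl fun u _ => ?_
  rw [Fin.sum_univ_castSucc]
  simp [Fin.castSucc_lt_last]

/-- Deleting the last letter is a bijection onto the enumerations of the remaining letters. As `ψ
none` is maximal for `r`, it imposes no other condition; the sign splits off its pairs with all
other letters. -/
theorem linExtPart_eq (r : I → I → Prop) (w : I → I → ℤ) (z : I → A)
    (hmax : ∀ i, ¬ r (ψ none) i) :
    linExtPart R N r w z (ψ none) =
      (∑ j, w (ψ (some j)) (ψ none)).negOnePow •
        (linExt R N (fun i j => r (ψ (some i)) (ψ (some j)))
          (fun i j => w (ψ (some i)) (ψ (some j))) (fun j => z (ψ (some j))) * ιT (z (ψ none))) := by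
  rw [linExtPart, sum_snocEquiv, linExt, Finset.sum_mul, Finset.smul_sum]
  refine Finset.sum_congr rfl fun τ _ => ?_
  have hiff : (∀ i j, r i j → (snocEquiv ψ τ).symm i < (snocEquiv ψ τ).symm j) ↔
      ∀ i j, r (ψ (some i)) (ψ (some j)) → τ.symm i < τ.symm j := by
    constructor
    · intro h i j hij
      simpa using h _ _ hij
    · intro h i j hij
      obtain ⟨i, rfl⟩ := ψ.surjective i
      obtain ⟨j, rfl⟩ := ψ.surjective j
      cases i with
      | none => exact absurd hij (hmax _)
      | some i =>
        cases j with
        | none => simp [Fin.castSucc_lt_last]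
        | some j => simpa using h i j hij
  by_cases h : ∀ i j, r (ψ (some i)) (ψ (some j)) → τ.symm i < τ.symm j
  · rw [if_pos h, if_pos (hiff.mpr h), sum_snoc_lt, word_succ]
    simp only [snocEquiv_castSucc, snocEquiv_last, Function.comp_def]
    rw [Equiv.sum_comp τ (fun j => w (ψ (some j)) (ψ none)), add_comm, Int.negOnePow_add, mul_smul,
      smul_mul_assoc]
  · rw [if_neg h, if_neg (hiff.not.mpr h), zero_mul, smul_zero]

/-- A letter with something above it cannot come last, so it suffices to sum over a set containing
the maximal letters. -/
theorem linExt_succ_eq_sum (r : I → I → Prop) (w : I → I → ℤ) (z : I → A) (S : Finset I)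
    (hS : ∀ i, i ∉ S → ∃ j, r i j) :
    linExt R (N + 1) r w z = ∑ i ∈ S, linExtPart R N r w z i := by
  simp only [linExtPart]
  rw [linExt, Finset.sum_comm]
  refine Finset.sum_congr rfl fun σ _ => ?_
  rw [Finset.sum_ite_eq]
  split_ifs with h1 h2 h2
  · rfl
  · obtain ⟨j, hj⟩ := hS _ h2
    have := h1 _ _ hj
    rw [Equiv.symm_apply_apply] at this
    exact absurd this (not_lt.mpr (Fin.le_last _))
  · rfl
  · rfl

end LinearExtensions

/-! ### Shuffles as linear extensions of two disjoint chains -/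

section Shuffles

variable {R : Type*} [CommRing R] {A : Type*} [AddCommGroup A] [Module R A]

local notation "ιT" => TensorAlgebra.ι R

/-- The order of the letters in a shuffle. -/
abbrev shuffleRel (n m : ℕ) : Fin n ⊕ Fin m → Fin n ⊕ Fin m → Prop :=
  Sum.LiftRel (· < ·) (· < ·)

/-- The exponent of the Koszul sign for a pair of letters of a shuffle. -/
def shuffleWeight {n m : ℕ} (a : Fin n → ℤ) (b : Fin m → ℤ) (s s' : Fin n ⊕ Fin m) : ℤ :=
  if finSumFinEquiv s' < finSumFinEquiv s then (Sum.elim a b s - 1) * (Sum.elim a b s' - 1) else 0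

section

variable {n m : ℕ} (a : Fin n → ℤ) (b : Fin m → ℤ)

@[simp]
theorem shuffleWeight_inl_inl (p p' : Fin n) : shuffleWeight a b (.inl p) (.inl p') =
    if p' < p then (a p - 1) * (a p' - 1) else 0 := by
  rw [shuffleWeight, finSumFinEquiv_apply_left, finSumFinEquiv_apply_left]
  rfl

@[simp]
theorem shuffleWeight_inr_inr (q q' : Fin m) : shuffleWeight a b (.inr q) (.inr q') =
    if q' < q then (b q - 1) * (b q' - 1) else 0 := by
  simp [shuffleWeight]

@[simp]
theorem shuffleWeight_inl_inr (p : Fin n) (q : Fin m) :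
    shuffleWeight a b (.inl p) (.inr q) = 0 := by
  refine if_neg (not_lt.mpr ?_)
  rw [finSumFinEquiv_apply_left, finSumFinEquiv_apply_right, Fin.le_def]
  simp only [Fin.val_castAdd, Fin.val_natAdd]
  omega

@[simp]
theorem shuffleWeight_inr_inl (q : Fin m) (p : Fin n) :
    shuffleWeight a b (.inr q) (.inl p) = (b q - 1) * (a p - 1) := by
  refine if_pos ?_
  rw [finSumFinEquiv_apply_left, finSumFinEquiv_apply_right, Fin.lt_def]
  simp only [Fin.val_castAdd, Fin.val_natAdd]
  omega

end

/-- Enumerating `Fin n ⊕ Fin m` instead of permuting `Fin (n + m)` lets the last letter of either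
word be removed without renumbering. -/
theorem shuffleProd_eq_linExt {n m : ℕ} (a : Fin n → ℤ) (b : Fin m → ℤ) (x : Fin n → A)
    (y : Fin m → A) : shuffleProd R a b x y =
      linExt R (n + m) (shuffleRel n m) (shuffleWeight a b) (Sum.elim x y) := by
  rw [shuffleProd, linExt, Finset.sum_filter]
  refine Fintype.sum_equiv (Equiv.equivCongr (Equiv.refl _) finSumFinEquiv.symm) _ _ fun σ => ?_
  have hword : (Sum.elim x y ∘ (Equiv.equivCongr (Equiv.refl _) finSumFinEquiv.symm) σ) =
      Fin.append x y ∘ σ := by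
    funext u
    simp only [Function.comp_apply, Equiv.equivCongr_apply_apply, Equiv.refl_symm, Equiv.refl_apply]
    generalize σ u = v
    induction v using Fin.addCases <;> simp
  have hdeg : ∀ v, Sum.elim a b (finSumFinEquiv.symm v) = Fin.append a b v := fun v => by
    induction v using Fin.addCases <;> simp
  have hexp : (∑ u : Fin (n + m), ∑ v ∈ Finset.univ.filter (fun v => u < v ∧ σ v < σ u),
      (Fin.append a b (σ u) - 1) * (Fin.append a b (σ v) - 1)) =
      ∑ u, ∑ v ∈ Finset.univ.filter (u < ·), shuffleWeight a b
        ((Equiv.equivCongr (Equiv.refl _) finSumFinEquiv.symm) σ u)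
        ((Equiv.equivCongr (Equiv.refl _) finSumFinEquiv.symm) σ v) := by
    refine Finset.sum_congr rfl fun u _ => ?_
    rw [Finset.sum_filter, Finset.sum_filter]
    refine Finset.sum_congr rfl fun v _ => ?_
    simp only [shuffleWeight, Equiv.equivCongr_apply_apply, Equiv.refl_symm, Equiv.refl_apply,
      Equiv.apply_symm_apply, hdeg]
    split_ifs <;> simp_all
  have hiff : ((∀ p p' : Fin n, p < p' → σ.symm (Fin.castAdd m p) < σ.symm (Fin.castAdd m p')) ∧
        ∀ q q' : Fin m, q < q' → σ.symm (Fin.natAdd n q) < σ.symm (Fin.natAdd n q')) ↔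
      ∀ s s', shuffleRel n m s s' →
        ((Equiv.equivCongr (Equiv.refl _) finSumFinEquiv.symm) σ).symm s <
          ((Equiv.equivCongr (Equiv.refl _) finSumFinEquiv.symm) σ).symm s' := by
    simp [Sum.forall]
  rw [hword, ← hexp]
  by_cases h : ∀ s s', shuffleRel n m s s' →
      ((Equiv.equivCongr (Equiv.refl _) finSumFinEquiv.symm) σ).symm s <
        ((Equiv.equivCongr (Equiv.refl _) finSumFinEquiv.symm) σ).symm s'
  · rw [if_pos h, if_pos (hiff.mpr h)]
  · rw [if_neg h, if_neg (hiff.not.mpr h)]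

/-- All letters but the last one of the first word. -/
def initLeft (n m : ℕ) : Option (Fin n ⊕ Fin m) ≃ Fin (n + 1) ⊕ Fin m :=
  Equiv.ofBijective (fun o => o.elim (Sum.inl (Fin.last n)) (Sum.map Fin.castSucc id)) <| by
    constructor
    · rintro (_ | _ | _) (_ | _ | _) h <;> simp_all [Fin.ext_iff] <;> omega
    · rintro (p | q)
      · induction p using Fin.lastCases with
        | last => exact ⟨none, rfl⟩
        | cast p => exact ⟨some (.inl p), rfl⟩
      · exact ⟨some (.inr q), rfl⟩

/-- All letters but the last one of the second word. -/
def initRight (n m : ℕ) : Option (Fin n ⊕ Fin m) ≃ Fin n ⊕ Fin (m + 1) :=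
  Equiv.ofBijective (fun o => o.elim (Sum.inr (Fin.last m)) (Sum.map id Fin.castSucc)) <| by
    constructor
    · rintro (_ | _ | _) (_ | _ | _) h <;> simp_all [Fin.ext_iff] <;> omega
    · rintro (p | q)
      · exact ⟨some (.inl p), rfl⟩
      · induction q using Fin.lastCases with
        | last => exact ⟨none, rfl⟩
        | cast q => exact ⟨some (.inr q), rfl⟩

@[simp]
theorem initLeft_none (n m : ℕ) : initLeft n m none = .inl (Fin.last n) := rfl

@[simp]
theorem initLeft_some (n m : ℕ) (s : Fin n ⊕ Fin m) :
    initLeft n m (some s) = s.map Fin.castSucc id := rfl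

@[simp]
theorem initRight_none (n m : ℕ) : initRight n m none = .inr (Fin.last m) := rfl

@[simp]
theorem initRight_some (n m : ℕ) (s : Fin n ⊕ Fin m) :
    initRight n m (some s) = s.map id Fin.castSucc := rfl

theorem linExtPart_initLeft {N n m : ℕ} (a : Fin (n + 1) → ℤ) (b : Fin m → ℤ) (x : Fin (n + 1) → A)
    (y : Fin m → A) :
    linExtPart R N (shuffleRel (n + 1) m) (shuffleWeight a b) (Sum.elim x y) (.inl (Fin.last n)) =
      ((a (Fin.last n) - 1) * ∑ q, (b q - 1)).negOnePow •
        (linExt R N (shuffleRel n m) (shuffleWeight (fun p => a p.castSucc) b)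
          (Sum.elim (fun p => x p.castSucc) y) * ιT (x (Fin.last n))) := by
  refine (linExtPart_eq (initLeft n m) (shuffleRel (n + 1) m) (shuffleWeight a b) (Sum.elim x y)
    ?_).trans ?_
  · rintro (p | q) h
    · exact absurd (Sum.liftRel_inl_inl.mp h) (not_lt.mpr (Fin.le_last p))
    · exact Sum.not_liftRel_inl_inr h
  · congr 2
    · rw [Fintype.sum_sum_type, Finset.mul_sum]
      have h1 : ∀ p : Fin n, ¬ Fin.last n < p.castSucc := fun p => not_lt.mpr (Fin.le_last _)
      simp [h1, mul_comm]
    · congr 1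
      · funext s s'
        rcases s with p | q <;> rcases s' with p' | q' <;> simp
      · funext s s'
        rcases s with p | q <;> rcases s' with p' | q' <;> simp
      · funext s
        rcases s with p | q <;> simp

theorem linExtPart_initRight {N n m : ℕ} (a : Fin n → ℤ) (b : Fin (m + 1) → ℤ) (x : Fin n → A)
    (y : Fin (m + 1) → A) :
    linExtPart R N (shuffleRel n (m + 1)) (shuffleWeight a b) (Sum.elim x y) (.inr (Fin.last m)) =
      linExt R N (shuffleRel n m) (shuffleWeight a fun q => b q.castSucc)
          (Sum.elim x fun q => y q.castSucc) * ιT (y (Fin.last m)) := by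
  refine (linExtPart_eq (initRight n m) (shuffleRel n (m + 1)) (shuffleWeight a b) (Sum.elim x y)
    ?_).trans ?_
  · rintro (p | q) h
    · exact Sum.not_liftRel_inr_inl h
    · exact absurd (Sum.liftRel_inr_inr.mp h) (not_lt.mpr (Fin.le_last q))
  · have h1 : ∀ s, shuffleWeight a b (initRight n m (some s)) (initRight n m none) = 0 := by
      rintro (p | q)
      · simp
      · simp [(Fin.castSucc_lt_last q).le]
    simp only [h1, Finset.sum_const_zero, Int.negOnePow_zero, one_smul]
    congr 1
    · congr 1
      · funext s s'
        rcases s with p | q <;> rcases s' with p' | q' <;> simp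
      · funext s s'
        rcases s with p | q <;> rcases s' with p' | q' <;> simp
      · funext s
        rcases s with p | q <;> simp

theorem linExt_shuffle_zero_right {N n : ℕ} (a : Fin n → ℤ) (b : Fin 0 → ℤ) (x : Fin n → A)
    (y : Fin 0 → A) (hN : N = n) :
    linExt R N (shuffleRel n 0) (shuffleWeight a b) (Sum.elim x y) = word R x := by
  subst hN
  induction N with
  | zero =>
    rw [linExt, Fintype.sum_eq_single (Equiv.equivOfIsEmpty _ _) (fun σ h => absurd (Subsingleton.elim _ _) h)]
    simp
  | succ n ih =>
    rw [linExt_succ_eq_sum _ _ _ {.inl (Fin.last n)}, Finset.sum_singleton, linExtPart_initLeft, ih,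
      word_succ x]
    · simp
    · rintro (p | q) h
      · exact ⟨.inl (Fin.last n), Sum.liftRel_inl_inl.mpr (Fin.lt_last_iff_ne_last.mpr (by simpa using h))⟩
      · exact q.elim0

theorem linExt_shuffle_zero_left {N m : ℕ} (a : Fin 0 → ℤ) (b : Fin m → ℤ) (x : Fin 0 → A)
    (y : Fin m → A) (hN : N = m) :
    linExt R N (shuffleRel 0 m) (shuffleWeight a b) (Sum.elim x y) = word R y := by
  subst hN
  induction N with
  | zero =>
    rw [linExt, Fintype.sum_eq_single (Equiv.equivOfIsEmpty _ _) (fun σ h => absurd (Subsingleton.elim _ _) h)]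
    simp
  | succ m ih =>
    rw [linExt_succ_eq_sum _ _ _ {.inr (Fin.last m)}, Finset.sum_singleton, linExtPart_initRight, ih,
      word_succ y]
    · rintro (p | q) h
      · exact p.elim0
      · exact ⟨.inr (Fin.last m), Sum.liftRel_inr_inr.mpr (Fin.lt_last_iff_ne_last.mpr (by simpa using h))⟩

/-- The maximal letters are the last ones of the two words. The sign is that of moving the last `x`
past all of the `y`. -/
theorem linExt_shuffle_succ {N n m : ℕ} (a : Fin (n + 1) → ℤ) (b : Fin (m + 1) → ℤ)
    (x : Fin (n + 1) → A) (y : Fin (m + 1) → A) :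
    linExt R (N + 1) (shuffleRel (n + 1) (m + 1)) (shuffleWeight a b) (Sum.elim x y) =
      linExt R N (shuffleRel (n + 1) m) (shuffleWeight a fun q => b q.castSucc)
          (Sum.elim x fun q => y q.castSucc) * ιT (y (Fin.last m)) +
        ((a (Fin.last n) - 1) * ∑ q, (b q - 1)).negOnePow •
          (linExt R N (shuffleRel n (m + 1)) (shuffleWeight (fun p => a p.castSucc) b)
            (Sum.elim (fun p => x p.castSucc) y) * ιT (x (Fin.last n))) := by
  rw [linExt_succ_eq_sum _ _ _ {.inr (Fin.last m), .inl (Fin.last n)},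
    Finset.sum_pair (by simp), linExtPart_initLeft, linExtPart_initRight]
  rintro (p | q) h
  · exact ⟨.inl (Fin.last n), Sum.liftRel_inl_inl.mpr (Fin.lt_last_iff_ne_last.mpr (by simpa using h))⟩
  · exact ⟨.inr (Fin.last m), Sum.liftRel_inr_inr.mpr (Fin.lt_last_iff_ne_last.mpr (by simpa using h))⟩

end Shuffles

/-! ### Shuffle products and Poisson brackets of lists of letters -/

section Letters

variable {A : Type*}

/-- The list of the letters `x p`, with their degrees. -/
def letters {n : ℕ} (a : Fin n → ℤ) (x : Fin n → A) : List (ℤ × A) := List.ofFn fun p => (a p, x p)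

/-- The degree of a word, given by the list of its letters with their degrees. -/
def shiftedDegree (l : List (ℤ × A)) : ℤ := (l.map fun z => z.1 - 1).sum

@[simp]
theorem shiftedDegree_append (l l' : List (ℤ × A)) :
    shiftedDegree (l ++ l') = shiftedDegree l + shiftedDegree l' := by
  simp [shiftedDegree]

@[simp]
theorem shiftedDegree_nil : shiftedDegree ([] : List (ℤ × A)) = 0 := rfl

@[simp]
theorem shiftedDegree_cons (z : ℤ × A) (l : List (ℤ × A)) :
    shiftedDegree (z :: l) = z.1 - 1 + shiftedDegree l := by
  simp [shiftedDegree]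

theorem shiftedDegree_reverse (l : List (ℤ × A)) : shiftedDegree l.reverse = shiftedDegree l := by
  simp [shiftedDegree]

theorem letters_succ {n : ℕ} (a : Fin (n + 1) → ℤ) (x : Fin (n + 1) → A) :
    letters a x = letters (fun p => a p.castSucc) (fun p => x p.castSucc) ++
      [(a (Fin.last n), x (Fin.last n))] := by
  rw [letters, List.ofFn_succ', List.concat_eq_append]
  rfl

@[simp]
theorem letters_zero (a : Fin 0 → ℤ) (x : Fin 0 → A) : letters a x = [] := by
  simp [letters]

theorem shiftedDegree_letters {n : ℕ} (a : Fin n → ℤ) (x : Fin n → A) :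
    shiftedDegree (letters a x) = ∑ p, (a p - 1) := by
  rw [shiftedDegree, letters, List.map_ofFn, List.sum_ofFn]
  rfl

theorem letters_after_castSucc {n : ℕ} (a : Fin (n + 1) → ℤ) (x : Fin (n + 1) → A) (i : Fin n) :
    letters (after a i.castSucc) (after x i.castSucc) =
      letters (after (fun p => a p.castSucc) i) (after (fun p => x p.castSucc) i) ++
        [(a (Fin.last n), x (Fin.last n))] := by
  have hi := i.isLt
  apply List.ext_getElem
  · simp [letters]
    omega
  · intro q h1 h2
    simp only [letters, List.length_ofFn, Fin.val_castSucc] at h1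
    rcases eq_or_lt_of_le (show q ≤ n - (i + 1) by omega) with h | h
    · rw [List.getElem_append_right (by simp [letters, h])]
      simp only [letters, List.getElem_ofFn, after, List.getElem_singleton, Fin.val_castSucc]
      congr 2 <;> exact Fin.ext (by simp; omega)
    · rw [List.getElem_append_left (by simpa [letters] using h)]
      simp only [letters, List.getElem_ofFn, after]
      rfl

theorem letters_before_castSucc {n : ℕ} (a : Fin (n + 1) → ℤ) (x : Fin (n + 1) → A) (i : Fin n) :
    letters (before a i.castSucc) (before x i.castSucc) =
      letters (before (fun p => a p.castSucc) i) (before (fun p => x p.castSucc) i) := rfl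

theorem letters_after_last {n : ℕ} (a : Fin (n + 1) → ℤ) (x : Fin (n + 1) → A) :
    letters (after a (Fin.last n)) (after x (Fin.last n)) = [] := by
  rw [← List.length_eq_zero_iff]
  simp [letters]

theorem shiftedDegree_before_after {n : ℕ} (a : Fin n → ℤ) (x : Fin n → A) (i : Fin n) :
    shiftedDegree (letters (before a i) (before x i)) + (a i - 1) +
      shiftedDegree (letters (after a i) (after x i)) = ∑ p, (a p - 1) := by
  induction n with
  | zero => exact i.elim0
  | succ n ih =>
    rw [Fin.sum_univ_castSucc]
    induction i using Fin.lastCases with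
    | last =>
      rw [letters_after_last, shiftedDegree_letters, shiftedDegree_nil, add_zero]
      rfl
    | cast i =>
      rw [letters_after_castSucc, shiftedDegree_append, ← add_assoc]
      exact congrArg₂ _ (ih (fun p => a p.castSucc) (fun p => x p.castSucc) i) (by simp)

end Letters

/-! ### Shuffle products and Poisson brackets by recursion on lists -/

section ShuffleLists

variable {R : Type*} [CommRing R] {A : Type*} [AddCommGroup A] [Module R A]

local notation "ιT" => TensorAlgebra.ι R

/-- The word with the given letters. -/
def lettersWord (R : Type*) [CommRing R] {A : Type*} [AddCommGroup A] [Module R A]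
    (l : List (ℤ × A)) : TensorAlgebra R A := listWord R (l.map Prod.snd)

/-- The shuffle product of two lists of letters, both in reverse order. -/
def shuffleRev (R : Type*) [CommRing R] {A : Type*} [AddCommGroup A] [Module R A] :
    List (ℤ × A) → List (ℤ × A) → TensorAlgebra R A
  -- In reverse order the head of a list is the last letter of the word, on which the recursion
  -- runs.
  | [], l' => lettersWord R l'.reverse
  | x :: l, [] => lettersWord R (x :: l).reverse
  | x :: l, y :: l' => shuffleRev R (x :: l) l' * TensorAlgebra.ι R y.2 +
      ((x.1 - 1) * shiftedDegree (y :: l')).negOnePow •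
        (shuffleRev R l (y :: l') * TensorAlgebra.ι R x.2)
termination_by l l' => l.length + l'.length

/-- The shuffle product of two lists of letters. -/
def shuffle (R : Type*) [CommRing R] {A : Type*} [AddCommGroup A] [Module R A]
    (l l' : List (ℤ × A)) : TensorAlgebra R A := shuffleRev R l.reverse l'.reverse

@[simp]
theorem shuffle_nil_left (l' : List (ℤ × A)) : shuffle R [] l' = lettersWord R l' := by
  rw [shuffle, List.reverse_nil, shuffleRev, List.reverse_reverse]

@[simp]
theorem shuffle_nil_right (l : List (ℤ × A)) : shuffle R l [] = lettersWord R l := by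
  rw [shuffle, List.reverse_nil]
  rcases h : l.reverse with _ | ⟨x, u⟩
  · rw [shuffleRev, List.reverse_eq_nil_iff.mp h]
    rfl
  · rw [shuffleRev, ← h, List.reverse_reverse]

theorem shuffle_append_singleton (l l' : List (ℤ × A)) (x y : ℤ × A) :
    shuffle R (l ++ [x]) (l' ++ [y]) = shuffle R (l ++ [x]) l' * ιT y.2 +
      ((x.1 - 1) * shiftedDegree (l' ++ [y])).negOnePow •
        (shuffle R l (l' ++ [y]) * ιT x.2) := by
  rw [shuffle, shuffle, shuffle, List.reverse_append, List.reverse_append, List.reverse_singleton,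
    List.reverse_singleton, List.singleton_append, List.singleton_append, shuffleRev,
    ← shiftedDegree_reverse (l' ++ [y])]
  simp

@[simp]
theorem lettersWord_append_singleton (l : List (ℤ × A)) (x : ℤ × A) :
    lettersWord R (l ++ [x]) = lettersWord R l * ιT x.2 := by
  simp [lettersWord, listWord_append]

@[simp]
theorem lettersWord_nil : lettersWord R ([] : List (ℤ × A)) = 1 := rfl

theorem lettersWord_letters {n : ℕ} (a : Fin n → ℤ) (x : Fin n → A) :
    lettersWord R (letters a x) = word R x := by
  rw [lettersWord, letters, List.map_ofFn, word_eq_listWord]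
  rfl

/-- Both sides satisfy the same recursion on last letters. With lists, the parts of a word before
and after a letter no longer have types depending on its position. -/
theorem linExt_eq_shuffle {N n m : ℕ} (hN : N = n + m) (a : Fin n → ℤ) (b : Fin m → ℤ)
    (x : Fin n → A) (y : Fin m → A) :
    linExt R N (shuffleRel n m) (shuffleWeight a b) (Sum.elim x y) =
      shuffle R (letters a x) (letters b y) := by
  induction N generalizing n m with
  | zero =>
    obtain rfl : n = 0 := by omega
    rw [linExt_shuffle_zero_left a b x y (by omega), letters_zero, shuffle_nil_left,
      lettersWord_letters]
  | succ N ih =>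
    match n, m with
    | 0, m =>
      rw [linExt_shuffle_zero_left a b x y (by omega), letters_zero, shuffle_nil_left,
        lettersWord_letters]
    | n + 1, 0 =>
      rw [linExt_shuffle_zero_right a b x y (by omega), letters_zero, shuffle_nil_right,
        lettersWord_letters]
    | n + 1, m + 1 =>
      rw [linExt_shuffle_succ, ih (by omega), ih (by omega), ← shiftedDegree_letters b y,
        letters_succ a x, letters_succ b y, shuffle_append_singleton]

theorem shuffleProd_eq_shuffle {n m : ℕ} (a : Fin n → ℤ) (b : Fin m → ℤ) (x : Fin n → A)
    (y : Fin m → A) : shuffleProd R a b x y = shuffle R (letters a x) (letters b y) := by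
  rw [shuffleProd_eq_linExt, linExt_eq_shuffle rfl]

/-- A term in the Poisson bracket of words. -/
def poissonTerm (br : A →ₗ[R] A →ₗ[R] A) (l : List (ℤ × A)) (z : ℤ × A) (u l' : List (ℤ × A))
    (z' : ℤ × A) (u' : List (ℤ × A)) : TensorAlgebra R A :=
  (z.1 + shiftedDegree l' * (z.1 - 1 + shiftedDegree u) + (z'.1 - 1) * shiftedDegree u).negOnePow •
    (shuffle R l l' * ιT (br z.2 z'.2) * shuffle R u u')

variable (br : A →ₗ[R] A →ₗ[R] A)

theorem poissonBracket_eq_sum {n m : ℕ} (a : Fin n → ℤ) (b : Fin m → ℤ) (x : Fin n → A)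
    (y : Fin m → A) : poissonBracket br a b x y =
      ∑ i, ∑ j, poissonTerm br (letters (before a i) (before x i)) (a i, x i)
        (letters (after a i) (after x i)) (letters (before b j) (before y j)) (b j, y j)
          (letters (after b j) (after y j)) := by
  refine Finset.sum_congr rfl fun i _ => Finset.sum_congr rfl fun j _ => ?_
  rw [poissonTerm, shiftedDegree_letters, shiftedDegree_letters, shuffleProd_eq_shuffle,
    shuffleProd_eq_shuffle]

section

variable (l l' u u' : List (ℤ × A)) (z z' x y : ℤ × A)

/-- Only the right-hand shuffle changes. The sign of its recursion combines with the prefactor to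
that of moving `x` past every letter of the second word. -/
theorem poissonTerm_append_append : poissonTerm br l z (u ++ [x]) l' z' (u' ++ [y]) =
    poissonTerm br l z (u ++ [x]) l' z' u' * ιT y.2 +
      ((x.1 - 1) * (shiftedDegree l' + (z'.1 - 1) + shiftedDegree (u' ++ [y]))).negOnePow •
        (poissonTerm br l z u l' z' (u' ++ [y]) * ιT x.2) := by
  rw [poissonTerm, poissonTerm, poissonTerm, shuffle_append_singleton,
    mul_add (shuffle R l l' * _), smul_add, smul_mul_assoc, ← mul_assoc, mul_smul_comm, ← mul_assoc, smul_mul_assoc, smul_smul, smul_smul,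
    ← Int.negOnePow_add, ← Int.negOnePow_add]
  congr 3
  simp only [shiftedDegree_append, shiftedDegree_cons, shiftedDegree_nil]
  ring

theorem poissonTerm_nil_append : poissonTerm br l z [] l' z' (u' ++ [y]) =
    poissonTerm br l z [] l' z' u' * ιT y.2 := by
  simp [poissonTerm, mul_assoc, smul_mul_assoc]

theorem poissonTerm_append_nil : poissonTerm br l z (u ++ [x]) l' z' [] =
    ((x.1 - 1) * (shiftedDegree l' + (z'.1 - 1))).negOnePow •
      (poissonTerm br l z u l' z' [] * ιT x.2) := by
  rw [poissonTerm, poissonTerm, shuffle_nil_right, shuffle_nil_right, lettersWord_append_singleton,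
    ← mul_assoc, smul_mul_assoc, smul_smul, ← Int.negOnePow_add]
  congr 2
  simp only [shiftedDegree_append, shiftedDegree_cons, shiftedDegree_nil]
  ring

end

/-- The last letter of a term is the last `y`, the last `x`, or the bracket of the two, the latter
only when `i` and `j` are both last. This is the recursion that the divided commutator satisfies
modulo `ħ`. -/
theorem poissonBracket_succ {n m : ℕ} (a : Fin (n + 1) → ℤ) (b : Fin (m + 1) → ℤ)
    (x : Fin (n + 1) → A) (y : Fin (m + 1) → A) : poissonBracket br a b x y =
      poissonBracket br a (fun q => b q.castSucc) x (fun q => y q.castSucc) * ιT (y (Fin.last m))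
      + ((a (Fin.last n) - 1) * ∑ q, (b q - 1)).negOnePow •
        (poissonBracket br (fun p => a p.castSucc) b (fun p => x p.castSucc) y *
          ιT (x (Fin.last n)))
      + (a (Fin.last n) + (∑ q : Fin m, (b q.castSucc - 1)) * (a (Fin.last n) - 1)).negOnePow •
        (shuffleProd R (fun p => a p.castSucc) (fun q => b q.castSucc) (fun p => x p.castSucc)
          (fun q => y q.castSucc) * ιT (br (x (Fin.last n)) (y (Fin.last m)))) := by
  have hlast : poissonTerm br (letters (before a (Fin.last n)) (before x (Fin.last n)))
      (a (Fin.last n), x (Fin.last n)) [] (letters (before b (Fin.last m)) (before y (Fin.last m)))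
      (b (Fin.last m), y (Fin.last m)) [] =
      (a (Fin.last n) + (∑ q : Fin m, (b q.castSucc - 1)) * (a (Fin.last n) - 1)).negOnePow •
        (shuffleProd R (fun p => a p.castSucc) (fun q => b q.castSucc) (fun p => x p.castSucc)
          (fun q => y q.castSucc) * ιT (br (x (Fin.last n)) (y (Fin.last m)))) := by
    rw [poissonTerm, shiftedDegree_letters, shuffleProd_eq_shuffle, shuffle_nil_right,
      lettersWord_nil, mul_one, shiftedDegree_nil, add_zero, mul_zero, add_zero]
    rfl
  rw [← hlast, poissonBracket_eq_sum, poissonBracket_eq_sum, poissonBracket_eq_sum]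
  have hd : ∀ j : Fin m, shiftedDegree (letters (before (fun q => b q.castSucc) j)
      (before (fun q => y q.castSucc) j)) + (b j.castSucc - 1) +
        shiftedDegree (letters (after (fun q => b q.castSucc) j) (after (fun q => y q.castSucc) j) ++
          [(b (Fin.last m), y (Fin.last m))]) = ∑ q, (b q - 1) := fun j => by
    rw [← letters_after_castSucc]
    exact shiftedDegree_before_after b y j.castSucc
  have hd' : shiftedDegree (letters (before b (Fin.last m)) (before y (Fin.last m))) +
      (b (Fin.last m) - 1) = ∑ q, (b q - 1) := by
    rw [← shiftedDegree_before_after b y (Fin.last m), letters_after_last, shiftedDegree_nil,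
      add_zero]
  -- The sign of moving the last `x` to the end involves only the total degree of the second word,
  -- whatever `j` is.
  generalize ∑ q, (b q - 1) = D at hd hd' ⊢
  simp only [Fin.sum_univ_castSucc (n := n), Fin.sum_univ_castSucc (n := m), letters_after_last,
    letters_after_castSucc, letters_before_castSucc, poissonTerm_append_append, hd,
    poissonTerm_nil_append, poissonTerm_append_nil, hd', Finset.sum_add_distrib, add_mul,
    Finset.sum_mul, smul_add, Finset.smul_sum]
  abel

end ShuffleLists

section SemiclassicalLimit

variable {R : Type*} [CommRing R] {A : Type*} [AddCommGroup A] [Module R A]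

local notation "ιT" => TensorAlgebra.ι R

/-! ### The braces modulo the deformation parameter -/

theorem shuffleProd_succ {n m : ℕ} (a : Fin (n + 1) → ℤ) (b : Fin (m + 1) → ℤ)
    (x : Fin (n + 1) → A) (y : Fin (m + 1) → A) : shuffleProd R a b x y =
      shuffleProd R a (fun q => b q.castSucc) x (fun q => y q.castSucc) * ιT (y (Fin.last m)) +
        ((a (Fin.last n) - 1) * ∑ q, (b q - 1)).negOnePow •
          (shuffleProd R (fun p => a p.castSucc) b (fun p => x p.castSucc) y *
            ιT (x (Fin.last n))) := by
  rw [shuffleProd_eq_shuffle, shuffleProd_eq_shuffle, shuffleProd_eq_shuffle, letters_succ a x,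
    letters_succ b y, shuffle_append_singleton, ← letters_succ b y, shiftedDegree_letters]

theorem shuffleProd_zero_left {m : ℕ} (a : Fin 0 → ℤ) (b : Fin m → ℤ) (x : Fin 0 → A)
    (y : Fin m → A) : shuffleProd R a b x y = word R y := by
  rw [shuffleProd_eq_shuffle, letters_zero, shuffle_nil_left, lettersWord_letters]

theorem shuffleProd_zero_right {n : ℕ} (a : Fin n → ℤ) (b : Fin 0 → ℤ) (x : Fin n → A)
    (y : Fin 0 → A) : shuffleProd R a b x y = word R x := by
  rw [shuffleProd_eq_shuffle, letters_zero, shuffle_nil_right, lettersWord_letters]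

section

variable {t : R} (S : WeightedBraceAlgebra R t A)

theorem rescale_brace_ι (a b : A) : S.rescale.brace a (ιT b) = S.brace a (ιT b) := by
  rw [WeightedBraceAlgebra.rescale, rescaledBrace_apply _ (isWord_ι b)]
  simp [wt]

/-- Rescaling puts a factor `t` on every brace with at least two arguments and leaves the others
unchanged. -/
theorem rescale_brace_modEq (a : A) (w : TensorAlgebra R A) :
    ModEq t (S.rescale.brace a w) (decounit w • a + S.rescale.brace a (ιT (letter w))) := by
  rw [rescale_brace_ι]
  -- The witness is the brace of the part of `w` of length at least two.
  refine ⟨S.brace a (w - algebraMap R _ (decounit w) - ιT (letter w)), ?_⟩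
  have h : S.brace a (algebraMap R _ (decounit w)) = decounit w • a := by
    rw [Algebra.algebraMap_eq_smul_one, map_smul, S.brace_one]
  have hw : S.rescale.brace a w = S.brace a (weightScale t w) := rfl
  rw [map_sub, map_sub, h, hw, weightScale]
  simp only [LinearMap.add_apply, LinearMap.smul_apply, LinearMap.id_coe, id_eq, map_add, map_smul,
    LinearMap.comp_apply, AlgHom.toLinearMap_apply, Algebra.linearMap_apply, h]
  module

/-- One factor `t` comes from rescaling, a second one from the divisibility of the original braces.
-/
theorem rescale_brace_modEq_mul_self
    (hS : ∀ (n : ℕ) (x : A) (y : Fin (n + 1) → A), ∃ a, S.brace x (word R y) = t • a)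
    (a : A) (w : TensorAlgebra R A) : ModEq (t * t) (S.rescale.brace a w)
      (decounit w • a + S.rescale.brace a (ιT (letter w))) := by
  induction w using listWord_induction S.internal with
  | add v w hv hw =>
    refine ((ModEq.of_eq (by rw [map_add])).trans (hv.add hw)).trans (.of_eq ?_)
    simp only [map_add, add_smul]
    abel
  | smul r w hw =>
    refine ((ModEq.of_eq (by rw [map_smul])).trans (hw.smul r)).trans (.of_eq ?_)
    simp only [map_smul, smul_add, smul_smul, smul_eq_mul]
  | hom l hl =>
    match l with
    | [] => exact .of_eq (by simp [S.rescale.brace_one])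
    | [b] => exact .of_eq (by simp)
    | b :: c :: l =>
      obtain ⟨z, hz⟩ := hS (l.length + 1) a (b :: c :: l).get
      rw [word_eq_listWord, List.ofFn_get] at hz
      refine ⟨z, ?_⟩
      rw [decounit_listWord, letter_listWord (b :: c :: l) (by simp), WeightedBraceAlgebra.rescale,
        rescaledBrace_apply _ ⟨b :: c :: l, rfl, rfl⟩, hz]
      simp [wt, mul_smul]

end

variable (S : BraceAlgebra R A) {t : R}

/-- When `a{b}` vanishes modulo `t`, the quasi-shuffle recursion becomes that of the shuffle
product. -/
theorem barMul_word_modEq_shuffleProd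
    (hS : ∀ a w, ModEq t (S.brace a w) (decounit w • a + S.brace a (ιT (letter w))))
    (hι : ∀ a b, ModEq t (S.brace a (ιT b)) 0) {n m : ℕ} {a : Fin n → ℤ} {b : Fin m → ℤ}
    {x : Fin n → A} {y : Fin m → A} (hx : ∀ p, x p ∈ S.gr (a p)) (hy : ∀ q, y q ∈ S.gr (b q)) :
    ModEq t (barMul S (word R x) (word R y)) (shuffleProd R a b x y) := by
  induction n generalizing m with
  | zero => exact .of_eq (by simp [shuffleProd_zero_left])
  | succ n ihn =>
    induction m with
    | zero => exact .of_eq (by simp [shuffleProd_zero_right, barMul_one_right])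
    | succ m ihm =>
      have h1 := ihm (fun q => hy q.castSucc)
      have h2 := ihn (fun p => hx p.castSucc) hy
      have hw := word_mem_barGr (R := R) (fun q => hy (Fin.castSucc q))
      rw [word_succ x] at h1 ⊢
      rw [word_succ y] at h2 ⊢
      refine (barMul_mul_ι_mul_ι_modEq S hS (hx _) (hy _) _ hw).trans ?_
      rw [shuffleProd_succ, Fin.sum_univ_castSucc]
      refine ModEq.add (((h1.mul (.refl t _)).add (ModEq.units_smul
        ((ModEq.refl t _).mul ((hι _ _).map ιT)) _)).trans (.of_eq ?_))
          ((h2.mul (.refl t _)).units_smul _)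
      rw [map_zero, mul_zero, smul_zero, add_zero]

/-- Both orders of the product are expanded modulo `t²` by the quasi-shuffle recursion. The outer
terms pair up to `t` times brackets of shorter words. The middle terms differ by `t` times the term
with `{a, b}`, plus a commutator of `v` and `w` next to `b{a}`; the latter is divisible by `t²`, as
each of the two factors is divisible by `t`. Then `t` is cancelled. -/
theorem bracket_mul_ι_mul_ι_modEq
    (hS : ∀ a w, ModEq (t * t) (S.brace a w) (decounit w • a + S.brace a (ιT (letter w))))
    (hι : ∀ a b, ModEq t (S.brace a (ιT b)) 0)
    (ht : ∀ w : TensorAlgebra R A, t • w = 0 → w = 0) {brA : A →ₗ[R] A →ₗ[R] A}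
    (hbrA : ∀ i j a b, a ∈ S.gr i → b ∈ S.gr j → S.brace a (ιT b) =
      ((i - 1) * (j - 1)).negOnePow • S.brace b (ιT a) + t • i.negOnePow • brA a b)
    {br : TensorAlgebra R A →ₗ[R] TensorAlgebra R A →ₗ[R] TensorAlgebra R A}
    (hbr : ∀ p q v w, v ∈ barGr S.gr p → w ∈ barGr S.gr q →
      t • br v w = barMul S v w - (p * q).negOnePow • barMul S w v)
    {p q i j : ℤ} {a b : A} {v w : TensorAlgebra R A} (ha : a ∈ S.gr i) (hb : b ∈ S.gr j)
    (hv : v ∈ barGr S.gr p) (hw : w ∈ barGr S.gr q) :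
    ModEq t (br (v * ιT a) (w * ιT b)) (br (v * ιT a) w * ιT b +
      ((i - 1) * (q + (j - 1))).negOnePow • (br v (w * ιT b) * ιT a) +
        (i + q * (i - 1)).negOnePow • (barMul S v w * ιT (brA a b))) := by
  have hva := mul_ι_mem_barGr hv ha
  have hwb := mul_ι_mem_barGr hw hb
  have e1 := eq_add_of_sub_eq (hbr _ _ _ _ hva hw).symm
  have e2 := eq_add_of_sub_eq (hbr _ _ _ _ hv hwb).symm
  have e3 := eq_add_of_sub_eq (hbr _ _ _ _ hv hw).symm
  obtain ⟨z₁, h1⟩ := barMul_mul_ι_mul_ι_modEq S hS ha hb v hw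
  obtain ⟨z₂, h2⟩ := barMul_mul_ι_mul_ι_modEq S hS hb ha w hv
  obtain ⟨c, hc⟩ := hι b a
  rw [zero_add] at hc
  -- The first summand is the product of the two divisible factors, with `b{a} = t c`; `z₁` and `z₂`
  -- are the errors of the two expansions.
  refine ⟨((i - 1) * q).negOnePow • ((i - 1) * (j - 1)).negOnePow • (br v w * ιT c) + z₁ -
    ((p + (i - 1)) * (q + (j - 1))).negOnePow • z₂, sub_eq_zero.mp (ht _ ?_)⟩
  rw [smul_sub, hbr _ _ _ _ hva hwb, h1, h2, e1, e2, hbrA i j a b ha hb, hc, map_add,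
    mul_add (barMul S v w), e3]
  simp only [map_units_smul, map_smul, add_mul, smul_mul_assoc, mul_smul_comm, smul_add, smul_sub,
    smul_comm t (Int.negOnePow _), smul_smul (Int.negOnePow _), ← Int.negOnePow_add,
    smul_smul t t]
  rw [negOnePow_congr (i := p * (q + (j - 1)) + (i - 1) * (q + (j - 1)) + (j - 1) * (p + (i - 1)))
      (j := p * q + (i - 1) * q) ⟨(j - 1) * (p + (i - 1)), by ring⟩,
    negOnePow_congr (i := p * (q + (j - 1)) + (i - 1) * (q + (j - 1)) + (j - 1) * p)
      (j := (i - 1) * q + ((i - 1) * (j - 1) + p * q)) ⟨(j - 1) * p, by ring⟩,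
    show i + q * (i - 1) + p * q = (i - 1) * q + (i + p * q) by ring,
    show i + q * (i - 1) = (i - 1) * q + i by ring,
    show p * (q + (j - 1)) + (i - 1) * (q + (j - 1)) =
      (i - 1) * (q + (j - 1)) + p * (q + (j - 1)) by ring]
  abel

theorem bracket_word_modEq_poissonBracket
    (hS : ∀ a w, ModEq (t * t) (S.brace a w) (decounit w • a + S.brace a (ιT (letter w))))
    (hι : ∀ a b, ModEq t (S.brace a (ιT b)) 0)
    (ht : ∀ w : TensorAlgebra R A, t • w = 0 → w = 0) {brA : A →ₗ[R] A →ₗ[R] A}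
    (hbrA : ∀ i j a b, a ∈ S.gr i → b ∈ S.gr j → S.brace a (ιT b) =
      ((i - 1) * (j - 1)).negOnePow • S.brace b (ιT a) + t • i.negOnePow • brA a b)
    {br : TensorAlgebra R A →ₗ[R] TensorAlgebra R A →ₗ[R] TensorAlgebra R A}
    (hbr : ∀ p q v w, v ∈ barGr S.gr p → w ∈ barGr S.gr q →
      t • br v w = barMul S v w - (p * q).negOnePow • barMul S w v)
    {n m : ℕ} {a : Fin n → ℤ} {b : Fin m → ℤ} {x : Fin n → A} {y : Fin m → A}
    (hx : ∀ p, x p ∈ S.gr (a p)) (hy : ∀ q, y q ∈ S.gr (b q)) :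
    ModEq t (br (word R x) (word R y)) (poissonBracket brA a b x y) := by
  induction n generalizing m with
  | zero =>
    -- The empty word is the unit, hence central, so its brackets vanish after multiplication by `t`
    -- and thus vanish.
    refine .of_eq ((ht _ ?_).trans (by simp [poissonBracket]))
    rw [hbr _ _ _ _ (word_mem_barGr hx) (word_mem_barGr hy)]
    simp [barMul_one_right]
  | succ n ihn =>
    induction m with
    | zero =>
      refine .of_eq ((ht _ ?_).trans (by simp [poissonBracket]))
      rw [hbr _ _ _ _ (word_mem_barGr hx) (word_mem_barGr hy)]
      simp [barMul_one_right]
    | succ m ihm =>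
      have h1 := ihm (fun q => hy q.castSucc)
      have h2 := ihn (fun p => hx p.castSucc) hy
      have h3 := barMul_word_modEq_shuffleProd S (fun a w => (hS a w).dvd (Dvd.intro _ rfl)) hι
        (fun p => hx p.castSucc) (fun q => hy q.castSucc)
      have hv := word_mem_barGr (R := R) (fun p => hx (Fin.castSucc p))
      have hw := word_mem_barGr (R := R) (fun q => hy (Fin.castSucc q))
      rw [poissonBracket_succ, Fin.sum_univ_castSucc]
      refine ModEq.trans ?_ (((h1.mul (.refl t _)).add ((h2.mul (.refl t _)).units_smul _)).add
        ((h3.mul (.refl t _)).units_smul _))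
      rw [word_succ x, word_succ y]
      exact bracket_mul_ι_mul_ι_modEq S hS hι ht hbrA hbr (hx _) (hy _) hv hw

end SemiclassicalLimit

/-! ### Application to `𝔹𝔻₂`-algebras over `k⟦ħ⟧` -/

section BD2

variable {k : Type*} [Field k] {A : Type*} [AddCommGroup A] [Module k⟦X⟧ A]

local notation "ħ" => (PowerSeries.X : k⟦X⟧)
local notation "ιT" => TensorAlgebra.ι k⟦X⟧

variable (S : BD2Algebra k A)

/-- This is the relation for `ħ{a, b}` solved for `a{b}` and written in shifted degrees: the brace
with one argument is graded symmetric up to `ħ` times the bracket. -/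
theorem BD2Algebra.rescale_brace_ι_eq (i j : ℤ) (a b : A) (ha : a ∈ S.gr i) (hb : b ∈ S.gr j) :
    S.rescale.brace a (ιT b) =
      ((i - 1) * (j - 1)).negOnePow • S.rescale.brace b (ιT a) + ħ • i.negOnePow • S.bracket a b := by
  have h := S.hbar_bracket i j a b ha hb
  rw [word_one, word_one] at h
  rw [rescale_brace_ι, rescale_brace_ι, smul_comm, h]
  simp only [Matrix.cons_val_zero, smul_add, smul_smul, Int.units_mul_self, one_smul]
  rw [← Int.negOnePow_add, negOnePow_congr (i := (i - 1) * (j - 1))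
    (j := i + j * (i + 1) + 1) ⟨-(i + j), by ring⟩, Int.negOnePow_succ, Units.neg_smul]
  abel

theorem BD2Algebra.barMul_comm_modEq {p q : ℤ} {v w : TensorAlgebra k⟦X⟧ A}
    (hv : v ∈ barGr S.gr p) (hw : w ∈ barGr S.gr q) : ModEq ħ (barMul S.rescale v w)
      ((p * q).negOnePow • barMul S.rescale w v) :=
  BDBar.barMul_comm_modEq S.rescale (rescale_brace_modEq _)
    (fun i j a b ha hb => ⟨_, S.rescale_brace_ι_eq i j a b ha hb⟩) hv hw

theorem BD2Algebra.exists_commutator_eq (p q : ℤ) (v w : TensorAlgebra k⟦X⟧ A)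
    (hv : v ∈ barGr S.gr p) (hw : w ∈ barGr S.gr q) :
    ∃ z, barMul S.rescale v w - (p * q).negOnePow • barMul S.rescale w v = ħ • z := by
  obtain ⟨z, hz⟩ := S.barMul_comm_modEq hv hw
  exact ⟨z, by rw [hz, add_sub_cancel_left]⟩

theorem exists_bracket {B : Type*} [AddCommGroup B] [Module k⟦X⟧ B] [Module.Flat k⟦X⟧ B]
    (D : DGBialgebra k⟦X⟧ B) (h : ∀ i j u v, u ∈ D.gr i → v ∈ D.gr j →
      ∃ w, D.mul u v - (i * j).negOnePow • D.mul v u = ħ • w) :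
    ∃ E : BD1Bialgebra k B, E.toDGBialgebra = D ∧
      ∀ br : B →ₗ[k⟦X⟧] B →ₗ[k⟦X⟧] B, (∀ i j u v, u ∈ D.gr i → v ∈ D.gr j →
        ħ • br u v = D.mul u v - (i * j).negOnePow • D.mul v u) → br = E.bracket := by
  obtain ⟨f, hf⟩ := exists_bilinear_smul_eq (fun b hb => eq_zero_of_X_smul_eq_zero b hb)
    (commutator D.toDGA) (exists_commutator_eq D.toDGA h)
  -- Flatness of `B` gives absence of `ħ`-torsion in `B` and in `B ⊗ B`; the latter is needed for
  -- the compatibility with the coproduct.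
  refine ⟨D.toBD1Bialgebra eq_zero_of_X_smul_eq_zero eq_zero_of_X_smul_eq_zero f hf, rfl,
    fun br hbr => ?_⟩
  refine linearMap_ext_homogeneous D.internal fun i u hu => ?_
  refine linearMap_ext_homogeneous D.internal fun j v hv => ?_
  refine sub_eq_zero.mp (eq_zero_of_X_smul_eq_zero (k := k) _ ?_)
  rw [smul_sub, hbr i j u v hu hv, ← commutator_apply D.toDGA hu hv, ← hf]
  exact sub_self _

theorem BD2Algebra.semiclassical_limit [Module.Flat k⟦X⟧ A]
    (hS : ∀ (n : ℕ) (x : A) (y : Fin (n + 1) → A), ∃ a, S.brace x (word k⟦X⟧ y) = ħ • a)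
    {br : TensorAlgebra k⟦X⟧ A →ₗ[k⟦X⟧] TensorAlgebra k⟦X⟧ A →ₗ[k⟦X⟧] TensorAlgebra k⟦X⟧ A}
    (hbr : ∀ p q v w, v ∈ barGr S.gr p → w ∈ barGr S.gr q →
      ħ • br v w = barMul S.rescale v w - (p * q).negOnePow • barMul S.rescale w v)
    {n m : ℕ} {a : Fin n → ℤ} {b : Fin m → ℤ} {x : Fin n → A} {y : Fin m → A}
    (hx : ∀ p, x p ∈ S.gr (a p)) (hy : ∀ q, y q ∈ S.gr (b q)) :
    ModEq ħ (barMul S.rescale (word k⟦X⟧ x) (word k⟦X⟧ y)) (shuffleProd k⟦X⟧ a b x y) ∧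
      ModEq ħ (br (word k⟦X⟧ x) (word k⟦X⟧ y)) (poissonBracket S.bracket a b x y) := by
  have hι : ∀ a b, ModEq ħ (S.rescale.brace a (ιT b)) 0 := fun a b => by
    obtain ⟨z, hz⟩ := hS 0 a ![b]
    rw [word_one] at hz
    exact ⟨z, by rw [rescale_brace_ι, zero_add, ← hz]; rfl⟩
  exact ⟨barMul_word_modEq_shuffleProd S.rescale (rescale_brace_modEq _) hι hx hy,
    bracket_word_modEq_poissonBracket S.rescale (rescale_brace_modEq_mul_self _ hS) hι
      (fun w hw => eq_zero_of_X_smul_eq_zero w hw) S.rescale_brace_ι_eq hbr hx hy⟩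

end BD2

end BDBar

end

theorem mainTheorem11 {k : Type*} [Field k] [CharZero k]
    {A : Type*} [AddCommGroup A] [Module k⟦X⟧ A] (S : BDBar.BD2Algebra k A) :
    -- the formulas for the differential, product and coproduct define a dg bialgebra
    (∃! D : BDBar.DGBialgebra k⟦X⟧ (TensorAlgebra k⟦X⟧ A),
      BDBar.IsBarBialgebra S.toWeightedBraceAlgebra D) ∧
    ∀ D : BDBar.DGBialgebra k⟦X⟧ (TensorAlgebra k⟦X⟧ A),
      BDBar.IsBarBialgebra S.toWeightedBraceAlgebra D →
      -- commutators are divisible by `ħ`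
      (∀ i j u v, u ∈ D.gr i → v ∈ D.gr j →
        ∃ w, D.mul u v - (i * j).negOnePow • D.mul v u = (PowerSeries.X : k⟦X⟧) • w) ∧
      -- if division by `ħ` is unambiguous, the quotient makes it a `𝔹𝔻₁`-algebra, compatibly with
      -- the coalgebra structure
      ((∀ a : A, (PowerSeries.X : k⟦X⟧) • a = 0 → a = 0) →
        ∃ B : BDBar.BD1Bialgebra k (TensorAlgebra k⟦X⟧ A),
          B.toDGBialgebra = D ∧
          (∀ br : TensorAlgebra k⟦X⟧ A →ₗ[k⟦X⟧] TensorAlgebra k⟦X⟧ A →ₗ[k⟦X⟧] TensorAlgebra k⟦X⟧ A,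
            (∀ i j u v, u ∈ D.gr i → v ∈ D.gr j → (PowerSeries.X : k⟦X⟧) • br u v =
              D.mul u v - (i * j).negOnePow • D.mul v u) → br = B.bracket) ∧
          -- if the braces vanish modulo `ħ`, then modulo `ħ` one gets the `ℙ₁`-bialgebra attached
          -- to a `ℙ₂`-algebra
          ((∀ (n : ℕ) (x : A) (y : Fin (n + 1) → A),
              ∃ a, S.brace x (BDBar.word k⟦X⟧ y) = (PowerSeries.X : k⟦X⟧) • a) →
            ∀ (n m : ℕ) (a : Fin n → ℤ) (b : Fin m → ℤ) (x : Fin n → A) (y : Fin m → A),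
              (∀ p, x p ∈ S.gr (a p)) → (∀ q, y q ∈ S.gr (b q)) →
              (∃ w, B.mul (BDBar.word k⟦X⟧ x) (BDBar.word k⟦X⟧ y) =
                BDBar.shuffleProd k⟦X⟧ a b x y + (PowerSeries.X : k⟦X⟧) • w) ∧
              (∃ w, B.bracket (BDBar.word k⟦X⟧ x) (BDBar.word k⟦X⟧ y) =
                BDBar.poissonBracket S.bracket a b x y + (PowerSeries.X : k⟦X⟧) • w))) ∧
      -- it is the dg bialgebra of a brace algebra, with braces `ħ^(wt n) x{y₁,...,yₙ}`
      ∃ S' : BDBar.BraceAlgebra k⟦X⟧ A,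
        S'.toDGA = S.toDGA ∧
        (∀ (n : ℕ) (x : A) (y : Fin n → A), S'.brace x (BDBar.word k⟦X⟧ y) =
          (PowerSeries.X : k⟦X⟧) ^ BDBar.wt n • S.brace x (BDBar.word k⟦X⟧ y)) ∧
        BDBar.IsBarBialgebra S' D := by
  -- The bialgebra of the rescaled brace algebra realizes the formulas with `ħ`. By uniqueness it is
  -- the only one, so all remaining claims are about `barMul S.rescale`.
  have hD₀ : BDBar.IsBarBialgebra S.toWeightedBraceAlgebra (BDBar.barBialgebra S.rescale) :=
    BDBar.isBarBialgebra_rescale_iff.mp (BDBar.isBarBialgebra_barBialgebra S.rescale)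
  refine ⟨⟨_, hD₀, fun D hD => hD.unique hD₀⟩, fun D hD => ?_⟩
  obtain rfl : D = BDBar.barBialgebra S.rescale := hD.unique hD₀
  have hcomm := S.exists_commutator_eq
  refine ⟨hcomm, fun hA => ?_, S.rescale, rfl,
    fun n x y => BDBar.rescaledBrace_apply _ (BDBar.isWord_word y) x,
    BDBar.isBarBialgebra_rescale_iff.mpr hD⟩
  -- Flatness of `A` passes to its tensor algebra, where the commutators are divided.
  have := BDBar.flat_of_X_smul_eq_zero hA
  obtain ⟨E, hE, hbr⟩ := BDBar.exists_bracket (BDBar.barBialgebra S.rescale) hcomm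
  refine ⟨E, hE, hbr, fun hS n m a b x y hx hy => ?_⟩
  have hEbr := E.hbar_bracket
  have hmul : E.mul = BDBar.barMul S.rescale := congrArg (fun D => D.mul) hE
  have hgr : E.gr = BDBar.barGr S.gr := congrArg (fun D => D.gr) hE
  rw [hgr, hmul] at hEbr
  rw [hmul]
  exact S.semiclassical_limit hS hEbr hx hy
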